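/- Let $q\in\mathbb C$, $0<|q|<1$, let $M\ge 0$ be an integer, and write $(a)_\infty=\prod_{n\ge0}(1-aq^n)$, $\int_0^\tau f(t)\,d_qt=(1-q)\sum_{n\ge 0}f(\tau q^n)\tau q^n$, $\int_{\tau_1}^{\tau_2}=\int_0^{\tau_2}-\int_0^{\tau_1}$. Let $(a,b)=(a_1,\dots,a_{M+3},b_1,\dots,b_{M+3})$ be complex parameters with $$a_1\cdots a_{M+3}=q^2\,b_1\cdots b_{M+3},$$ let $T_{a_k}$, $T_{b_k}$ be the operators $a_k\mapsto qa_k$, $b_k\mapsto qb_k$ on functions of $(a,b)$ (only products preserving this relation, called admissible, are used), and put $$\varphi_{i,j}=\int_{q/a_i}^{q/a_j}\prod_{k=1}^{M+3}\frac{(a_kt)_\infty}{(b_kt)_\infty}\,d_qt\qquad(1\le i,j\le M+3).$$ Put $T=T_{a_1}T_{b_1}$, let $e_k$ be the elementary symmetric function of degree $k$, $\hat a=(a_2,\dots,a_{M+3})$, $\hat b=(b_2,\dots,b_{M+3})$, and $$\begin{aligned}\hat E_M&=b_1^{M+2}T^{-1}\prod_{i=0}^{M}\Bigl(1-\tfrac{a_1q^i}{b_1}T\Bigr)\\&\quad+\sum_{k=1}^{M+1}(-1)^kb_1^{M+2-k}\bigl[e_k(\hat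 a)T^{-1}-q\,e_k(\hat b)\bigr]\prod_{i=0}^{M-k}\Bigl(1-\tfrac{a_1q^i}{b_1}T\Bigr)\prod_{i=0}^{k-2}(1-q^{-i}T)\\&\quad+(-1)^Ma_2\cdots a_{M+3}\,T^{-1}\prod_{i=0}^{M}(1-q^{-i}T).\end{aligned}$$ Let $q\text{-}RP^M$ be the following system for a function $y$ of $(a,b)$, where $2\le k\ne l\le M+3$: $$\begin{aligned} &\hat E_M\,y=0,\\ &[(a_1-a_kq)T_{a_k}T_{a_l}^{-1}-(a_l-a_kq)T_{a_k}T_{a_1}^{-1}+(a_l-a_1)]y=0,\\ &[(b_1-a_1)T_{a_1}T_{a_k}^{-1}-(q^{-1}a_k-a_1)T_{a_1}T_{b_1}+(q^{-1}a_k-b_1)]y=0,\\ &[(b_1-q^{-1}b_l)T_{b_k}T_{b_l}^{-1}-(b_k-q^{-1}b_l)T_{b_1}T_{b_l}^{-1}+(b_k-b_1)]y=0,\\ &[(a_1-b_1)T_{b_k}T_{b_1}^{-1}-(b_kq-b_1)(T_{a_1}T_{b_1})^{-1}+(b_kq-a_1)]y=0,\\ &[(b_1-a_k)T_{a_k}T_{b_l}-(b_l-a_k)T_{a_k}T_{b_1}+(b_l-b_1)]y=0,\\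 &[(b_l-a_1)T_{a_k}^{-1}T_{b_l}^{-1}-(b_l-a_k)T_{a_1}^{-1}T_{b_l}^{-1}+(a_1-a_k)]y=0,\\ &\Bigl(q\prod_{k=1}^{M+3}T_{a_k}T_{b_k}-1\Bigr)y=0. \end{aligned}$$ (1) Let $1\le i,j\le M+3$. For all $(a,b)$ satisfying the relation above with $b_1\neq0$, $a_i,a_j\ne0$ and $a_i,a_j\notin b_kq^{\mathbb Z}$ for all $k$, the series defining $\varphi_{i,j}$ converge absolutely, and $\varphi_{i,j}$ satisfies $q\text{-}RP^M$ at $(a,b)$. (2) The rank of $q\text{-}RP^M$ is $M+1$. Here solutions are functions that satisfy the system at all points $(a,b)$ of the set $D$ of parameters satisfying the relation above with all $a_i,b_k\neq0$ and $a_i\notin b_kq^{\mathbb Z}$ for all $i,k$; they may be taken in any class $Y$ of functions that contains all $\varphi_{i,j}$. Let $F$ be the field of rational functions on the hypersurface $a_1\cdots a_{M+3}=q^2b_1\cdots b_{M+3}$, i.e. $F=\mathbb C(a_1,\dots,a_{M+2},b_1,\dots,b_{M+3})$, and let $S$ be any set of admissible products of the $T_{a_k}^{\pm1},T_{b_k}^{\pm1}$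 that contains $T_{a_1}T_{b_1}$ (for example the set of the operators that occur in the system, or the set of all admissible products). Then $$\dim_F\bigl(\mathrm{span}_F\{\sigma^n y\mid \sigma\in S,\ n\in\mathbb Z\}/{\sim}\bigr)=M+1,$$ where the $\sigma^ny$ are formal expressions and $A(y)\sim B(y)$ means that $A(y)-B(y)$, multiplied by a common denominator of its coefficients, vanishes on $D$ for every solution $y$. -/

import Mathlib

open Finset

noncomputable section

namespace QRP

/-- `(a)_∞ = ∏_{n ≥ 0} (1 - a q^n)`. -/
def qPoch (q a : ℂ) : ℂ := ∏' n : ℕ, (1 - a * q ^ n)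

/-- The `n`-th term of the Jackson integral `∫_0^τ f(t) d_q t`. -/
def jacksonTerm (q τ : ℂ) (f : ℂ → ℂ) (n : ℕ) : ℂ := f (τ * q ^ n) * (τ * q ^ n)

/-- `∫_0^τ f(t) d_q t = (1 - q) ∑_{n ≥ 0} f(τ q^n) τ q^n`. -/
def jacksonZero (q τ : ℂ) (f : ℂ → ℂ) : ℂ := (1 - q) * ∑' n : ℕ, jacksonTerm q τ f n

/-- `∫_{τ₁}^{τ₂} f(t) d_q t`. -/
def jackson (q τ₁ τ₂ : ℂ) (f : ℂ → ℂ) : ℂ := jacksonZero q τ₂ f - jacksonZero q τ₁ f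

/-- A pair `(a, b)` of parameter vectors of length `M + 3`.
The index `0 : Fin (M + 3)` stands for the index `1` of the usual notation `a₁, …, a_{M+3}`. -/
abbrev Param (M : ℕ) : Type := (Fin (M + 3) → ℂ) × (Fin (M + 3) → ℂ)

/-- The lattice of exponents: `s` stands for `∏ T_{a_i}^{s.1 i} ∏ T_{b_i}^{s.2 i}`,
with the group law written additively. -/
abbrev Shift (M : ℕ) : Type := (Fin (M + 3) → ℤ) × (Fin (M + 3) → ℤ)

/-- The exponent of `T_{a_k}`. -/
def sA {M : ℕ} (k : Fin (M + 3)) : Shift M := (Pi.single k 1, 0)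

/-- The exponent of `T_{b_k}`. -/
def sB {M : ℕ} (k : Fin (M + 3)) : Shift M := (0, Pi.single k 1)

/-- The shifts which preserve the relation `a₁ ⋯ a_{M+3} = q² b₁ ⋯ b_{M+3}`. -/
def admissible (M : ℕ) : Set (Shift M) := {s | ∑ i, s.1 i = ∑ i, s.2 i}

/-- `a_i ↦ q^{s.1 i} a_i`, `b_i ↦ q^{s.2 i} b_i`. -/
def shiftPoint {M : ℕ} (q : ℂ) (s : Shift M) (x : Param M) : Param M :=
  (fun i => q ^ s.1 i * x.1 i, fun i => q ^ s.2 i * x.2 i)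

/-- The `q`-shift operator with exponent `s`, acting on functions of `(a, b)`. -/
def T {M : ℕ} (q : ℂ) (s : Shift M) : Module.End ℂ (Param M → ℂ) where
  toFun y := fun x => y (shiftPoint q s x)
  map_add' _ _ := rfl
  map_smul' _ _ := rfl

/-- Multiplication by a function of `(a, b)`. -/
def mulOp {M : ℕ} (f : Param M → ℂ) : Module.End ℂ (Param M → ℂ) := LinearMap.mulLeft ℂ f

/-- The integrand `∏_k (a_k t)_∞ / (b_k t)_∞`. -/
def integrand {M : ℕ} (q : ℂ) (x : Param M) (t : ℂ) : ℂ :=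
  ∏ k, qPoch q (x.1 k * t) / qPoch q (x.2 k * t)

/-- The Jackson integral of Riemann--Papperitz type `φ_{i,j}`, as a function of `(a, b)`. -/
def phi {M : ℕ} (q : ℂ) (i j : Fin (M + 3)) : Param M → ℂ := fun x =>
  jackson q (q / x.1 i) (q / x.1 j) (integrand q x)

/-- The parameters with `a₁ ⋯ a_{M+3} = q² b₁ ⋯ b_{M+3}` for which no denominator vanishes in
the Jackson integrals with end points `q / a_i`, `i ∈ I`, in their `q`-shifts, and in the
ratio `a₁ / b₁`. It is stable under the admissible shifts. -/
def domain {M : ℕ} (q : ℂ) (I : Set (Fin (M + 3))) : Set (Param M) :=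
  {x | ∏ i, x.1 i = q ^ 2 * ∏ i, x.2 i ∧ x.2 0 ≠ 0 ∧
    ∀ i ∈ I, x.1 i ≠ 0 ∧ ∀ (k : Fin (M + 3)) (n : ℤ), x.2 k * q ^ n ≠ x.1 i}

/-- The elementary symmetric function `e_k(v₂, …, v_{M+3})` of all entries but the first. -/
def eHat {M : ℕ} (k : ℕ) (v : Fin (M + 3) → ℂ) : ℂ :=
  ∑ s ∈ (univ.erase (0 : Fin (M + 3))).powersetCard k, ∏ i ∈ s, v i

/-- `∏_{i=0}^{n-1} (1 - (a₁ q^i / b₁) T)` with `T = T_{a₁} T_{b₁}`. -/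
def prodP {M : ℕ} (q : ℂ) (n : ℕ) : Module.End ℂ (Param M → ℂ) :=
  ((List.range n).map fun i =>
    1 - mulOp (fun x : Param M => x.1 0 * q ^ i / x.2 0) * T q (sA 0 + sB 0)).prod

/-- `∏_{i=0}^{n-1} (1 - q^{-i} T)` with `T = T_{a₁} T_{b₁}`. -/
def prodQ {M : ℕ} (q : ℂ) (n : ℕ) : Module.End ℂ (Param M → ℂ) :=
  ((List.range n).map fun i => 1 - mulOp (fun _ : Param M => (q ^ i)⁻¹) * T q (sA 0 + sB 0)).prod

/-- The operator `Ê_M`. -/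
def hatE (M : ℕ) (q : ℂ) : Module.End ℂ (Param M → ℂ) :=
  mulOp (fun x => x.2 0 ^ (M + 2)) * T q (-(sA 0 + sB 0)) * prodP q (M + 1)
  + ∑ k ∈ Icc 1 (M + 1),
      mulOp (fun x => (-1) ^ k * x.2 0 ^ (M + 2 - k)) *
        (mulOp (fun x => eHat k x.1) * T q (-(sA 0 + sB 0)) - mulOp (fun x => q * eHat k x.2)) *
        prodP q (M + 1 - k) * prodQ q (k - 1)
  + mulOp (fun x => (-1) ^ M * ∏ i ∈ univ.erase 0, x.1 i) * T q (-(sA 0 + sB 0)) * prodQ q (M + 1)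

/-- `y` satisfies the system `q-RP^M` at every point of `Ω`. -/
structure SatisfiesRP {M : ℕ} (q : ℂ) (Ω : Set (Param M)) (y : Param M → ℂ) : Prop where
  ordinary : ∀ x ∈ Ω, hatE M q y x = 0
  three₁ : ∀ x ∈ Ω, ∀ k l : Fin (M + 3), k ≠ 0 → l ≠ 0 → k ≠ l →
    (x.1 0 - x.1 k * q) * T q (sA k - sA l) y x
      - (x.1 l - x.1 k * q) * T q (sA k - sA 0) y x + (x.1 l - x.1 0) * y x = 0
  three₂ : ∀ x ∈ Ω, ∀ k : Fin (M + 3), k ≠ 0 →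
    (x.2 0 - x.1 0) * T q (sA 0 - sA k) y x
      - (q⁻¹ * x.1 k - x.1 0) * T q (sA 0 + sB 0) y x + (q⁻¹ * x.1 k - x.2 0) * y x = 0
  three₃ : ∀ x ∈ Ω, ∀ k l : Fin (M + 3), k ≠ 0 → l ≠ 0 → k ≠ l →
    (x.2 0 - q⁻¹ * x.2 l) * T q (sB k - sB l) y x
      - (x.2 k - q⁻¹ * x.2 l) * T q (sB 0 - sB l) y x + (x.2 k - x.2 0) * y x = 0
  three₄ : ∀ x ∈ Ω, ∀ k : Fin (M + 3), k ≠ 0 →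
    (x.1 0 - x.2 0) * T q (sB k - sB 0) y x
      - (x.2 k * q - x.2 0) * T q (-(sA 0 + sB 0)) y x + (x.2 k * q - x.1 0) * y x = 0
  three₅ : ∀ x ∈ Ω, ∀ k l : Fin (M + 3), k ≠ 0 → l ≠ 0 → k ≠ l →
    (x.2 0 - x.1 k) * T q (sA k + sB l) y x
      - (x.2 l - x.1 k) * T q (sA k + sB 0) y x + (x.2 l - x.2 0) * y x = 0
  three₆ : ∀ x ∈ Ω, ∀ k l : Fin (M + 3), k ≠ 0 → l ≠ 0 → k ≠ l →
    (x.2 l - x.1 0) * T q (-sA k - sB l) y x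
      - (x.2 l - x.1 k) * T q (-sA 0 - sB l) y x + (x.1 0 - x.1 k) * y x = 0
  total : ∀ x ∈ Ω, q * T q (∑ k, (sA k + sB k)) y x - y x = 0

/-- Polynomials in the independent coordinates `a₁, …, a_{M+2}, b₁, …, b_{M+3}` on the
hypersurface `a₁ ⋯ a_{M+3} = q² b₁ ⋯ b_{M+3}`. -/
abbrev Poly (M : ℕ) : Type := MvPolynomial (Fin (M + 2) ⊕ Fin (M + 3)) ℂ

/-- The field of rational functions on the hypersurface `a₁ ⋯ a_{M+3} = q² b₁ ⋯ b_{M+3}`, on which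
`a_{M+3} = q² b₁ ⋯ b_{M+3} / (a₁ ⋯ a_{M+2})`. -/
abbrev RatFun (M : ℕ) : Type := FractionRing (Poly M)

/-- The value of a polynomial at `(a, b)`. -/
def evalAt {M : ℕ} (x : Param M) : Poly M →+* ℂ :=
  MvPolynomial.eval (Sum.elim (fun i : Fin (M + 2) => x.1 i.castSucc) x.2)

/-- The operator `∑ P_s T^s` with polynomial coefficients kills every `y ∈ Sol` on `Ω`. -/
def Kills {M : ℕ} (q : ℂ) (Ω : Set (Param M)) (Sol : Set (Param M → ℂ))
    (P : Shift M →₀ Poly M) : Prop :=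
  ∀ y ∈ Sol, ∀ x ∈ Ω, (P.sum fun s p => evalAt x p * T q s y x) = 0

theorem Kills.add {M : ℕ} {q : ℂ} {Ω : Set (Param M)} {Sol : Set (Param M → ℂ)}
    {P Q : Shift M →₀ Poly M} (hP : Kills q Ω Sol P) (hQ : Kills q Ω Sol Q) :
    Kills q Ω Sol (P + Q) := by
  intro y hy x hx
  rw [Finsupp.sum_add_index' (by simp) (by intros; simp [add_mul]), hP y hy x hx, hQ y hy x hx,
    add_zero]

theorem Kills.smul {M : ℕ} {q : ℂ} {Ω : Set (Param M)} {Sol : Set (Param M → ℂ)}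
    {P : Shift M →₀ Poly M} (c : Poly M) (hP : Kills q Ω Sol P) :
    Kills q Ω Sol (c • P) := by
  intro y hy x hx
  rw [Finsupp.sum_smul_index' (by simp)]
  have h := hP y hy x hx
  simp only [Finsupp.sum, smul_eq_mul, map_mul, mul_assoc] at h ⊢
  rw [← Finset.mul_sum, h, mul_zero]

/-- The operator with rational function coefficients attached to one with polynomial ones. -/
def toRat {M : ℕ} : (Shift M →₀ Poly M) →ₗ[Poly M] (Shift M →₀ RatFun M) :=
  Finsupp.mapRange.linearMap (Algebra.linearMap (Poly M) (RatFun M))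

/-- The relation `A ∼ 0`: the formal expressions `A(y) = ∑ c_s T^s y` with coefficients in the
rational function field such that `A(y) = 0` for every solution `y ∈ Sol`, as an
identity of functions on `Ω` after multiplication by a common denominator `d` of the `c_s`. -/
def vanishing {M : ℕ} (q : ℂ) (Ω : Set (Param M)) (Sol : Set (Param M → ℂ)) :
    Submodule (RatFun M) (Shift M →₀ RatFun M) where
  carrier := {A | ∃ d : Poly M, d ≠ 0 ∧ ∃ P : Shift M →₀ Poly M,
    algebraMap (Poly M) (RatFun M) d • A = toRat P ∧ Kills q Ω Sol P}
  zero_mem' := ⟨1, one_ne_zero, 0, by simp, by intro y _ x _; simp⟩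
  add_mem' := by
    rintro A B ⟨d, hd, P, hA, hP⟩ ⟨e, he, Q, hB, hQ⟩
    refine ⟨d * e, mul_ne_zero hd he, e • P + d • Q, ?_, (hP.smul e).add (hQ.smul d)⟩
    rw [map_add, map_smul, map_smul, ← hA, ← hB, smul_add, map_mul, mul_smul, mul_smul,
      algebraMap_smul, algebraMap_smul, algebraMap_smul, algebraMap_smul, algebraMap_smul,
      smul_comm d e A]
  smul_mem' := by
    rintro c A ⟨d, hd, P, hA, hP⟩
    obtain ⟨u, v, hv, rfl⟩ := IsFractionRing.div_surjective (A := Poly M) c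
    have hv0 : v ≠ 0 := nonZeroDivisors.ne_zero hv
    refine ⟨v * d, mul_ne_zero hv0 hd, u • P, ?_, hP.smul u⟩
    have hv1 : algebraMap (Poly M) (RatFun M) v ≠ 0 := by
      simpa using hv0
    rw [map_smul, ← hA, ← algebraMap_smul (RatFun M) u, smul_smul, smul_smul, map_mul]
    congr 1
    field_simp

/-- The span over the rational function field of the formal expressions `τ^i y`,
`τ ∈ S`, `i ∈ ℤ`. -/
def powerSpan {M : ℕ} (S : Set (Shift M)) : Submodule (RatFun M) (Shift M →₀ RatFun M) :=
  Submodule.span (RatFun M) {A | ∃ s ∈ S, ∃ i : ℤ, A = Finsupp.single (i • s) 1}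

/-- A system in the shifts `S`, with set of solutions `Sol` on `Ω`, has rank `r`:
`dim (span {τ^i y | τ ∈ S, i ∈ ℤ} / ∼) = r`, where `span / ∼` is the image of the span in the
quotient of all formal expressions by those that are `∼ 0`. -/
def HasRank {M : ℕ} (q : ℂ) (Ω : Set (Param M)) (Sol : Set (Param M → ℂ)) (S : Set (Shift M))
    (r : ℕ) : Prop :=
  Module.rank (RatFun M) ((powerSpan S).map (vanishing q Ω Sol).mkQ) = r

end QRP

end

/-! Solutions. The factor $(a_it)_\infty$ vanishes at $t=q^n/a_i$ for $n\le 0$, so $\int_0^{q/a_i}$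
is a bilateral sum over the lattice $q^{\mathbb Z}/a_i$. A parameter shift does not change this
lattice (`hasSum_jacksonSum`), so every operator may be applied to the integrand. The three-term
relations then become identities between affine functions of $t$, and the last equation is the
substitution $t\mapsto qt$. For $\hat E_M$, $t$ times the image of the integrand is a $q$-difference
in $t$ (`hatE_integrand`). Its sum is a boundary term at $t=0$ that does not depend on $i$
(`hatE_jacksonSum`), so it cancels in $\varphi_{i,j}$.

Upper bound for the rank. $\hat E_MT$ is a polynomial of degree $M+1$ in $T$, and its two extreme
coefficients factor and have no zero on $D$. Hence every $T^ny$ lies in the span of the window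
$y,Ty,\dots,T^My$ (`shiftClass_mem_windowSpan`), and likewise after any admissible shift. Two of the
three-term relations show that shifting by $T_{a_1}T_{a_k}^{-1}$ or $T_{b_k}T_{b_1}^{-1}$ maps a
window into its span. Once all windows are known to be linearly independent, equality of dimensions
turns these inclusions into equalities. Together with $T$ these shifts generate all admissible ones,
so there is only one window space (`windowSpan_eq`).

Lower bound. Take the matrix of $T^n\varphi_{1,i}$, $0\le n\le M$, $2\le i\le M+2$, near a point
with $a_i=qb_i$ for these $i$. After row $i$ is multiplied by $1-qb_i/a_i$, only the first term of
the Jackson sum survives in the limit. A kernel vector of the limit matrix gives a polynomial of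
degree at most $M$ with the $M+1$ distinct roots $q/a_i$; it is zero, and the polynomials being
combined are independent (`IsPolar.det_casoratian_ne_zero`). Nonvanishing of the determinant
persists nearby, which rules out any relation with rational coefficients
(`eq_zero_of_sum_phi_eq_zero`). -/

namespace QRP

open Filter Topology

/-! ### The infinite product `(a)_∞` -/

section Pochhammer

variable {q : ℂ}

theorem summable_norm_mul_pow (hq1 : ‖q‖ < 1) (a : ℂ) : Summable fun n : ℕ => ‖-(a * q ^ n)‖ := by
  simpa [norm_mul, norm_pow] using
    (summable_geometric_of_lt_one (norm_nonneg q) hq1).mul_left ‖a‖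

theorem multipliable_qPoch (hq1 : ‖q‖ < 1) (a : ℂ) : Multipliable fun n : ℕ => 1 - a * q ^ n := by
  simpa [sub_eq_add_neg] using multipliable_one_add_of_summable (summable_norm_mul_pow hq1 a)

theorem qPoch_eq_mul (hq1 : ‖q‖ < 1) (a : ℂ) : qPoch q a = (1 - a) * qPoch q (q * a) := by
  have e : ∀ n : ℕ, 1 - a * q ^ (n + 1) = 1 - q * a * q ^ n := fun n => by ring
  have h : Multipliable fun n : ℕ => 1 - a * q ^ (n + 1) := by
    simpa only [e] using multipliable_qPoch hq1 (q * a)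
  have h1 := tprod_eq_zero_mul' (f := fun n : ℕ => 1 - a * q ^ n) h
  simpa only [qPoch, e, pow_zero, mul_one] using h1

theorem qPoch_ne_zero (hq1 : ‖q‖ < 1) {a : ℂ} (h : ∀ n : ℕ, a * q ^ n ≠ 1) : qPoch q a ≠ 0 := by
  have := tprod_one_add_ne_zero_of_summable (f := fun n : ℕ => -(a * q ^ n))
    (fun n hn => h n (by linear_combination -hn)) (summable_norm_mul_pow hq1 a)
  simpa [qPoch, sub_eq_add_neg] using this

theorem qPoch_eq_zero (hq1 : ‖q‖ < 1) {a : ℂ} (n : ℕ) (h : a * q ^ n = 1) : qPoch q a = 0 := by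
  induction n generalizing a with
  | zero => rw [qPoch_eq_mul hq1, show a = 1 by simpa using h]; simp
  | succ n ih => rw [qPoch_eq_mul hq1, ih (a := q * a) (by rw [← h]; ring), mul_zero]

theorem qPoch_zero : qPoch q 0 = 1 := by simp [qPoch]

theorem qPoch_q_ne_zero (hq1 : ‖q‖ < 1) : qPoch q q ≠ 0 := by
  refine qPoch_ne_zero hq1 fun n h => ?_
  have : ‖q * q ^ n‖ < 1 := by
    rw [← pow_succ', norm_pow]
    exact pow_lt_one₀ (norm_nonneg _) hq1 (by simp)
  simp [h] at this

theorem continuous_qPoch (hq1 : ‖q‖ < 1) : Continuous (qPoch q) := by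
  rw [continuous_iff_continuousAt]
  intro a
  have h := (((summable_geometric_of_lt_one (norm_nonneg q) hq1).mul_left (‖a‖ + 1)
    ).hasProdUniformlyOn_nat_one_add (f := fun n (z : ℂ) => -(z * q ^ n))
    (isCompact_closedBall a 1) (Eventually.of_forall fun n z hz => by
      have : ‖z‖ ≤ ‖a‖ + 1 := by
        have h1 := norm_le_norm_add_norm_sub' z a
        have h2 : ‖z - a‖ ≤ 1 := by simpa [dist_eq_norm] using hz
        linarith
      rw [norm_neg, norm_mul, norm_pow]
      gcongr) (fun n => by fun_prop)).tendstoUniformlyOn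
  have h' := h.continuousOn (Frequently.of_forall fun s => by fun_prop)
  have h2 := h'.continuousAt (Metric.closedBall_mem_nhds a one_pos)
  have h3 : qPoch q = fun z => ∏' n : ℕ, (1 + -(z * q ^ n)) := by
    ext z
    simp [qPoch, sub_eq_add_neg]
  rwa [h3]

end Pochhammer

/-! ### Shifts of the parameters -/

section Shift

variable {M : ℕ} {q : ℂ}

theorem shiftPoint_zero (x : Param M) : shiftPoint q 0 x = x := by
  simp [shiftPoint]

theorem shiftPoint_shiftPoint (hq : q ≠ 0) (s r : Shift M) (x : Param M) :
    shiftPoint q s (shiftPoint q r x) = shiftPoint q (s + r) x := by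
  ext i <;> simp [shiftPoint, zpow_add₀ hq, mul_assoc]

/-- `domain q univ` is the set $D$: when all $a_i\ne0$, the product relation forces all $b_k\neq0$.
-/
theorem domain_anti {I I' : Set (Fin (M + 3))} (h : I ⊆ I') : domain (M := M) q I' ⊆ domain q I :=
  fun _ hx => ⟨hx.1, hx.2.1, fun i hi => hx.2.2 i (h hi)⟩

theorem shiftPoint_mem_domain (hq : q ≠ 0) {I : Set (Fin (M + 3))} {s : Shift M}
    (hs : s ∈ admissible M) {x : Param M} (hx : x ∈ domain q I) :
    shiftPoint q s x ∈ domain q I := by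
  refine ⟨?_, ?_, fun i hi => ⟨?_, fun k n h => ?_⟩⟩
  · have h1 : ∀ f : Fin (M + 3) → ℤ, ∏ i, q ^ f i = q ^ ∑ i, f i := fun f => by
      induction (univ : Finset (Fin (M + 3))) using Finset.induction_on with
      | empty => simp
      | insert a t ha ih => rw [prod_insert ha, sum_insert ha, ih, zpow_add₀ hq]
    have h2 : ∑ i, s.1 i = ∑ i, s.2 i := hs
    simp only [shiftPoint, prod_mul_distrib, h1, h2, hx.1]
    ring
  · exact mul_ne_zero (zpow_ne_zero _ hq) hx.2.1
  · exact mul_ne_zero (zpow_ne_zero _ hq) (hx.2.2 i hi).1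
  · apply (hx.2.2 i hi).2 k (s.2 k + n - s.1 i)
    simp only [shiftPoint] at h
    rw [zpow_sub₀ hq, zpow_add₀ hq]
    have := zpow_ne_zero (s.1 i) hq
    field_simp
    linear_combination h

theorem admissible_add {s r : Shift M} (hs : s ∈ admissible M) (hr : r ∈ admissible M) :
    s + r ∈ admissible M := by
  simp only [admissible, Set.mem_ofPred_eq] at *
  simp [sum_add_distrib, hs, hr]

theorem admissible_zsmul {s : Shift M} (n : ℤ) (hs : s ∈ admissible M) :
    n • s ∈ admissible M := by
  simp only [admissible, Set.mem_ofPred_eq] at *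
  simp [← mul_sum, hs]

theorem sA_add_sB_admissible (k l : Fin (M + 3)) : sA k + sB l ∈ admissible M := by
  simp [admissible, sA, sB]

theorem sA_sub_sA_admissible (k l : Fin (M + 3)) : sA k - sA l ∈ admissible M := by
  simp [admissible, sA]

theorem sB_sub_sB_admissible (k l : Fin (M + 3)) : sB k - sB l ∈ admissible M := by
  simp [admissible, sB]

end Shift

/-! ### The integrand -/

section Integrand

variable {M : ℕ} {q : ℂ}

/-- This direction involves no division, so it also covers the zeros $a_kt=1$. -/
theorem integrand_eq_mul_shift_sA (hq1 : ‖q‖ < 1) (x : Param M) (k : Fin (M + 3)) (t : ℂ) :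
    integrand q x t = (1 - x.1 k * t) * integrand q (shiftPoint q (sA k) x) t := by
  rw [integrand, integrand, ← mul_prod_erase _ _ (mem_univ k), ← mul_prod_erase _ _ (mem_univ k),
    qPoch_eq_mul hq1 (x.1 k * t)]
  have : ∏ i ∈ univ.erase k, qPoch q ((shiftPoint q (sA k) x).1 i * t) /
      qPoch q ((shiftPoint q (sA k) x).2 i * t) =
      ∏ i ∈ univ.erase k, qPoch q (x.1 i * t) / qPoch q (x.2 i * t) :=
    prod_congr rfl fun i hi => by
      simp [shiftPoint, sA, ne_of_mem_erase hi]
  rw [this]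
  simp [shiftPoint, sA]
  ring_nf

/-- At $b_kt=1$ the integrand on the right has the default value $0$ of a division by zero, hence
the assumption. -/
theorem integrand_shift_sB (hq1 : ‖q‖ < 1) (x : Param M) (k : Fin (M + 3)) (t : ℂ)
    (h : x.2 k * t ≠ 1) :
    integrand q (shiftPoint q (sB k) x) t = (1 - x.2 k * t) * integrand q x t := by
  rw [integrand, integrand, ← mul_prod_erase _ _ (mem_univ k), ← mul_prod_erase _ _ (mem_univ k),
    qPoch_eq_mul hq1 (x.2 k * t)]
  have : ∏ i ∈ univ.erase k, qPoch q ((shiftPoint q (sB k) x).1 i * t) /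
      qPoch q ((shiftPoint q (sB k) x).2 i * t) =
      ∏ i ∈ univ.erase k, qPoch q (x.1 i * t) / qPoch q (x.2 i * t) :=
    prod_congr rfl fun i hi => by
      simp [shiftPoint, sB, ne_of_mem_erase hi]
  rw [this]
  have h1 : 1 - x.2 k * t ≠ 0 := sub_ne_zero.2 h.symm
  simp only [shiftPoint, sB, Pi.single_eq_same, zpow_one, Pi.zero_apply, zpow_zero, one_mul]
  rw [← mul_assoc q, ← mul_assoc, ← mul_div_assoc, mul_div_mul_left _ _ h1]

theorem continuousAt_integrand (hq1 : ‖q‖ < 1) {x : Param M} {t : ℂ}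
    (h : ∀ k, qPoch q (x.2 k * t) ≠ 0) :
    ContinuousAt (fun p : Param M × ℂ => integrand q p.1 p.2) (x, t) := by
  refine tendsto_finsetProd _ fun k _ => ?_
  have := continuous_qPoch hq1
  refine ContinuousAt.div (f := fun p : Param M × ℂ => qPoch q (p.1.1 k * p.2))
    (g := fun p : Param M × ℂ => qPoch q (p.1.2 k * p.2)) ?_ ?_ (h k)
  · fun_prop
  · fun_prop

theorem integrand_zero (x : Param M) : integrand q x 0 = 1 := by
  simp [integrand, qPoch_zero]

theorem integrand_smul (x : Param M) (t : ℂ) :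
    integrand q (shiftPoint q (∑ k, (sA k + sB k)) x) t = integrand q x (q * t) := by
  have h1 : ∀ i, (∑ k, (sA k + sB k : Shift M)).1 i = 1 := fun i => by
    simp [sA, sB, Prod.fst_sum, Pi.single_apply]
  have h2 : ∀ i, (∑ k, (sA k + sB k : Shift M)).2 i = 1 := fun i => by
    simp [sA, sB, Prod.snd_sum, Pi.single_apply]
  simp only [integrand, shiftPoint, h1, h2, zpow_one]
  refine prod_congr rfl fun k _ => ?_
  ring_nf

end Integrand

/-! ### The Jackson integrals -/

section Jackson

variable {M : ℕ} {q : ℂ}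

/-- The integrand tends to $1$ at $t=0$, so all but finitely many terms obey a geometric bound. -/
theorem summable_jacksonTerm (hq1 : ‖q‖ < 1) (x : Param M) (τ : ℂ) :
    Summable (jacksonTerm q τ (integrand q x)) := by
  have h0 : Tendsto (fun n : ℕ => τ * q ^ n) atTop (𝓝 0) := by
    simpa using (tendsto_pow_atTop_nhds_zero_of_norm_lt_one hq1).const_mul τ
  have h1 : ContinuousAt (integrand q x) 0 := by
    have := continuousAt_integrand hq1 (x := x) (t := 0) (by simp [qPoch_zero])
    exact this.comp (f := fun t : ℂ => (x, t)) (by fun_prop)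
  have h2 := (h1.tendsto.comp h0).norm
  rw [integrand_zero, norm_one] at h2
  have h3 : ∀ᶠ n in atTop, ‖jacksonTerm q τ (integrand q x) n‖ ≤ 2 * ‖τ‖ * ‖q‖ ^ n := by
    filter_upwards [h2.eventually (eventually_lt_nhds one_lt_two)] with n hn
    simp only [Function.comp_apply] at hn
    rw [jacksonTerm, norm_mul, norm_mul τ, norm_pow, ← mul_assoc, mul_assoc, mul_assoc]
    gcongr
  exact ((summable_geometric_of_lt_one (norm_nonneg q) hq1).mul_left (2 * ‖τ‖)
    ).of_norm_bounded_eventually_nat h3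

/-- The Jackson integral `∫_0^{q / a_i}` of the integrand, divided by `1 - q`. -/
noncomputable def jacksonSum (q : ℂ) (i : Fin (M + 3)) : Param M → ℂ := fun x =>
  ∑' n, jacksonTerm q (q / x.1 i) (integrand q x) n

theorem phi_eq (i j : Fin (M + 3)) :
    phi (M := M) q i j = (1 - q) • (jacksonSum q j - jacksonSum q i) := by
  ext x
  simp [phi, jackson, jacksonZero, jacksonSum, mul_sub]

theorem mul_zpow_ne_one {i : Fin (M + 3)} {x : Param M} (hx : x ∈ domain q {i})
    (k : Fin (M + 3)) (n : ℤ) : x.2 k * (q ^ n / x.1 i) ≠ 1 := by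
  intro h
  have h0 := (hx.2.2 i rfl).1
  apply (hx.2.2 i rfl).2 k n
  field_simp at h
  exact h

/-- After the shift, $a_i$ is $q^{s_i}a_i$, whose factor kills the terms with $n+s_i\le0$. The
remaining nodes $q^{m+1-s_i}/a_i$, $m\ge0$, are those of the shifted Jackson sum. The node set on
the left is thus the same for every `s`, which allows sums with different shifts to be combined
termwise. -/
theorem hasSum_jacksonSum (hq : q ≠ 0) (hq1 : ‖q‖ < 1) {i : Fin (M + 3)} {x : Param M}
    (hx : x ∈ domain q {i}) (s : Shift M) :
    HasSum (fun n : ℤ => q ^ n / x.1 i * integrand q (shiftPoint q s x) (q ^ n / x.1 i))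
      (jacksonSum q i (shiftPoint q s x)) := by
  have h0 := (hx.2.2 i rfl).1
  let g : ℕ → ℤ := fun m => m + 1 - s.1 i
  have hg : Function.Injective g := fun a b h => by simpa [g] using h
  refine (hg.hasSum_iff ?_).1 ?_
  · intro n hn
    have hn' : n + s.1 i ≤ 0 := by
      by_contra hc
      exact hn ⟨(n + s.1 i - 1).toNat, by simp only [g]; omega⟩
    have : qPoch q ((shiftPoint q s x).1 i * (q ^ n / x.1 i)) = 0 := by
      refine qPoch_eq_zero hq1 (-(n + s.1 i)).toNat ?_
      rw [← zpow_natCast, Int.toNat_of_nonneg (by omega), zpow_neg, zpow_add₀ hq]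
      have h1 := zpow_ne_zero n hq
      have h2 := zpow_ne_zero (s.1 i) hq
      simp only [shiftPoint]
      field_simp
    rw [integrand, prod_eq_zero (mem_univ i) (by rw [this, zero_div]), mul_zero]
  · have := (summable_jacksonTerm hq1 (shiftPoint q s x) (q / (shiftPoint q s x).1 i)).hasSum
    refine HasSum.congr_fun this ?_
    intro m
    have h2 := zpow_ne_zero (s.1 i) hq
    have : q ^ g m / x.1 i = q / (shiftPoint q s x).1 i * q ^ m := by
      simp only [g, shiftPoint]
      rw [zpow_sub₀ hq, zpow_add₀ hq]
      field_simp
      simp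
    simp only [Function.comp_apply, jacksonTerm, this]
    ring

end Jackson

end QRP

namespace QRP

open Filter Topology

/-! ### Three-term relations for the half integrals -/

section ThreeTerm

variable {M : ℕ} {q : ℂ}

/-- No denominator of the integrand vanishes at `t`, nor in its `q`-shifts. -/
def Regular (q : ℂ) (x : Param M) (t : ℂ) : Prop := ∀ k (n : ℤ), x.2 k * (q ^ n * t) ≠ 1

theorem Regular.shift (hq : q ≠ 0) {x : Param M} {t : ℂ} (h : Regular q x t) (s : Shift M) :
    Regular q (shiftPoint q s x) t := fun k n hk => h k (s.2 k + n) (by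
  rw [← hk, zpow_add₀ hq, shiftPoint]
  ring)

theorem Regular.ne_one {x : Param M} {t : ℂ} (h : Regular q x t) (k : Fin (M + 3)) :
    x.2 k * t ≠ 1 := by simpa using h k 0

theorem Regular.mul_zpow (hq : q ≠ 0) {x : Param M} {t : ℂ} (h : Regular q x t) (m : ℤ) :
    Regular q x (q ^ m * t) := fun k n hk => h k (n + m) (by
  rw [← hk, zpow_add₀ hq]
  ring)

theorem regular_of_mem_domain (hq : q ≠ 0) {i : Fin (M + 3)} {x : Param M}
    (hx : x ∈ domain q {i}) (m : ℤ) : Regular q x (q ^ m / x.1 i) := fun k n h =>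
  mul_zpow_ne_one hx k (n + m) (by rw [← h, zpow_add₀ hq]; ring)

theorem integrand_shift_sub_sA (hq : q ≠ 0) (hq1 : ‖q‖ < 1) (x : Param M) (s : Shift M)
    (k : Fin (M + 3)) (t : ℂ) :
    integrand q (shiftPoint q (s - sA k) x) t =
      (1 - q ^ (s.1 k - 1) * x.1 k * t) * integrand q (shiftPoint q s x) t := by
  rw [integrand_eq_mul_shift_sA hq1 _ k, shiftPoint_shiftPoint hq, add_sub_cancel]
  simp [shiftPoint, sA]

theorem integrand_shift_add_sB (hq : q ≠ 0) (hq1 : ‖q‖ < 1) {x : Param M} {t : ℂ}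
    (h : Regular q x t) (s : Shift M) (k : Fin (M + 3)) :
    integrand q (shiftPoint q (s + sB k) x) t =
      (1 - q ^ s.2 k * x.2 k * t) * integrand q (shiftPoint q s x) t := by
  rw [add_comm, ← shiftPoint_shiftPoint hq, integrand_shift_sB hq1 _ _ _ ((h.shift hq s).ne_one k)]
  rfl

/-- All three sums run over $q^{\mathbb Z}/a_i$, so a pointwise identity of integrands is enough. -/
theorem jacksonSum_three_term (hq : q ≠ 0) (hq1 : ‖q‖ < 1) {i : Fin (M + 3)} {x : Param M}
    (hx : x ∈ domain q {i}) (s r : Shift M) (c₁ c₂ c₃ : ℂ)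
    (h : ∀ t, Regular q x t → c₁ * integrand q (shiftPoint q s x) t -
      c₂ * integrand q (shiftPoint q r x) t + c₃ * integrand q x t = 0) :
    c₁ * T q s (jacksonSum q i) x - c₂ * T q r (jacksonSum q i) x + c₃ * jacksonSum q i x = 0 := by
  have h1 := (hasSum_jacksonSum hq hq1 hx s).mul_left c₁
  have h2 := (hasSum_jacksonSum hq hq1 hx r).mul_left c₂
  have h3 := (hasSum_jacksonSum hq hq1 hx 0).mul_left c₃
  have h4 := (h1.sub h2).add h3
  rw [shiftPoint_zero] at h4
  refine h4.unique ?_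
  refine hasSum_zero.congr_fun fun n => ?_
  linear_combination (q ^ n / x.1 i) * h _ (regular_of_mem_domain hq hx n)

/-- Rescaling all parameters by $q$ replaces $t$ by $qt$ in the integrand; this is a translation of
the bilateral sum, and the prefactor $q$ rescales the weight $t$. -/
theorem jacksonSum_total (hq : q ≠ 0) (hq1 : ‖q‖ < 1) {i : Fin (M + 3)} {x : Param M}
    (hx : x ∈ domain q {i}) :
    q * T q (∑ k, (sA k + sB k)) (jacksonSum q i) x - jacksonSum q i x = 0 := by
  have h1 := (hasSum_jacksonSum hq hq1 hx (∑ k, (sA k + sB k))).mul_left q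
  have h2 := hasSum_jacksonSum hq hq1 hx 0
  rw [shiftPoint_zero, ← (Equiv.addRight (1 : ℤ)).hasSum_iff] at h2
  refine sub_eq_zero.2 (h1.unique (h2.congr_fun fun n => ?_))
  simp only [integrand_smul, Function.comp_apply, Equiv.coe_addRight, zpow_add₀ hq, zpow_one]
  rw [show q ^ n * q / x.1 i = q * (q ^ n / x.1 i) by ring]
  ring

section

variable (hq : q ≠ 0) (hq1 : ‖q‖ < 1) {i : Fin (M + 3)} {x : Param M} (hx : x ∈ domain q {i})

include hq hq1 hx

/-- In all six relations the three integrands are a common one times $1-\alpha t$, $1-\beta t$,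
$1-\gamma t$. Up to a constant, the relation is $(\beta-\gamma)(1-\alpha t)-(\alpha-\gamma)(1-\beta
t)+(\alpha-\beta)(1-\gamma t)=0$. Here the common integrand has $a_k$ shifted, with $\alpha=a_l/q$,
$\beta=a_1/q$, $\gamma=a_k$. -/
theorem jacksonSum_three₁ {k l : Fin (M + 3)} (hk : k ≠ 0) (hkl : k ≠ l) :
    (x.1 0 - x.1 k * q) * T q (sA k - sA l) (jacksonSum q i) x
      - (x.1 l - x.1 k * q) * T q (sA k - sA 0) (jacksonSum q i) x
      + (x.1 l - x.1 0) * jacksonSum q i x = 0 := by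
  refine jacksonSum_three_term hq hq1 hx _ _ _ _ _ fun t ht => ?_
  rw [integrand_shift_sub_sA hq hq1, integrand_shift_sub_sA hq hq1,
    integrand_eq_mul_shift_sA hq1 x k]
  simp [sA, hk.symm, hkl.symm]
  field_simp
  ring

theorem jacksonSum_three₂ {k : Fin (M + 3)} (hk : k ≠ 0) :
    (x.2 0 - x.1 0) * T q (sA 0 - sA k) (jacksonSum q i) x
      - (q⁻¹ * x.1 k - x.1 0) * T q (sA 0 + sB 0) (jacksonSum q i) x
      + (q⁻¹ * x.1 k - x.2 0) * jacksonSum q i x = 0 := by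
  refine jacksonSum_three_term hq hq1 hx _ _ _ _ _ fun t ht => ?_
  rw [integrand_shift_sub_sA hq hq1, integrand_shift_add_sB hq hq1 ht,
    integrand_eq_mul_shift_sA hq1 x 0]
  simp [sA, hk]
  field_simp
  ring

theorem jacksonSum_three₃ {k l : Fin (M + 3)} (hl : l ≠ 0) (hkl : k ≠ l) :
    (x.2 0 - q⁻¹ * x.2 l) * T q (sB k - sB l) (jacksonSum q i) x
      - (x.2 k - q⁻¹ * x.2 l) * T q (sB 0 - sB l) (jacksonSum q i) x
      + (x.2 k - x.2 0) * jacksonSum q i x = 0 := by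
  refine jacksonSum_three_term hq hq1 hx _ _ _ _ _ fun t ht => ?_
  -- The common integrand is the one with $b_l$ replaced by $b_l/q$; `h` recovers the unshifted
  -- integrand from it.
  have h := integrand_shift_add_sB hq hq1 ht (-sB l) l
  rw [neg_add_cancel, shiftPoint_zero] at h
  rw [sub_eq_neg_add (sB k), sub_eq_neg_add (sB 0), integrand_shift_add_sB hq hq1 ht,
    integrand_shift_add_sB hq hq1 ht, h]
  simp [sB, hl.symm, hkl]
  field_simp
  ring

theorem jacksonSum_three₄ {k : Fin (M + 3)} (hk : k ≠ 0) :
    (x.1 0 - x.2 0) * T q (sB k - sB 0) (jacksonSum q i) x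
      - (x.2 k * q - x.2 0) * T q (-(sA 0 + sB 0)) (jacksonSum q i) x
      + (x.2 k * q - x.1 0) * jacksonSum q i x = 0 := by
  refine jacksonSum_three_term hq hq1 hx _ _ _ _ _ fun t ht => ?_
  have h := integrand_shift_add_sB hq hq1 ht (-sB 0) 0
  rw [neg_add_cancel, shiftPoint_zero] at h
  rw [sub_eq_neg_add (sB k), integrand_shift_add_sB hq hq1 ht, neg_add_rev, ← sub_eq_add_neg,
    integrand_shift_sub_sA hq hq1, h]
  simp [sB, hk]
  field_simp
  ring

theorem jacksonSum_three₅ {k l : Fin (M + 3)} :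
    (x.2 0 - x.1 k) * T q (sA k + sB l) (jacksonSum q i) x
      - (x.2 l - x.1 k) * T q (sA k + sB 0) (jacksonSum q i) x
      + (x.2 l - x.2 0) * jacksonSum q i x = 0 := by
  refine jacksonSum_three_term hq hq1 hx _ _ _ _ _ fun t ht => ?_
  rw [integrand_shift_add_sB hq hq1 ht, integrand_shift_add_sB hq hq1 ht,
    integrand_eq_mul_shift_sA hq1 x k]
  simp [sA]
  ring

theorem jacksonSum_three₆ {k l : Fin (M + 3)} :
    (x.2 l - x.1 0) * T q (-sA k - sB l) (jacksonSum q i) x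
      - (x.2 l - x.1 k) * T q (-sA 0 - sB l) (jacksonSum q i) x
      + (x.1 0 - x.1 k) * jacksonSum q i x = 0 := by
  refine jacksonSum_three_term hq hq1 hx _ _ _ _ _ fun t ht => ?_
  have h := integrand_shift_add_sB hq hq1 ht (-sB l) l
  rw [neg_add_cancel, shiftPoint_zero] at h
  rw [← neg_add', ← neg_add', neg_add_rev, neg_add_rev, ← sub_eq_add_neg, ← sub_eq_add_neg,
    integrand_shift_sub_sA hq hq1, integrand_shift_sub_sA hq hq1, h]
  simp [sB]
  field_simp
  ring

end

end ThreeTerm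

end QRP

namespace QRP

open Filter Topology

/-! ### Operator calculus: exchange with sums, commuting factors, generating function of the $e_k$
-/

section Operators

variable {M : ℕ} {q : ℂ}

/-- The operator `A` can be interchanged with sums over `ℤ` which converge on `O`. -/
def CommutesWithSums (O : Set (Param M)) (A : Module.End ℂ (Param M → ℂ)) : Prop :=
  ∀ (f : ℤ → Param M → ℂ) (y : Param M → ℂ), (∀ x ∈ O, HasSum (fun n => f n x) (y x)) →
    ∀ x ∈ O, HasSum (fun n => A (f n) x) (A y x)

namespace CommutesWithSums

variable {O : Set (Param M)} {A B : Module.End ℂ (Param M → ℂ)}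

theorem one : CommutesWithSums O 1 := fun _ _ h => h

theorem mulOp (c : Param M → ℂ) : CommutesWithSums O (mulOp c) :=
  fun _ _ h x hx => (h x hx).mul_left (c x)

theorem shift {s : Shift M} (hO : ∀ x ∈ O, shiftPoint q s x ∈ O) : CommutesWithSums O (T q s) :=
  fun _ _ h x hx => h _ (hO x hx)

theorem add (hA : CommutesWithSums O A) (hB : CommutesWithSums O B) : CommutesWithSums O (A + B) :=
  fun f y h x hx => (hA f y h x hx).add (hB f y h x hx)

theorem sub (hA : CommutesWithSums O A) (hB : CommutesWithSums O B) : CommutesWithSums O (A - B) :=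
  fun f y h x hx => (hA f y h x hx).sub (hB f y h x hx)

theorem mul (hA : CommutesWithSums O A) (hB : CommutesWithSums O B) : CommutesWithSums O (A * B) :=
  fun f y h => hA (fun n => B (f n)) (B y) (hB f y h)

theorem sum {ι : Type*} {s : Finset ι} {A : ι → Module.End ℂ (Param M → ℂ)}
    (h : ∀ i, CommutesWithSums O (A i)) : CommutesWithSums O (∑ i ∈ s, A i) := by
  induction s using Finset.cons_induction with
  | empty => exact fun f y _ x _ => by simp [hasSum_zero]
  | cons i s hi ih => rw [sum_cons]; exact (h i).add ih

theorem list_prod {ι : Type*} {l : List ι} {A : ι → Module.End ℂ (Param M → ℂ)}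
    (h : ∀ i, CommutesWithSums O (A i)) : CommutesWithSums O (l.map A).prod := by
  induction l with
  | nil => exact one
  | cons i s ih => rw [List.map_cons, List.prod_cons]; exact (h i).mul ih

theorem hatE {s : ℂ} (hO : ∀ x ∈ O, ∀ r, shiftPoint s r x ∈ O) :
    CommutesWithSums O (hatE M s) := by
  have hT : ∀ r, CommutesWithSums O (T s r) := fun r => shift fun x hx => hO x hx r
  have hP : ∀ n, CommutesWithSums O (prodP s n) := fun n =>
    list_prod fun i => one.sub ((mulOp _).mul (hT _))
  have hQ : ∀ n, CommutesWithSums O (prodQ s n) := fun n =>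
    list_prod fun i => one.sub ((mulOp _).mul (hT _))
  exact ((((mulOp _).mul (hT _)).mul (hP _)).add (sum fun k => (((mulOp _).mul
    (((mulOp _).mul (hT _)).sub (mulOp _))).mul (hP _)).mul (hQ _))).add
    (((mulOp _).mul (hT _)).mul (hQ _))

end CommutesWithSums

theorem commute_mulOp_mul_T {s : Shift M} {f g : Param M → ℂ}
    (hf : ∀ x, f (shiftPoint q s x) = f x) (hg : ∀ x, g (shiftPoint q s x) = g x) :
    Commute (mulOp f * T q s) (mulOp g * T q s) := by
  ext y x
  simp only [mulOp, T, Module.End.mul_apply, LinearMap.coe_mk, AddHom.coe_mk,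
    LinearMap.mulLeft_apply, Pi.mul_apply, hf, hg]
  ring

theorem one_sub_mulOp_mul_T_apply (s : Shift M) (f y : Param M → ℂ) (x : Param M) :
    ((1 - mulOp f * T q s : Module.End ℂ (Param M → ℂ)) y) x =
      y x - f x * y (shiftPoint q s x) := rfl

/-- Since $a_1/b_1$ is invariant under $T$, the factors of `prodP` commute with each other and with
$T$. -/
theorem shift_ratio (hq : q ≠ 0) (c : ℂ) (x : Param M) :
    (shiftPoint q (sA 0 + sB 0) x).1 0 * c / (shiftPoint q (sA 0 + sB 0) x).2 0 =
      x.1 0 * c / x.2 0 := by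
  simp only [shiftPoint, sA, sB, Prod.fst_add, Prod.snd_add, Pi.add_apply, Pi.single_eq_same,
    Pi.zero_apply, add_zero, zero_add, zpow_one]
  rw [mul_assoc, mul_div_mul_left _ _ hq]

theorem prodP_succ (hq : q ≠ 0) (n : ℕ) :
    prodP (M := M) q (n + 1) =
      (1 - mulOp (fun x : Param M => x.1 0 * q ^ n / x.2 0) * T q (sA 0 + sB 0)) * prodP q n := by
  rw [prodP, List.range_succ, List.map_append, List.prod_append, List.map_singleton,
    List.prod_singleton, prodP]
  refine (Commute.list_prod_right _ _ fun A hA => ?_).eq.symm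
  obtain ⟨i, -, rfl⟩ := List.mem_map.1 hA
  exact (((Commute.one_left _).sub_left (((Commute.one_right _).sub_right
    (commute_mulOp_mul_T (shift_ratio hq _) (shift_ratio hq _))))))

theorem prodQ_succ (n : ℕ) :
    prodQ (M := M) q (n + 1) =
      (1 - mulOp (fun _ : Param M => (q ^ n)⁻¹) * T q (sA 0 + sB 0)) * prodQ q n := by
  rw [prodQ, List.range_succ, List.map_append, List.prod_append, List.map_singleton,
    List.prod_singleton, prodQ]
  refine (Commute.list_prod_right _ _ fun A hA => ?_).eq.symm
  obtain ⟨i, -, rfl⟩ := List.mem_map.1 hA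
  exact (((Commute.one_left _).sub_left (((Commute.one_right _).sub_right
    (commute_mulOp_mul_T (fun _ => rfl) (fun _ => rfl))))))

/-- This is the expansion of $\prod(1-v_iz)$ without its terms of degree $0$ and $M+2$; in $\hat
E_M$ those two degrees are accounted for by the first and last summands. -/
theorem sum_eHat (v : Fin (M + 3) → ℂ) (z : ℂ) :
    ∑ k ∈ Icc 1 (M + 1), (-1) ^ k * eHat k v * z ^ k =
      ∏ i ∈ univ.erase 0, (1 - v i * z) - 1 - (-1) ^ M * (∏ i ∈ univ.erase 0, v i) * z ^ (M + 2) := by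
  have hc : #((univ : Finset (Fin (M + 3))).erase 0) = M + 2 := by simp
  have h1 : ∏ i ∈ univ.erase 0, (1 - v i * z) =
      ∑ k ∈ range (M + 3), (-1) ^ k * eHat k v * z ^ k := by
    simp_rw [sub_eq_add_neg]
    rw [prod_one_add, sum_powerset, hc]
    refine sum_congr rfl fun k _ => ?_
    rw [eHat, mul_sum, sum_mul]
    refine sum_congr rfl fun s hs => ?_
    rw [← (mem_powersetCard.1 hs).2]
    simp_rw [← neg_one_mul (_ * z), prod_mul_distrib, prod_const]
    ring
  have h2 : eHat (M + 2) v = ∏ i ∈ univ.erase 0, v i := by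
    rw [eHat, ← hc, powersetCard_self, sum_singleton]
  have h0 : eHat 0 v = 1 := by simp [eHat]
  rw [h1, sum_range_succ, sum_range_succ', h2, h0, range_eq_Ico, sum_Ico_add' (fun k : ℕ =>
    (-1 : ℂ) ^ k * eHat k v * z ^ k) 0 (M + 1) 1]
  have : Icc 1 (M + 1) = Ico (0 + 1) (M + 1 + 1) := rfl
  rw [this]
  ring

end Operators

/-! ### The action of $\hat E_M$ on the integrand -/

section Ordinary

variable {M : ℕ} {q : ℂ}

/-- The integrand with the factor `(a₁ t)_∞` replaced by `(a₁ q^m t)_∞`. -/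
noncomputable def reducedIntegrand (q t : ℂ) (m : ℕ) (x : Param M) : ℂ :=
  qPoch q (x.1 0 * q ^ m * t) / qPoch q (x.2 0 * t) *
    ∏ k ∈ univ.erase 0, qPoch q (x.1 k * t) / qPoch q (x.2 k * t)

theorem reducedIntegrand_zero (t : ℂ) (x : Param M) :
    reducedIntegrand q t 0 x = integrand q x t := by
  rw [integrand, ← mul_prod_erase _ _ (mem_univ 0), reducedIntegrand, pow_zero, mul_one]

theorem reducedIntegrand_eq_mul (hq1 : ‖q‖ < 1) (t : ℂ) (m : ℕ) (x : Param M) :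
    reducedIntegrand q t m x = (1 - x.1 0 * q ^ m * t) * reducedIntegrand q t (m + 1) x := by
  rw [reducedIntegrand, qPoch_eq_mul hq1, reducedIntegrand]
  ring_nf

theorem reducedIntegrand_shift (hq1 : ‖q‖ < 1) {t : ℂ} (m : ℕ) {x : Param M}
    (h : Regular q x t) :
    reducedIntegrand q t m (shiftPoint q (sA 0 + sB 0) x) =
      (1 - x.2 0 * t) * reducedIntegrand q t (m + 1) x := by
  have h1 : 1 - x.2 0 * t ≠ 0 := sub_ne_zero.2 (h.ne_one 0).symm
  rw [reducedIntegrand, reducedIntegrand, qPoch_eq_mul hq1 (x.2 0 * t)]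
  have : ∏ i ∈ univ.erase 0, qPoch q ((shiftPoint q (sA 0 + sB 0) x).1 i * t) /
      qPoch q ((shiftPoint q (sA 0 + sB 0) x).2 i * t) =
      ∏ i ∈ univ.erase 0, qPoch q (x.1 i * t) / qPoch q (x.2 i * t) :=
    prod_congr rfl fun i hi => by
      simp [shiftPoint, sA, sB, ne_of_mem_erase hi]
  rw [this, ← mul_assoc, ← mul_div_assoc, mul_div_mul_left _ _ h1]
  simp only [shiftPoint, sA, sB, Prod.fst_add, Prod.snd_add, Pi.add_apply, Pi.single_eq_same,
    Pi.zero_apply, add_zero, zero_add, zpow_one]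
  ring_nf

theorem shift_zero_fst (x : Param M) : (shiftPoint q (sA 0 + sB 0) x).1 0 = q * x.1 0 := by
  simp [shiftPoint, sA, sB]

theorem shift_zero_snd (x : Param M) : (shiftPoint q (sA 0 + sB 0) x).2 0 = q * x.2 0 := by
  simp [shiftPoint, sA, sB]

/-- Under $T$ the product of the $b_1-a_1q^i$ gains $q^n$, which the coefficient $q^{-n}$ of the
next factor cancels. What remains is $(1-a_1q^nt)-(1-b_1t)=t(b_1-a_1q^n)$. -/
theorem prodQ_integrand (hq : q ≠ 0) (hq1 : ‖q‖ < 1) (n : ℕ) {t : ℂ} {x : Param M}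
    (h : Regular q x t) :
    prodQ q n (fun x => integrand q x t) x =
      t ^ n * (∏ i ∈ range n, (x.2 0 - x.1 0 * q ^ i)) * reducedIntegrand q t n x := by
  induction n generalizing x with
  | zero => simp [prodQ, reducedIntegrand_zero]
  | succ n ih =>
    rw [prodQ_succ, Module.End.mul_apply, one_sub_mulOp_mul_T_apply, ih h, ih (h.shift hq _),
      reducedIntegrand_shift hq1 n h, reducedIntegrand_eq_mul hq1 t n x, shift_zero_fst,
      shift_zero_snd, prod_range_succ]
    have h2 : ∏ i ∈ range n, (q * x.2 0 - q * x.1 0 * q ^ i) =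
        q ^ n * ∏ i ∈ range n, (x.2 0 - x.1 0 * q ^ i) := by
      conv_rhs => rw [← card_range n, ← prod_const, card_range, ← prod_mul_distrib]
      exact prod_congr rfl fun i _ => by ring
    rw [h2]
    field_simp
    ring

/-- $T$ multiplies $b_1^n$ by $q^n$, so the next factor contributes
$(1-ct)-\frac{c}{b_1}(1-b_1t)=1-c/b_1$ with $c=a_1q^{n+m}$. Apart from $(tb_1)^n$ the result depends
only on $n+m$, so the middle terms of $\hat E_M$ share a common factor. -/
theorem prodP_prodQ_integrand (hq : q ≠ 0) (hq1 : ‖q‖ < 1) (m n : ℕ) {t : ℂ} {x : Param M}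
    (h : Regular q x t) (hb : x.2 0 ≠ 0) :
    prodP q m (prodQ q n (fun x => integrand q x t)) x =
      t ^ n * x.2 0 ^ n * (∏ i ∈ range (n + m), (1 - x.1 0 * q ^ i / x.2 0)) *
        reducedIntegrand q t (n + m) x := by
  induction m generalizing x with
  | zero =>
    have h2 : ∏ i ∈ range n, (x.2 0 - x.1 0 * q ^ i) =
        x.2 0 ^ n * ∏ i ∈ range n, (1 - x.1 0 * q ^ i / x.2 0) := by
      conv_rhs => rw [← card_range n, ← prod_const, card_range, ← prod_mul_distrib]
      exact prod_congr rfl fun i _ => by field_simp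
    have h1 : prodP (M := M) q 0 = 1 := by simp [prodP]
    rw [h1, Module.End.one_apply, prodQ_integrand hq hq1 n h, h2, add_zero]
    ring
  | succ m ih =>
    have hb' : (shiftPoint q (sA 0 + sB 0) x).2 0 ≠ 0 := by
      rw [shift_zero_snd]
      exact mul_ne_zero hq hb
    rw [prodP_succ hq, Module.End.mul_apply, one_sub_mulOp_mul_T_apply, ih h hb, ih (h.shift hq _) hb',
      reducedIntegrand_shift hq1 _ h, reducedIntegrand_eq_mul hq1 t (n + m) x,
      ← add_assoc, prod_range_succ]
    simp_rw [shift_ratio hq, shift_zero_snd]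
    field_simp
    ring

/-- The function whose `q`-difference is `t Ê_M ∏_k (a_k t)_∞ / (b_k t)_∞`, up to a factor. -/
noncomputable def telescoper (q : ℂ) (x : Param M) (t : ℂ) : ℂ :=
  reducedIntegrand q t M x * ∏ k ∈ univ.erase 0, (1 - x.2 k * t)

/-- Passing from $t$ to $t/q$ creates one factor $1-a_kt/q$ above and one factor $1-b_kt/q$ below
for each $k$; for $k\ne1$ the lower ones cancel against the product in `telescoper`. -/
theorem telescoper_div (hq : q ≠ 0) (hq1 : ‖q‖ < 1) {t : ℂ} {x : Param M} (h : Regular q x t) :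
    (1 - x.2 0 * (t / q)) * telescoper q x (t / q) = (1 - x.1 0 * q ^ M * (t / q)) *
      (∏ k ∈ univ.erase 0, (1 - x.1 k * (t / q))) * reducedIntegrand q t M x := by
  have hu : Regular q x (t / q) := by simpa [div_eq_inv_mul] using h.mul_zpow hq (-1)
  have h0 : ∀ k, 1 - x.2 k * (t / q) ≠ 0 := fun k => sub_ne_zero.2 (hu.ne_one k).symm
  have e : ∀ a : ℂ, qPoch q (a * (t / q)) = (1 - a * (t / q)) * qPoch q (a * t) := fun a => by
    rw [qPoch_eq_mul hq1]
    congr 2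
    field_simp
  have h1 : (∏ k ∈ univ.erase 0, qPoch q (x.1 k * (t / q)) / qPoch q (x.2 k * (t / q))) *
      ∏ k ∈ univ.erase 0, (1 - x.2 k * (t / q)) =
      (∏ k ∈ univ.erase 0, (1 - x.1 k * (t / q))) *
        ∏ k ∈ univ.erase 0, qPoch q (x.1 k * t) / qPoch q (x.2 k * t) := by
    rw [← prod_mul_distrib, ← prod_mul_distrib]
    refine prod_congr rfl fun k _ => ?_
    rw [e, e, mul_comm, mul_div_mul_comm, ← mul_assoc, mul_div_cancel₀ _ (h0 k)]
  rw [telescoper, reducedIntegrand, reducedIntegrand, mul_assoc _ _ (∏ k ∈ _, (1 - x.2 k * (t / q))),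
    h1, e, e]
  rw [← mul_assoc, ← mul_assoc, mul_div_mul_comm, ← mul_assoc, mul_div_cancel₀ _ (h0 0)]
  ring

/-- With $u=t/q$, every term is a multiple of one reduced integrand at $x'=T^{-1}x$. The sum over
$k$ then becomes, via `sum_eHat`, $(1-a_1q^Mu)\prod_{k\ge2}(1-a_ku)-(1-b_1u)\prod_{k\ge2}(1-b_kqu)$
up to terms of extreme degree in $u$. The two products are the values of the telescoper at $t/q$ and
$t$; the first and last summands of $\hat E_M$ cancel the rest. -/
theorem hatE_integrand (hq : q ≠ 0) (hq1 : ‖q‖ < 1) {t : ℂ} {x : Param M} (h : Regular q x t)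
    (hb : x.2 0 ≠ 0) (hrel : ∏ i, x.1 i = q ^ 2 * ∏ i, x.2 i) :
    t * hatE M q (fun x => integrand q x t) x =
      q * x.2 0 ^ (M + 1) * (∏ i ∈ range M, (1 - x.1 0 * q ^ i / x.2 0)) *
        (telescoper q x (t / q) - telescoper q x t) := by
  have hu : Regular q x (t / q) := by simpa [div_eq_inv_mul] using h.mul_zpow hq (-1)
  have h0 : 1 - x.2 0 * (t / q) ≠ 0 := sub_ne_zero.2 (hu.ne_one 0).symm
  set x' := shiftPoint q (-(sA 0 + sB 0)) x with hx'
  have hxx : shiftPoint q (sA 0 + sB 0) x' = x := by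
    rw [hx', shiftPoint_shiftPoint hq, add_neg_cancel, shiftPoint_zero]
  have h' : Regular q x' t := h.shift hq _
  have ha' : x'.1 0 = q⁻¹ * x.1 0 := by rw [← hxx, shift_zero_fst]; field_simp
  have hb' : x'.2 0 = q⁻¹ * x.2 0 := by rw [← hxx, shift_zero_snd]; field_simp
  have hb0 : x'.2 0 ≠ 0 := by rw [hb']; exact mul_ne_zero (inv_ne_zero hq) hb
  have hr : ∀ i, x'.1 0 * q ^ i / x'.2 0 = x.1 0 * q ^ i / x.2 0 := fun i => by
    rw [← shift_ratio hq, hxx]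
  obtain ⟨u, rfl⟩ : ∃ u, t = q * u := ⟨t / q, by field_simp⟩
  have eu : q * u / q = u := by field_simp
  rw [eu] at hu h0 ⊢
  have r1 : reducedIntegrand q (q * u) M x =
      (1 - x.2 0 * u) * reducedIntegrand q (q * u) (M + 1) x' := by
    conv_lhs => rw [← hxx, reducedIntegrand_shift hq1 M h', hb']
    congr 2
    field_simp
  have r2 : reducedIntegrand q (q * u) M x' =
      (1 - x.1 0 * q ^ M * u) * reducedIntegrand q (q * u) (M + 1) x' := by
    rw [reducedIntegrand_eq_mul hq1, ha']
    congr 2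
    field_simp
  have r3 : telescoper q x u = (1 - x.1 0 * q ^ M * u) *
      (∏ k ∈ univ.erase 0, (1 - x.1 k * u)) * reducedIntegrand q (q * u) (M + 1) x' := by
    have := telescoper_div hq hq1 h
    rw [eu, r1] at this
    apply mul_left_cancel₀ h0
    linear_combination this
  have hw : x.2 0 * (1 - x.1 0 * q ^ M / x.2 0) = x.2 0 - x.1 0 * q ^ M := by field_simp
  have v1 : prodP q (M + 1) (fun x => integrand q x (q * u)) x' =
      (∏ i ∈ range M, (1 - x.1 0 * q ^ i / x.2 0)) * (1 - x.1 0 * q ^ M / x.2 0) *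
        reducedIntegrand q (q * u) (M + 1) x' := by
    have := prodP_prodQ_integrand hq hq1 (M + 1) 0 h' hb0
    simp only [hr, prod_range_succ, zero_add, pow_zero, one_mul] at this
    simpa [prodQ] using this
  have v2 : prodQ q (M + 1) (fun x => integrand q x (q * u)) x' =
      u ^ (M + 1) * x.2 0 ^ (M + 1) *
      (∏ i ∈ range M, (1 - x.1 0 * q ^ i / x.2 0)) * (1 - x.1 0 * q ^ M / x.2 0) *
        reducedIntegrand q (q * u) (M + 1) x' := by
    have := prodP_prodQ_integrand hq hq1 0 (M + 1) h' hb0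
    simp only [hr, prod_range_succ, add_zero, ← mul_pow] at this
    rw [hb', show q * u * (q⁻¹ * x.2 0) = u * x.2 0 by field_simp] at this
    rw [← mul_pow, mul_assoc ((u * x.2 0) ^ (M + 1)), ← this]
    simp [prodP]
  have v3 : ∀ k ∈ Icc 1 (M + 1), q * u * ((-1) ^ k * x.2 0 ^ (M + 2 - k) *
      (eHat k x.1 * prodP q (M + 1 - k) (prodQ q (k - 1) (fun x => integrand q x (q * u))) x' -
      q * eHat k x.2 * prodP q (M + 1 - k) (prodQ q (k - 1) (fun x => integrand q x (q * u))) x))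
      = q * x.2 0 ^ (M + 1) * (∏ i ∈ range M, (1 - x.1 0 * q ^ i / x.2 0)) *
        reducedIntegrand q (q * u) (M + 1) x' * ((1 - x.1 0 * q ^ M * u) *
          ((-1) ^ k * eHat k x.1 * u ^ k) - (1 - x.2 0 * u) *
          ((-1) ^ k * eHat k x.2 * (q * u) ^ k)) := by
    intro k hk
    obtain ⟨j, rfl⟩ : ∃ j, k = j + 1 := ⟨k - 1, by have := (mem_Icc.1 hk).1; omega⟩
    have hj : j ≤ M := by have := (mem_Icc.1 hk).2; omega
    rw [prodP_prodQ_integrand hq hq1 _ _ h' hb0, prodP_prodQ_integrand hq hq1 _ _ h hb]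
    have e1 : j + (M + 1 - (j + 1)) = M := by omega
    have e2 : M + 2 - (j + 1) = M + 1 - j := by omega
    have e3 : x.2 0 ^ (M + 1) = x.2 0 ^ (M + 1 - j) * x.2 0 ^ j := by
      rw [← pow_add]; congr 1; omega
    simp only [hr, e1, e2, e3, r1, r2, Nat.add_sub_cancel]
    rw [hb', ← mul_pow (q * u) (q⁻¹ * _), show q * u * (q⁻¹ * x.2 0) = u * x.2 0 by field_simp]
    ring
  have hrel' : x.1 0 * ∏ k ∈ univ.erase 0, x.1 k = q ^ 2 * (x.2 0 * ∏ k ∈ univ.erase 0, x.2 k) := by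
    rw [mul_prod_erase _ _ (mem_univ _), mul_prod_erase _ _ (mem_univ _), hrel]
  have v4 : hatE M q (fun x => integrand q x (q * u)) x =
      x.2 0 ^ (M + 2) * prodP q (M + 1) (fun x => integrand q x (q * u)) x' +
      ∑ k ∈ Icc 1 (M + 1), (-1) ^ k * x.2 0 ^ (M + 2 - k) *
      (eHat k x.1 * prodP q (M + 1 - k) (prodQ q (k - 1) (fun x => integrand q x (q * u))) x' -
      q * eHat k x.2 * prodP q (M + 1 - k) (prodQ q (k - 1) (fun x => integrand q x (q * u))) x)
      + (-1) ^ M * (∏ i ∈ univ.erase 0, x.1 i) *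
        prodQ q (M + 1) (fun x => integrand q x (q * u)) x' := by
    simp only [hatE, LinearMap.add_apply, Pi.add_apply, LinearMap.sum_apply, Finset.sum_apply]
    rfl
  rw [v4, mul_add, mul_add, mul_sum, sum_congr rfl v3, ← mul_sum, sum_sub_distrib, ← mul_sum,
    ← mul_sum, sum_eHat, sum_eHat, v1, v2, r3, telescoper, r1]
  -- `hw` clears the division in $1-a_1q^M/b_1$. The balancing relation `hrel'` cancels the terms in
  -- $u^{M+3}$ and identifies those in $u^{M+2}$ with the last summand of $\hat E_M$.
  linear_combination (q * u * x.2 0 ^ (M + 1) *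
    (∏ i ∈ range M, (1 - x.1 0 * q ^ i / x.2 0)) * reducedIntegrand q (q * u) (M + 1) x' +
    q * (-1) ^ M * (∏ i ∈ univ.erase 0, x.1 i) * u ^ (M + 2) * x.2 0 ^ M *
    (∏ i ∈ range M, (1 - x.1 0 * q ^ i / x.2 0)) * reducedIntegrand q (q * u) (M + 1) x') * hw +
    (q * x.2 0 ^ M * (∏ i ∈ range M, (1 - x.1 0 * q ^ i / x.2 0)) *
    reducedIntegrand q (q * u) (M + 1) x' * (-1) ^ M * u ^ (M + 2) * q ^ M * (x.2 0 * u - 1)) * hrel'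

end Ordinary

end QRP

namespace QRP

open Filter Topology

/-! ### Telescoping, and the system for $\varphi_{i,j}$ -/

section Solutions

variable {M : ℕ} {q : ℂ}

theorem eq_neg_of_hasSum_sub {g : ℤ → ℂ} {N : ℤ} {K S l : ℂ} (h0 : ∀ n ≤ N, g n = 0)
    (h1 : Tendsto (fun n : ℕ => g (N + n)) atTop (𝓝 l))
    (h : HasSum (fun n => K * (g (n - 1) - g n)) S) : S = -(K * l) := by
  -- The term with index $n$ contains $g(n-1)$ and $g(n)$, so the first one that can be nonzero has
  -- $n=N+1$.
  have hi : Function.Injective fun m : ℕ => N + m + 1 := fun a b hab => by simpa using hab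
  rw [← hi.hasSum_iff] at h
  · have h2 := h.tendsto_sum_nat
    refine tendsto_nhds_unique h2 ?_
    have h3 : ∀ n : ℕ, ∑ m ∈ range n, ((fun n => K * (g (n - 1) - g n)) ∘
        fun m : ℕ => N + m + 1) m = K * (0 - g (N + n)) := fun n => by
      have := sum_range_sub' (fun m : ℕ => g (N + m)) n
      simp only [Function.comp_apply, ← mul_sum, add_sub_cancel_right]
      rw [← h0 N le_rfl]
      simpa [add_assoc] using congrArg (K * ·) this
    simp_rw [h3]
    convert (h1.const_sub 0).const_mul K using 2
    ring
  · intro n hn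
    have : n ≤ N := by
      by_contra hc
      exact hn ⟨(n - N - 1).toNat, by simp only; omega⟩
    rw [h0 n this, h0 (n - 1) (by omega)]
    simp

theorem tendsto_telescoper (hq1 : ‖q‖ < 1) (x : Param M) :
    Tendsto (telescoper q x) (𝓝 0) (𝓝 1) := by
  have hc := continuous_qPoch hq1
  have hd : ∀ a b : ℂ, ContinuousAt (fun t => qPoch q (a * t) / qPoch q (b * t)) 0 := fun a b =>
    ContinuousAt.div (by fun_prop) (by fun_prop) (by simp [qPoch_zero])
  have h : ContinuousAt (telescoper q x) 0 := by
    unfold telescoper reducedIntegrand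
    refine ((hd _ _).mul (tendsto_finsetProd _ fun k _ => hd _ _)).mul (by fun_prop)
  have h0 : telescoper q x 0 = 1 := by simp [telescoper, reducedIntegrand, qPoch_zero]
  rw [← h0]
  exact h

/-- For $i=1$ the numerator is $(a_1q^Mt)_\infty$, which vanishes only from $n\le-M$ on; for the
other $i$ already $n\le0$ suffices. -/
theorem telescoper_eq_zero (hq : q ≠ 0) (hq1 : ‖q‖ < 1) {x : Param M} {i : Fin (M + 3)}
    (h0 : x.1 i ≠ 0) {n : ℤ} (hn : n ≤ -M) : telescoper q x (q ^ n / x.1 i) = 0 := by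
  rw [telescoper, reducedIntegrand]
  by_cases hi : i = 0
  · subst hi
    rw [qPoch_eq_zero hq1 (-(n + M)).toNat]
    · simp
    · rw [← zpow_natCast, ← zpow_natCast, Int.toNat_of_nonneg (by omega), zpow_neg, zpow_add₀ hq]
      have h1 := zpow_ne_zero n hq
      have h2 := zpow_ne_zero (M : ℤ) hq
      field_simp
  · rw [prod_eq_zero (mem_erase.2 ⟨hi, mem_univ i⟩) (f := fun k =>
      qPoch q (x.1 k * (q ^ n / x.1 i)) / qPoch q (x.2 k * (q ^ n / x.1 i)))]
    · simp
    · rw [qPoch_eq_zero hq1 (-n).toNat, zero_div]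
      rw [← zpow_natCast, Int.toNat_of_nonneg (by omega), zpow_neg]
      have h1 := zpow_ne_zero n hq
      field_simp

/-- The telescoper is $0$ at one end of the lattice and tends to $1$ at $t=0$. The right side is
free of `i`, so differences of half integrals are annihilated. -/
theorem hatE_jacksonSum (hq : q ≠ 0) (hq1 : ‖q‖ < 1) {i : Fin (M + 3)} {x : Param M}
    (hx : x ∈ domain q {i}) :
    hatE M q (jacksonSum q i) x =
      -(q * x.2 0 ^ (M + 1) * ∏ k ∈ range M, (1 - x.1 0 * q ^ k / x.2 0)) := by
  have h0 := (hx.2.2 i rfl).1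
  -- The orbit of `x` under all shifts is stable, and all the bilateral sums over $q^{\mathbb
  -- Z}/a_i$ converge on it with one and the same lattice.
  have hO : ∀ z ∈ Set.range fun s => shiftPoint q s x, ∀ r, shiftPoint q r z ∈
      Set.range fun s => shiftPoint q s x := by
    rintro _ ⟨s, rfl⟩ r
    exact ⟨r + s, (shiftPoint_shiftPoint hq r s x).symm⟩
  have h1 := CommutesWithSums.hatE hO
    (fun n => (q ^ n / x.1 i) • fun z => integrand q z (q ^ n / x.1 i)) (jacksonSum q i) (by
      rintro _ ⟨s, rfl⟩
      exact hasSum_jacksonSum hq hq1 hx s) x ⟨0, shiftPoint_zero x⟩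
  rw [← mul_one (q * x.2 0 ^ (M + 1) * _)]
  refine eq_neg_of_hasSum_sub (g := fun n => telescoper q x (q ^ n / x.1 i)) (N := -M)
    (fun n hn => telescoper_eq_zero hq hq1 h0 hn) ?_ (h1.congr_fun fun n => ?_)
  · refine (tendsto_telescoper hq1 x).comp ?_
    have := ((tendsto_pow_atTop_nhds_zero_of_norm_lt_one hq1).const_mul
      (q ^ (-M : ℤ) / x.1 i))
    rw [mul_zero] at this
    refine this.congr fun n => ?_
    rw [zpow_add₀ hq, zpow_natCast]
    ring
  · rw [map_smul, Pi.smul_apply, smul_eq_mul,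
      hatE_integrand hq hq1 (regular_of_mem_domain hq hx n) hx.2.1 hx.1, zpow_sub_one₀ hq]
    rw [mul_div_right_comm, div_eq_mul_inv _ q]

theorem satisfiesRP_phi (hq : q ≠ 0) (hq1 : ‖q‖ < 1) (i j : Fin (M + 3)) :
    SatisfiesRP q (domain q {i, j}) (phi (M := M) q i j) := by
  have hi : domain (M := M) q {i, j} ⊆ domain q {i} := domain_anti (by simp)
  have hj : domain (M := M) q {i, j} ⊆ domain q {j} := domain_anti (by simp)
  have key : ∀ (s r : Shift M) (c₁ c₂ c₃ : ℂ) (x : Param M),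
      (c₁ * T q s (jacksonSum q i) x - c₂ * T q r (jacksonSum q i) x +
        c₃ * jacksonSum q i x = 0) →
      (c₁ * T q s (jacksonSum q j) x - c₂ * T q r (jacksonSum q j) x +
        c₃ * jacksonSum q j x = 0) →
      (c₁ * T q s (phi q i j) x - c₂ * T q r (phi q i j) x + c₃ * phi q i j x = 0) := by
    intro s r c₁ c₂ c₃ x h1 h2
    simp only [phi_eq, map_smul, map_sub, Pi.smul_apply, Pi.sub_apply, smul_eq_mul]
    linear_combination (1 - q) * h2 - (1 - q) * h1
  refine ⟨fun x hx => ?_, fun x hx k l hk _ hkl => ?_, fun x hx k hk => ?_,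
    fun x hx k l _ hl hkl => ?_, fun x hx k hk => ?_, fun x hx k l _ _ _ => ?_,
    fun x hx k l _ _ _ => ?_, fun x hx => ?_⟩
  · rw [phi_eq, map_smul, map_sub, Pi.smul_apply, Pi.sub_apply,
      hatE_jacksonSum hq hq1 (hi hx), hatE_jacksonSum hq hq1 (hj hx), sub_self, smul_zero]
  · exact key _ _ _ _ _ x (jacksonSum_three₁ hq hq1 (hi hx) hk hkl)
      (jacksonSum_three₁ hq hq1 (hj hx) hk hkl)
  · exact key _ _ _ _ _ x (jacksonSum_three₂ hq hq1 (hi hx) hk)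
      (jacksonSum_three₂ hq hq1 (hj hx) hk)
  · exact key _ _ _ _ _ x (jacksonSum_three₃ hq hq1 (hi hx) hl hkl)
      (jacksonSum_three₃ hq hq1 (hj hx) hl hkl)
  · exact key _ _ _ _ _ x (jacksonSum_three₄ hq hq1 (hi hx) hk)
      (jacksonSum_three₄ hq hq1 (hj hx) hk)
  · exact key _ _ _ _ _ x (jacksonSum_three₅ hq hq1 (hi hx))
      (jacksonSum_three₅ hq hq1 (hj hx))
  · exact key _ _ _ _ _ x (jacksonSum_three₆ hq hq1 (hi hx))
      (jacksonSum_three₆ hq hq1 (hj hx))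
  · have h1 := jacksonSum_total hq hq1 (hi hx)
    have h2 := jacksonSum_total hq hq1 (hj hx)
    rw [phi_eq]
    simp only [map_smul, map_sub, Pi.smul_apply, Pi.sub_apply, smul_eq_mul]
    linear_combination (1 - q) * h2 - (1 - q) * h1

end Solutions

end QRP

namespace QRP

/-! ### From functional relations on $D$ to linear relations over the function field -/

section Relations

variable {M : ℕ} {q : ℂ}

/-- The algebra map on polynomials corresponding to a shift of the parameters. -/
noncomputable def scale (q : ℂ) (s : Shift M) : Poly M →+* Poly M :=
  (MvPolynomial.aeval (Sum.elim
    (fun i => MvPolynomial.C (q ^ s.1 i.castSucc) * MvPolynomial.X (Sum.inl i))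
    (fun k => MvPolynomial.C (q ^ s.2 k) * MvPolynomial.X (Sum.inr k))) :
      Poly M →ₐ[ℂ] Poly M).toRingHom

theorem evalAt_scale (s : Shift M) (p : Poly M) (x : Param M) :
    evalAt x (scale q s p) = evalAt (shiftPoint q s x) p := by
  induction p using MvPolynomial.induction_on with
  | C a => simp [scale, evalAt, MvPolynomial.algebraMap_eq]
  | add p r hp hr => rw [map_add, map_add, map_add, hp, hr]
  | mul_X p i hp =>
    rw [map_mul, map_mul, map_mul, hp]
    congr 1
    cases i <;> simp [scale, evalAt, shiftPoint]

variable (M q) in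
/-- The functions which coincide on `domain q univ` with a quotient of polynomials without
zeros of the denominator. -/
def rationalFunctions : Subring (Param M → ℂ) where
  carrier := {f | ∃ u d : Poly M, ∀ x ∈ domain q Set.univ,
    evalAt x d ≠ 0 ∧ f x * evalAt x d = evalAt x u}
  mul_mem' := by
    rintro f g ⟨u, d, h⟩ ⟨v, e, h'⟩
    refine ⟨u * v, d * e, fun x hx => ⟨?_, ?_⟩⟩
    · rw [map_mul]
      exact mul_ne_zero (h x hx).1 (h' x hx).1
    · rw [map_mul, map_mul, ← (h x hx).2, ← (h' x hx).2, Pi.mul_apply]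
      ring
  one_mem' := ⟨1, 1, fun x _ => by simp⟩
  add_mem' := by
    rintro f g ⟨u, d, h⟩ ⟨v, e, h'⟩
    refine ⟨u * e + v * d, d * e, fun x hx => ⟨?_, ?_⟩⟩
    · rw [map_mul]
      exact mul_ne_zero (h x hx).1 (h' x hx).1
    · rw [map_mul, map_add, map_mul, map_mul, ← (h x hx).2, ← (h' x hx).2, Pi.add_apply]
      ring
  zero_mem' := ⟨0, 1, fun x _ => by simp⟩
  neg_mem' := by
    rintro f ⟨u, d, h⟩
    exact ⟨-u, d, fun x hx => ⟨(h x hx).1, by rw [map_neg, ← (h x hx).2, Pi.neg_apply, neg_mul]⟩⟩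

theorem rationalFunctions_shift (hq : q ≠ 0) {s : Shift M} (hs : s ∈ admissible M)
    {f : Param M → ℂ} (hf : f ∈ rationalFunctions M q) :
    (fun x => f (shiftPoint q s x)) ∈ rationalFunctions M q := by
  obtain ⟨u, d, h⟩ := hf
  refine ⟨scale q s u, scale q s d, fun x hx => ?_⟩
  rw [evalAt_scale, evalAt_scale]
  exact h _ (shiftPoint_mem_domain hq hs hx)

theorem const_mem_rationalFunctions (c : ℂ) : (fun _ => c) ∈ rationalFunctions M q :=
  ⟨MvPolynomial.C c, 1, fun x _ => by simp [evalAt]⟩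

theorem snd_mem_rationalFunctions (k : Fin (M + 3)) :
    (fun x : Param M => x.2 k) ∈ rationalFunctions M q :=
  ⟨MvPolynomial.X (Sum.inr k), 1, fun x _ => by simp [evalAt]⟩

theorem inv_snd_mem_rationalFunctions :
    (fun x : Param M => (x.2 0)⁻¹) ∈ rationalFunctions M q :=
  ⟨1, MvPolynomial.X (Sum.inr 0), fun x hx => by simp [evalAt, hx.2.1]⟩

theorem fst_mem_rationalFunctions (k : Fin (M + 3)) :
    (fun x : Param M => x.1 k) ∈ rationalFunctions M q := by
  induction k using Fin.lastCases with
  | cast k => exact ⟨MvPolynomial.X (Sum.inl k), 1, fun x _ => by simp [evalAt]⟩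
  | last =>
    -- $a_{M+3}$ is not an independent coordinate and is obtained from the product relation.
    refine ⟨MvPolynomial.C (q ^ 2) * ∏ k, MvPolynomial.X (Sum.inr k),
      ∏ k, MvPolynomial.X (Sum.inl k), fun x hx => ⟨?_, ?_⟩⟩
    · simp only [evalAt, map_prod, MvPolynomial.eval_X, Sum.elim_inl]
      exact prod_ne_zero_iff.2 fun i _ => (hx.2.2 _ trivial).1
    · simp only [evalAt, map_prod, MvPolynomial.eval_X, Sum.elim_inl, map_mul,
        MvPolynomial.eval_C, Sum.elim_inr]
      rw [← hx.1, Fin.prod_univ_castSucc fun i => x.1 i, mul_comm]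

theorem exists_common_denominator {ι : Type*} (I : Finset ι) {f : ι → Param M → ℂ}
    (hf : ∀ i ∈ I, f i ∈ rationalFunctions M q) :
    ∃ (d : Poly M) (u : ι → Poly M), ∀ x ∈ domain q Set.univ, evalAt x d ≠ 0 ∧
      ∀ i ∈ I, f i x * evalAt x d = evalAt x (u i) := by
  classical
  have : ∀ i, ∃ u d : Poly M, i ∈ I → ∀ x ∈ domain q Set.univ,
      evalAt x d ≠ 0 ∧ f i x * evalAt x d = evalAt x u := fun i => by
    by_cases hi : i ∈ I
    · obtain ⟨u, d, h⟩ := hf i hi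
      exact ⟨u, d, fun _ => h⟩
    · exact ⟨0, 0, fun h => absurd h hi⟩
  choose u d h using this
  refine ⟨∏ i ∈ I, d i, fun i => u i * ∏ j ∈ I.erase i, d j, fun x hx => ⟨?_, fun i hi => ?_⟩⟩
  · rw [map_prod]
    exact prod_ne_zero_iff.2 fun i hi => (h i hi x hx).1
  · rw [← mul_prod_erase _ _ hi, map_mul, map_mul, ← (h i hi x hx).2]
    ring

/-- The class of the formal expression `T^s y` modulo the expressions vanishing on solutions. -/
noncomputable def shiftClass (q : ℂ) (Sol : Set (Param M → ℂ)) (s : Shift M) :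
    (Shift M →₀ RatFun M) ⧸ vanishing q (domain q Set.univ) Sol :=
  (vanishing q (domain q Set.univ) Sol).mkQ (Finsupp.single s 1)

theorem sum_smul_shiftClass_eq_zero {Sol : Set (Param M → ℂ)} {ι : Type*} (I : Finset ι)
    (u : ι → Poly M) (s : ι → Shift M) (h : ∀ y ∈ Sol, ∀ x ∈ domain q Set.univ,
      ∑ i ∈ I, evalAt x (u i) * y (shiftPoint q (s i) x) = 0) :
    ∑ i ∈ I, algebraMap (Poly M) (RatFun M) (u i) • shiftClass q Sol (s i) = 0 := by
  simp only [shiftClass, ← map_smul, ← map_sum]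
  rw [Submodule.mkQ_apply, Submodule.Quotient.mk_eq_zero]
  refine ⟨1, one_ne_zero, ∑ i ∈ I, Finsupp.single (s i) (u i), ?_, ?_⟩
  · simp [toRat, Algebra.smul_def]
  · intro y hy x hx
    have h1 : ∀ P : Shift M →₀ Poly M, (P.sum fun s p => evalAt x p * T q s y x) =
        Finsupp.liftAddHom (fun s => (AddMonoidHom.mulRight (T q s y x)).comp
          (evalAt x).toAddMonoidHom) P := fun P => rfl
    rw [h1, map_sum, ← h y hy x hx]
    refine sum_congr rfl fun i _ => ?_
    rw [Finsupp.liftAddHom_apply_single]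
    rfl

/-- After clearing denominators, the relation is solved for the term `i`. A single point of $D$
suffices to show that the numerator of its coefficient is a nonzero polynomial, hence invertible in
the field. -/
theorem shiftClass_mem_of_relation (hD : (domain (M := M) q Set.univ).Nonempty)
    {Sol : Set (Param M → ℂ)} {ι : Type*} (I : Finset ι) (f : ι → Param M → ℂ)
    (hf : ∀ i ∈ I, f i ∈ rationalFunctions M q) (s : ι → Shift M)
    (h : ∀ y ∈ Sol, ∀ x ∈ domain q Set.univ, ∑ i ∈ I, f i x * y (shiftPoint q (s i) x) = 0)
    {i : ι} (hi : i ∈ I) (hi0 : ∀ x ∈ domain q Set.univ, f i x ≠ 0)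
    {W : Submodule (RatFun M) ((Shift M →₀ RatFun M) ⧸ vanishing q (domain q Set.univ) Sol)}
    (hW : ∀ j ∈ I, j ≠ i → shiftClass q Sol (s j) ∈ W) : shiftClass q Sol (s i) ∈ W := by
  classical
  obtain ⟨d, u, hd⟩ := exists_common_denominator I hf
  have h1 := sum_smul_shiftClass_eq_zero (q := q) (Sol := Sol) I u s fun y hy x hx => by
    have := h y hy x hx
    calc _ = evalAt x d * ∑ i ∈ I, f i x * y (shiftPoint q (s i) x) := by
            rw [mul_sum]
            refine sum_congr rfl fun j hj => ?_
            rw [← (hd x hx).2 j hj]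
            ring
      _ = 0 := by rw [this, mul_zero]
  obtain ⟨x, hx⟩ := hD
  have hu : algebraMap (Poly M) (RatFun M) (u i) ≠ 0 := by
    rw [Ne, FaithfulSMul.algebraMap_eq_zero_iff]
    intro hu
    have := (hd x hx).2 i hi
    rw [hu, map_zero] at this
    exact mul_ne_zero (hi0 x hx) (hd x hx).1 this
  rw [← add_sum_erase _ _ hi] at h1
  rw [← Submodule.smul_mem_iff W hu, eq_neg_of_add_eq_zero_left h1]
  exact W.neg_mem (W.sum_mem fun j hj =>
    W.smul_mem _ (hW j (mem_of_mem_erase hj) (ne_of_mem_erase hj)))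

end Relations

end QRP

namespace QRP

/-! ### $\hat E_M T$ as a polynomial in $T$, and its extreme coefficients -/

section NormalForm

open Polynomial

variable {M : ℕ} {q : ℂ}

/-- The operator `∑ c_j T^j`, `T = T_{a₁} T_{b₁}`, attached to the polynomial `∑ c_j X^j`. -/
noncomputable def opOf (q : ℂ) : (Param M → ℂ)[X] →+ Module.End ℂ (Param M → ℂ) where
  toFun p := p.sum fun j c => mulOp c * T q ((j : ℤ) • (sA 0 + sB 0))
  map_zero' := Polynomial.sum_zero_index _
  map_add' p r := Polynomial.sum_add_index p r _ (fun j => by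
    ext; simp [mulOp]) (fun j c d => by
    ext; simp [mulOp, add_mul])

theorem opOf_monomial (j : ℕ) (c : Param M → ℂ) :
    opOf q (monomial j c) = mulOp c * T q ((j : ℤ) • (sA 0 + sB 0)) :=
  Polynomial.sum_monomial_index c (fun j c => mulOp c * T q ((j : ℤ) • (sA 0 + sB 0)))
    (by ext; simp [mulOp])

theorem opOf_apply {p : (Param M → ℂ)[X]} {n : ℕ} (hp : p.natDegree < n) (y : Param M → ℂ)
    (x : Param M) : opOf q p y x =
      ∑ j ∈ range n, p.coeff j x * y (shiftPoint q ((j : ℤ) • (sA 0 + sB 0)) x) := by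
  change (p.sum fun j c => mulOp c * T q ((j : ℤ) • (sA 0 + sB 0)) :
    Module.End ℂ (Param M → ℂ)) y x = _
  rw [Polynomial.sum_over_range' p (fun j => by ext; simp [mulOp]) n hp]
  simp only [LinearMap.sum_apply, Finset.sum_apply]
  rfl

theorem opOf_one : opOf (M := M) q 1 = 1 := by
  rw [← monomial_zero_one, opOf_monomial]
  ext y x
  simp [mulOp, T, shiftPoint]

theorem opOf_C_mul (c : Param M → ℂ) (p : (Param M → ℂ)[X]) :
    opOf q (C c * p) = mulOp c * opOf q p := by
  induction p using Polynomial.induction_on' with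
  | add p r hp hr => rw [mul_add, map_add, map_add, hp, hr, mul_add]
  | monomial j d =>
    rw [C_mul_monomial, opOf_monomial, opOf_monomial]
    ext y x
    simp [mulOp, T]

theorem opOf_mul_X (hq : q ≠ 0) (p : (Param M → ℂ)[X]) :
    opOf q (p * X) = opOf q p * T q (sA 0 + sB 0) := by
  induction p using Polynomial.induction_on' with
  | add p r hp hr => rw [add_mul, map_add, map_add, hp, hr, add_mul]
  | monomial j d =>
    rw [monomial_mul_X, opOf_monomial, opOf_monomial]
    ext y x
    simp only [mulOp, T, Module.End.mul_apply, LinearMap.coe_mk, AddHom.coe_mk,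
      LinearMap.mulLeft_apply, Pi.mul_apply]
    rw [shiftPoint_shiftPoint hq, Nat.cast_succ, add_smul, one_smul, add_comm (sA 0 + sB 0)]

/-- Coefficients do not commute with $T$ in general. For $T$-invariant ones the commutative
polynomial ring models composition, and the factors of `prodP` and `prodQ` are of this kind. -/
theorem opOf_mul_C {c : Param M → ℂ} (hc : ∀ x, c (shiftPoint q (sA 0 + sB 0) x) = c x)
    (hq : q ≠ 0) (p : (Param M → ℂ)[X]) : opOf q (p * C c) = opOf q p * mulOp c := by
  have h : ∀ (j : ℕ) x, c (shiftPoint q ((j : ℤ) • (sA 0 + sB 0)) x) = c x := fun j => by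
    induction j with
    | zero => intro x; rw [Nat.cast_zero, zero_smul, shiftPoint_zero]
    | succ j ih =>
      intro x
      rw [Nat.cast_succ, add_smul, one_smul, ← shiftPoint_shiftPoint hq, ih, hc]
  induction p using Polynomial.induction_on' with
  | add p r hp hr => rw [add_mul, map_add, map_add, hp, hr, add_mul]
  | monomial j d =>
    rw [monomial_mul_C, opOf_monomial, opOf_monomial]
    ext y x
    simp only [mulOp, T, Module.End.mul_apply, LinearMap.coe_mk, AddHom.coe_mk,
      LinearMap.mulLeft_apply, Pi.mul_apply, h]
    ring

theorem opOf_mul_list_prod (hq : q ≠ 0) {r : ℕ → Param M → ℂ}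
    (hr : ∀ i x, r i (shiftPoint q (sA 0 + sB 0) x) = r i x) (n : ℕ) (p : (Param M → ℂ)[X]) :
    opOf q p * ((List.range n).map fun i => 1 - mulOp (r i) * T q (sA 0 + sB 0)).prod =
      opOf q (p * ∏ i ∈ range n, (1 - C (r i) * X)) := by
  induction n with
  | zero => simp
  | succ n ih =>
    rw [List.range_succ, List.map_append, List.prod_append, ← mul_assoc, ih, List.map_singleton,
      List.prod_singleton, prod_range_succ, ← mul_assoc, mul_sub, mul_sub, mul_one, mul_one,
      map_sub, ← mul_assoc, ← mul_assoc, opOf_mul_X hq, opOf_mul_C (hr n) hq]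

theorem T_neg_commute (hq : q ≠ 0) {r : ℕ → Param M → ℂ}
    (hr : ∀ i x, r i (shiftPoint q (sA 0 + sB 0) x) = r i x) (n : ℕ) :
    Commute (T q (-(sA 0 + sB 0)))
      ((List.range n).map fun i => 1 - mulOp (r i) * T q (sA 0 + sB 0)).prod := by
  refine Commute.list_prod_right _ _ fun A hA => ?_
  obtain ⟨i, -, rfl⟩ := List.mem_map.1 hA
  refine (Commute.one_right _).sub_right ?_
  ext y x
  have h : r i (shiftPoint q (-(sA 0 + sB 0)) x) = r i x := by
    rw [← hr, shiftPoint_shiftPoint hq, add_neg_cancel, shiftPoint_zero]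
  simp only [mulOp, T, Module.End.mul_apply, LinearMap.coe_mk, AddHom.coe_mk,
    LinearMap.mulLeft_apply, Pi.mul_apply, h, shiftPoint_shiftPoint hq, add_comm]

variable (M) in
/-- The polynomial of `prodP`. -/
noncomputable def polyP (q : ℂ) (n : ℕ) : (Param M → ℂ)[X] :=
  ∏ i ∈ range n, (1 - C (fun x => x.1 0 * q ^ i / x.2 0) * X)

variable (M) in
/-- The polynomial of `prodQ`. -/
noncomputable def polyQ (q : ℂ) (n : ℕ) : (Param M → ℂ)[X] :=
  ∏ i ∈ range n, (1 - C (fun _ => (q ^ i)⁻¹) * X)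

theorem opOf_mul_prodP (hq : q ≠ 0) (n : ℕ) (p : (Param M → ℂ)[X]) :
    opOf q p * prodP q n = opOf q (p * polyP M q n) :=
  opOf_mul_list_prod hq (fun _ => shift_ratio hq _) n p

theorem opOf_mul_prodQ (hq : q ≠ 0) (n : ℕ) (p : (Param M → ℂ)[X]) :
    opOf q p * prodQ q n = opOf q (p * polyQ M q n) :=
  opOf_mul_list_prod hq (fun _ _ => rfl) n p

variable (M) in
/-- The polynomial of `Ê_M T`, where `T = T_{a₁} T_{b₁}`. -/
noncomputable def polyE (q : ℂ) : (Param M → ℂ)[X] :=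
  C (fun x => x.2 0 ^ (M + 2)) * polyP M q (M + 1)
  + ∑ k ∈ Icc 1 (M + 1), C (fun x => (-1) ^ k * x.2 0 ^ (M + 2 - k)) *
      (C (fun x : Param M => eHat k x.1) - C (fun x : Param M => q * eHat k x.2) * X) *
      polyP M q (M + 1 - k) * polyQ M q (k - 1)
  + C (fun x => (-1) ^ M * ∏ i ∈ univ.erase 0, x.1 i) * polyQ M q (M + 1)

theorem T_mul_T (hq : q ≠ 0) (s r : Shift M) : T q s * T q r = T q (s + r) := by
  ext y x
  simp only [T, Module.End.mul_apply, LinearMap.coe_mk, AddHom.coe_mk]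
  rw [shiftPoint_shiftPoint hq, add_comm]

theorem T_zero : T (M := M) q 0 = 1 := by
  ext y x
  simp [T, shiftPoint_zero]

theorem hatE_eq (hq : q ≠ 0) :
    hatE M q = opOf q (polyE M q) * T q (-(sA 0 + sB 0)) := by
  have h1 : ∀ n, opOf q (polyP M q n) = prodP q n := fun n => by
    rw [← one_mul (polyP M q n), ← opOf_mul_prodP hq, opOf_one, one_mul]
  have h2 : ∀ n, opOf q (polyQ M q n) = prodQ q n := fun n => by
    rw [← one_mul (polyQ M q n), ← opOf_mul_prodQ hq, opOf_one, one_mul]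
  have cP : ∀ n, T q (-(sA 0 + sB 0)) * prodP (M := M) q n =
      prodP q n * T q (-(sA 0 + sB 0)) := fun n =>
    (T_neg_commute hq (fun _ => shift_ratio hq _) n).eq
  have cQ : ∀ n, T q (-(sA 0 + sB 0)) * prodQ (M := M) q n =
      prodQ q n * T q (-(sA 0 + sB 0)) := fun n =>
    (T_neg_commute hq (fun _ _ => rfl) n).eq
  have hX : opOf (M := M) q X = T q (sA 0 + sB 0) := by
    rw [← one_mul X, opOf_mul_X hq, opOf_one, one_mul]
  have hC : ∀ c : Param M → ℂ, opOf q (C c) = mulOp c := fun c => by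
    rw [← mul_one (C c), opOf_C_mul, opOf_one, mul_one]
  rw [polyE, map_add, map_add, map_sum, add_mul, add_mul, sum_mul, hatE]
  congr 1
  · congr 1
    · rw [opOf_C_mul, h1, mul_assoc, mul_assoc, cP]
    · refine sum_congr rfl fun k _ => ?_
      rw [← opOf_mul_prodQ hq, ← opOf_mul_prodP hq, opOf_C_mul, map_sub, hC, opOf_C_mul, hX]
      -- $T^{-1}$ is split off on the right of the bracket; it then moves past the products because
      -- it commutes with their factors.
      have : (mulOp (fun x => eHat k x.1) * T q (-(sA 0 + sB 0)) -
          mulOp (fun x : Param M => q * eHat k x.2)) =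
          (mulOp (fun x => eHat k x.1) - mulOp (fun x => q * eHat k x.2) * T q (sA 0 + sB 0)) *
            T q (-(sA 0 + sB 0)) := by
        rw [sub_mul, mul_assoc, T_mul_T hq, add_neg_cancel, T_zero, mul_one]
      rw [this]
      simp only [mul_assoc]
      rw [← cQ, ← mul_assoc (prodP q _) (T q _), ← cP]
      simp only [mul_assoc]
  · rw [opOf_C_mul, h2, mul_assoc, mul_assoc, cQ]

theorem natDegree_one_sub_C_mul_X_le (c : Param M → ℂ) : (1 - C c * X).natDegree ≤ 1 :=
  (natDegree_sub_le _ _).trans (max_le (by simp) ((natDegree_C_mul_le _ _).trans natDegree_X_le))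

theorem natDegree_polyP_le (n : ℕ) : (polyP M q n).natDegree ≤ n := by
  refine (natDegree_prod_le _ _).trans ?_
  refine (sum_le_card_nsmul _ _ 1 fun i _ => natDegree_one_sub_C_mul_X_le _).trans (by simp)

theorem natDegree_polyQ_le (n : ℕ) : (polyQ M q n).natDegree ≤ n := by
  refine (natDegree_prod_le _ _).trans ?_
  refine (sum_le_card_nsmul _ _ 1 fun i _ => natDegree_one_sub_C_mul_X_le _).trans (by simp)

theorem coeff_polyP (n : ℕ) :
    (polyP M q n).coeff n = ∏ i ∈ range n, -(fun x : Param M => x.1 0 * q ^ i / x.2 0) := by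
  have := coeff_prod_of_natDegree_le (range n)
    (fun i => 1 - C (fun x : Param M => x.1 0 * q ^ i / x.2 0) * X) 1
    fun i _ => natDegree_one_sub_C_mul_X_le _
  rw [card_range, mul_one] at this
  rw [polyP, this]
  refine prod_congr rfl fun i _ => ?_
  rw [coeff_sub, coeff_C_mul_X, coeff_one]
  simp

theorem coeff_polyQ (n : ℕ) :
    (polyQ M q n).coeff n = ∏ i ∈ range n, -(fun _ : Param M => (q ^ i)⁻¹) := by
  have := coeff_prod_of_natDegree_le (range n)
    (fun i => 1 - C (fun _ : Param M => (q ^ i)⁻¹) * X) 1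
    fun i _ => natDegree_one_sub_C_mul_X_le _
  rw [card_range, mul_one] at this
  rw [polyQ, this]
  refine prod_congr rfl fun i _ => ?_
  rw [coeff_sub, coeff_C_mul_X, coeff_one]
  simp

theorem natDegree_linear_le (c d : Param M → ℂ) : (C c - C d * X).natDegree ≤ 1 :=
  (natDegree_sub_le _ _).trans (max_le (by simp) ((natDegree_C_mul_le _ _).trans natDegree_X_le))

theorem natDegree_term_le {k : ℕ} (hk : k ∈ Icc 1 (M + 1)) (b c d : Param M → ℂ) :
    (C b * (C c - C d * X) * polyP M q (M + 1 - k) * polyQ M q (k - 1)).natDegree ≤ M + 1 := by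
  have h1 := natDegree_polyP_le (M := M) (q := q) (M + 1 - k)
  have h2 := natDegree_polyQ_le (M := M) (q := q) (k - 1)
  have h3 := (natDegree_C_mul_le b (C c - C d * X)).trans (natDegree_linear_le c d)
  have h := natDegree_mul_le_of_le (natDegree_mul_le_of_le h3 h1) h2
  refine h.trans ?_
  have := mem_Icc.1 hk
  omega

theorem natDegree_polyE_le : (polyE M q).natDegree ≤ M + 1 := by
  refine natDegree_add_le_of_degree_le (natDegree_add_le_of_degree_le ?_ ?_) ?_
  · exact (natDegree_C_mul_le _ _).trans (natDegree_polyP_le _)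
  · exact natDegree_sum_le_of_forall_le _ _ fun k hk => natDegree_term_le hk _ _ _
  · exact (natDegree_C_mul_le _ _).trans (natDegree_polyQ_le _)

/-- Setting $T=0$ leaves the full expansion $b_1^{M+2}\prod_{k\ge2}(1-a_k/b_1)$, and $a_k\ne b_1$ on
$D$. -/
theorem coeff_polyE_zero_ne_zero {x : Param M} (hx : x ∈ domain q Set.univ) :
    (polyE M q).coeff 0 x ≠ 0 := by
  have hb := hx.2.1
  have hP : ∀ n, (polyP M q n).coeff 0 = 1 := fun n => by
    simp [polyP, coeff_zero_eq_eval_zero, eval_prod]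
  have hQ : ∀ n, (polyQ M q n).coeff 0 = 1 := fun n => by
    simp [polyQ, coeff_zero_eq_eval_zero, eval_prod]
  have h : (polyE M q).coeff 0 x =
      x.2 0 ^ (M + 2) * ∏ i ∈ univ.erase 0, (1 - x.1 i * (x.2 0)⁻¹) := by
    have h1 := sum_eHat x.1 (x.2 0)⁻¹
    rw [← sub_eq_zero] at h1 ⊢
    simp only [polyE, coeff_add, finsetSum_coeff, mul_coeff_zero, hP, hQ, coeff_C_zero, mul_one,
      coeff_sub, coeff_X_zero, mul_zero, sub_zero, Pi.add_apply, Finset.sum_apply, Pi.mul_apply]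
    have h2 : ∑ k ∈ Icc 1 (M + 1), (-1) ^ k * x.2 0 ^ (M + 2 - k) * eHat k x.1 =
        x.2 0 ^ (M + 2) * ∑ k ∈ Icc 1 (M + 1), (-1) ^ k * eHat k x.1 * (x.2 0)⁻¹ ^ k := by
      rw [mul_sum]
      refine sum_congr rfl fun k hk => ?_
      have : x.2 0 ^ (M + 2) = x.2 0 ^ (M + 2 - k) * x.2 0 ^ k := by
        rw [← pow_add]; congr 1; have := mem_Icc.1 hk; omega
      have h4 : x.2 0 ^ k * (x.2 0)⁻¹ ^ k = 1 := by rw [← mul_pow, mul_inv_cancel₀ hb, one_pow]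
      rw [this]
      linear_combination (-(-1) ^ k * x.2 0 ^ (M + 2 - k) * eHat k x.1) * h4
    rw [h2]
    have h3 : x.2 0 ^ (M + 2) * (x.2 0)⁻¹ ^ (M + 2) = 1 := by
      rw [← mul_pow, mul_inv_cancel₀ hb, one_pow]
    linear_combination x.2 0 ^ (M + 2) * h1 - ((-1) ^ M * ∏ i ∈ univ.erase 0, x.1 i) * h3
  rw [h]
  refine mul_ne_zero (pow_ne_zero _ hb) (prod_ne_zero_iff.2 fun i _ hi => ?_)
  apply (hx.2.2 i trivial).2 0 0
  field_simp at hi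
  rw [zpow_zero, mul_one]
  linear_combination hi

theorem coeff_polyP_apply (n : ℕ) (x : Param M) :
    (polyP M q n).coeff n x = (-1) ^ n * (x.1 0 / x.2 0) ^ n * ∏ i ∈ range n, q ^ i := by
  rw [coeff_polyP, Finset.prod_apply]
  conv_rhs => rw [← mul_pow, ← card_range n, ← prod_const, card_range, ← prod_mul_distrib]
  refine prod_congr rfl fun i _ => ?_
  rw [Pi.neg_apply]
  ring

theorem coeff_polyQ_apply (n : ℕ) (x : Param M) :
    (polyQ M q n).coeff n x = (-1) ^ n * (∏ i ∈ range n, q ^ i)⁻¹ := by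
  rw [coeff_polyQ, Finset.prod_apply, ← prod_inv_distrib]
  conv_rhs => rw [← card_range n, ← prod_const, card_range, ← prod_mul_distrib]
  refine prod_congr rfl fun i _ => ?_
  rw [Pi.neg_apply]
  ring

/-- Bookkeeping of triangular exponents: it shows that the leading coefficients of the terms $k=j+1$
of `polyE` are a common factor times the $k$-th power of $q^{1-M}/a_1$. -/
theorem prod_range_pow_relation (hq : q ≠ 0) {j : ℕ} (hj : j ≤ M) :
    q * (∏ i ∈ range (M - j), q ^ i) * (∏ i ∈ range j, q ^ i)⁻¹ =
      (∏ i ∈ range (M + 1), q ^ i) * (q * (q ^ M)⁻¹) ^ (j + 1) := by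
  induction j with
  | zero =>
    rw [Nat.sub_zero, prod_range_succ]
    have := pow_ne_zero M hq
    simp
    field_simp
  | succ j ih =>
    have ih := ih (by omega)
    obtain ⟨m, hm⟩ : ∃ m, M = m + j + 1 := ⟨M - j - 1, by omega⟩
    rw [pow_succ _ (j + 1), ← mul_assoc, ← ih, show M - j = m + 1 by omega,
      show M - (j + 1) = m by omega, prod_range_succ _ m, prod_range_succ _ j, hm]
    have h1 := pow_ne_zero m hq
    have h2 := pow_ne_zero j hq
    have h3 : ∏ i ∈ range j, q ^ i ≠ 0 := prod_ne_zero_iff.2 fun i _ => pow_ne_zero i hq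
    field_simp
    ring

/-- The top coefficients of the middle terms assemble into the generating function of the $e_k(\hat
b)$ at $z=q^{1-M}/a_1$. The first summand of `polyE` supplies degree $0$; the last one supplies
degree $M+2$ through the balancing relation (`hlast`). -/
theorem coeff_polyE_last (hq : q ≠ 0) {x : Param M} (hx : x ∈ domain q Set.univ) :
    (polyE M q).coeff (M + 1) x =
      (-1) ^ (M + 1) * x.2 0 * x.1 0 ^ (M + 1) * (∏ i ∈ range (M + 1), q ^ i) *
        ∏ k ∈ univ.erase 0, (1 - x.2 k * (q * (q ^ M)⁻¹ / x.1 0)) := by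
  have hb := hx.2.1
  have ha := (hx.2.2 0 trivial).1
  have hterm : ∀ k ∈ Icc 1 (M + 1), (C (fun x : Param M => (-1) ^ k * x.2 0 ^ (M + 2 - k)) *
      (C (fun x : Param M => eHat k x.1) - C (fun x : Param M => q * eHat k x.2) * X) *
      polyP M q (M + 1 - k) * polyQ M q (k - 1)).coeff (M + 1) x =
      (-1) ^ (M + 1) * x.2 0 * x.1 0 ^ (M + 1) * (∏ i ∈ range (M + 1), q ^ i) *
        ((-1) ^ k * eHat k x.2 * (q * (q ^ M)⁻¹ / x.1 0) ^ k) := by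
    intro k hk
    obtain ⟨j, rfl⟩ : ∃ j, k = j + 1 := ⟨k - 1, by have := (mem_Icc.1 hk).1; omega⟩
    have hj : j ≤ M := by have := (mem_Icc.1 hk).2; omega
    -- The degree bounds of the three factors add up to exactly $M+1$, so the coefficient is the
    -- product of the top coefficients.
    have e1 : M + 1 = (1 + (M + 1 - (j + 1))) + (j + 1 - 1) := by omega
    have d1 := (natDegree_C_mul_le (fun x : Param M => (-1) ^ (j + 1) * x.2 0 ^ (M + 2 - (j + 1)))
      (C (fun x : Param M => eHat (j + 1) x.1) - C (fun x : Param M => q * eHat (j + 1) x.2) * X)).trans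
      (natDegree_linear_le _ _)
    have d2 := natDegree_polyP_le (M := M) (q := q) (M + 1 - (j + 1))
    have d3 := natDegree_polyQ_le (M := M) (q := q) (j + 1 - 1)
    have hc := coeff_mul_add_eq_of_natDegree_le (natDegree_mul_le_of_le d1 d2) d3
    rw [← e1, coeff_mul_add_eq_of_natDegree_le d1 d2, coeff_C_mul, coeff_sub, coeff_C_mul_X,
      coeff_C] at hc
    rw [hc]
    simp only [Pi.mul_apply, Pi.sub_apply, one_ne_zero, if_false, if_true, Pi.zero_apply,
      coeff_polyP_apply, coeff_polyQ_apply]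
    have h := prod_range_pow_relation hq hj
    rw [div_pow]
    have e2 : M + 1 - (j + 1) = M - j := by omega
    rw [e2, show M + 2 - (j + 1) = M - j + 1 by omega, Nat.add_sub_cancel]
    have e3 : x.1 0 ^ (M + 1) = x.1 0 ^ (M - j) * x.1 0 ^ (j + 1) := by
      rw [← pow_add]; congr 1; omega
    have e4 : (-1 : ℂ) ^ (M + 1) = (-1) ^ (M - j) * (-1) ^ (j + 1) := by
      rw [← pow_add]; congr 1; omega
    have e5 : x.1 0 ^ (j + 1) * (x.1 0 ^ (j + 1))⁻¹ = 1 := mul_inv_cancel₀ (pow_ne_zero _ ha)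
    have e6 : x.2 0 ^ (M - j + 1) * (x.1 0 / x.2 0) ^ (M - j) = x.2 0 * x.1 0 ^ (M - j) := by
      rw [div_pow, pow_succ]
      have := pow_ne_zero (M - j) hb
      field_simp
    rw [e3, e4]
    linear_combination ((-1) ^ (j + 1) * (0 - q * eHat (j + 1) x.2) * (-1) ^ (M - j) * (-1) ^ j *
      (∏ i ∈ range (M - j), q ^ i) * (∏ i ∈ range j, q ^ i)⁻¹) * e6 +
      ((-1) ^ (M - j) * x.2 0 * x.1 0 ^ (M - j) * (-1) ^ (j + 1) * (-1) ^ (j + 1) *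
        eHat (j + 1) x.2) * h - ((-1) ^ (M - j) * (-1) ^ (j + 1) * x.2 0 * x.1 0 ^ (M - j) *
        (∏ i ∈ range (M + 1), q ^ i) * (-1) ^ (j + 1) * eHat (j + 1) x.2 *
        (q * (q ^ M)⁻¹) ^ (j + 1)) * e5
  have hrel : x.1 0 * ∏ k ∈ univ.erase 0, x.1 k =
      q ^ 2 * (x.2 0 * ∏ k ∈ univ.erase 0, x.2 k) := by
    rw [mul_prod_erase _ _ (mem_univ _), mul_prod_erase _ _ (mem_univ _), hx.1]
  have hlast : (∏ k ∈ univ.erase 0, x.1 k) * (∏ i ∈ range (M + 1), q ^ i)⁻¹ =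
      x.2 0 * x.1 0 ^ (M + 1) * (∏ i ∈ range (M + 1), q ^ i) *
        ((∏ k ∈ univ.erase 0, x.2 k) * (q * (q ^ M)⁻¹ / x.1 0) ^ (M + 2)) := by
    have h := prod_range_pow_relation hq (le_refl M)
    rw [Nat.sub_self, range_zero, prod_empty, mul_one] at h
    have hM := pow_ne_zero M hq
    have hM1 := pow_ne_zero (M + 1) ha
    have h3 : ∏ i ∈ range M, q ^ i ≠ 0 := prod_ne_zero_iff.2 fun i _ => pow_ne_zero i hq
    have e1 : (∏ i ∈ range (M + 1), q ^ i)⁻¹ = (∏ i ∈ range M, q ^ i)⁻¹ * (q ^ M)⁻¹ := by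
      rw [prod_range_succ, mul_inv]
    rw [div_pow, pow_succ _ (M + 1), pow_succ (x.1 0) (M + 1)]
    apply mul_left_cancel₀ ha
    rw [← mul_assoc, hrel, e1]
    have e2 : x.1 0 * (x.2 0 * x.1 0 ^ (M + 1) * (∏ i ∈ range (M + 1), q ^ i) *
        ((∏ k ∈ univ.erase 0, x.2 k) * ((q * (q ^ M)⁻¹) ^ (M + 1) * (q * (q ^ M)⁻¹) /
          (x.1 0 ^ (M + 1) * x.1 0)))) = x.2 0 * (∏ k ∈ univ.erase 0, x.2 k) *
        ((∏ i ∈ range (M + 1), q ^ i) * (q * (q ^ M)⁻¹) ^ (M + 1)) * (q * (q ^ M)⁻¹) := by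
      field_simp
    rw [e2, ← h]
    ring
  have h0 : (polyE M q).coeff (M + 1) x = x.2 0 ^ (M + 2) * (polyP M q (M + 1)).coeff (M + 1) x +
      ∑ k ∈ Icc 1 (M + 1), (C (fun x : Param M => (-1) ^ k * x.2 0 ^ (M + 2 - k)) *
      (C (fun x : Param M => eHat k x.1) - C (fun x : Param M => q * eHat k x.2) * X) *
      polyP M q (M + 1 - k) * polyQ M q (k - 1)).coeff (M + 1) x +
      (-1) ^ M * (∏ i ∈ univ.erase 0, x.1 i) * (polyQ M q (M + 1)).coeff (M + 1) x := by
    simp only [polyE, coeff_add, finsetSum_coeff, coeff_C_mul, Pi.add_apply, Finset.sum_apply,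
      Pi.mul_apply]
  rw [h0, sum_congr rfl hterm, ← mul_sum, sum_eHat, coeff_polyP_apply, coeff_polyQ_apply]
  have e6 : x.2 0 ^ (M + 2) * (x.1 0 / x.2 0) ^ (M + 1) = x.2 0 * x.1 0 ^ (M + 1) := by
    rw [div_pow, pow_succ]
    have := pow_ne_zero (M + 1) hb
    field_simp
  linear_combination ((-1) ^ (M + 1) * ∏ i ∈ range (M + 1), q ^ i) * e6 +
    ((-1) ^ M * (-1) ^ (M + 1)) * hlast

theorem coeff_polyE_last_ne_zero (hq : q ≠ 0) {x : Param M} (hx : x ∈ domain q Set.univ) :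
    (polyE M q).coeff (M + 1) x ≠ 0 := by
  have ha := (hx.2.2 0 trivial).1
  rw [coeff_polyE_last hq hx]
  refine mul_ne_zero (mul_ne_zero (mul_ne_zero (mul_ne_zero (pow_ne_zero _ (by norm_num)) hx.2.1)
    (pow_ne_zero _ ha)) (prod_ne_zero_iff.2 fun i _ => pow_ne_zero i hq))
    (prod_ne_zero_iff.2 fun k _ hk => ?_)
  -- A vanishing factor would mean $b_kq^{1-M}=a_1$, which is excluded on $D$.
  apply (hx.2.2 0 trivial).2 k (1 - M)
  rw [zpow_sub₀ hq, zpow_one, zpow_natCast]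
  have := pow_ne_zero M hq
  field_simp at hk
  field_simp
  linear_combination -hk

end NormalForm

end QRP

namespace QRP

/-! ### Windows of $M+1$ consecutive powers of $T$ and the upper bound -/

section Window

variable {M : ℕ} {q : ℂ}

open Polynomial in
theorem coeff_polyE_mem (j : ℕ) : (polyE M q).coeff j ∈ rationalFunctions M q := by
  have hC : ∀ {f : Param M → ℂ}, f ∈ rationalFunctions M q →
      C f ∈ liftsRing (rationalFunctions M q).subtype := fun {f} hf =>
    ⟨C ⟨f, hf⟩, by simp⟩
  have hX : (X : (Param M → ℂ)[X]) ∈ liftsRing (rationalFunctions M q).subtype := ⟨X, by simp⟩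
  have ha := fst_mem_rationalFunctions (M := M) (q := q)
  have hb := snd_mem_rationalFunctions (M := M) (q := q)
  have hc := const_mem_rationalFunctions (M := M) (q := q)
  have hP : ∀ n, polyP M q n ∈ liftsRing (rationalFunctions M q).subtype := fun n =>
    Subring.prod_mem _ fun i _ => Subring.sub_mem _ (Subring.one_mem _) (Subring.mul_mem _
      (hC (mul_mem (mul_mem (ha 0) (hc (q ^ i))) inv_snd_mem_rationalFunctions)) hX)
  have hQ : ∀ n, polyQ M q n ∈ liftsRing (rationalFunctions M q).subtype := fun n =>
    Subring.prod_mem _ fun i _ => Subring.sub_mem _ (Subring.one_mem _) (Subring.mul_mem _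
      (hC (hc _)) hX)
  have hea : ∀ k, (fun x : Param M => eHat k x.1) ∈ rationalFunctions M q := fun k => by
    have := sum_mem (t := (univ.erase (0 : Fin (M + 3))).powersetCard k) fun s (_ : s ∈ _) =>
      prod_mem (S := rationalFunctions M q) (t := s) fun i _ => ha i
    convert this using 1
    ext x
    simp [eHat]
  have heb : ∀ k, (fun x : Param M => eHat k x.2) ∈ rationalFunctions M q := fun k => by
    have := sum_mem (t := (univ.erase (0 : Fin (M + 3))).powersetCard k) fun s (_ : s ∈ _) =>
      prod_mem (S := rationalFunctions M q) (t := s) fun i _ => hb i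
    convert this using 1
    ext x
    simp [eHat]
  have hpa : (fun x : Param M => ∏ i ∈ univ.erase 0, x.1 i) ∈ rationalFunctions M q := by
    have := prod_mem (S := rationalFunctions M q) (t := univ.erase 0) fun i _ => ha i
    convert this using 1
    ext x
    simp
  have h : polyE M q ∈ liftsRing (rationalFunctions M q).subtype := by
    refine Subring.add_mem _ (Subring.add_mem _ ?_ ?_) ?_
    · exact Subring.mul_mem _ (hC (pow_mem (hb 0) _)) (hP _)
    · refine Subring.sum_mem _ fun k _ => Subring.mul_mem _ (Subring.mul_mem _ (Subring.mul_mem _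
        (hC (mul_mem (hc _) (pow_mem (hb 0) _))) (Subring.sub_mem _ (hC (hea k))
        (Subring.mul_mem _ (hC (mul_mem (hc q) (heb k))) hX))) (hP _)) (hQ _)
    · exact Subring.mul_mem _ (hC (mul_mem (hc _) hpa)) (hQ _)
  obtain ⟨p, hp⟩ := h
  rw [← hp]
  simp only [coe_mapRingHom, coeff_map]
  exact (p.coeff j).2

variable {Sol : Set (Param M → ℂ)}
  {W : Submodule (RatFun M) ((Shift M →₀ RatFun M) ⧸ vanishing q (domain q Set.univ) Sol)}

theorem zsmul_tau_admissible {r : Shift M} (hr : r ∈ admissible M) (n : ℤ) :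
    r + n • (sA 0 + sB 0) ∈ admissible M :=
  admissible_add hr (admissible_zsmul n (sA_add_sB_admissible 0 0))

theorem hatE_relation (hq : q ≠ 0) {y : Param M → ℂ}
    (hy : SatisfiesRP q (domain q Set.univ) y) {r : Shift M} (hr : r ∈ admissible M) (n : ℤ)
    {x : Param M} (hx : x ∈ domain q Set.univ) :
    ∑ j ∈ range (M + 2), (polyE M q).coeff j (shiftPoint q (r + (n + 1) • (sA 0 + sB 0)) x) *
      y (shiftPoint q (r + (n + j) • (sA 0 + sB 0)) x) = 0 := by
  -- The exponent $n+1$ compensates the factor $T^{-1}$ in `hatE_eq`, so that the terms run from $n$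
  -- to $n+M+1$.
  have h := hy.ordinary _ (shiftPoint_mem_domain hq (zsmul_tau_admissible hr (n + 1)) hx)
  rw [hatE_eq hq, Module.End.mul_apply, opOf_apply (Nat.lt_succ_of_le natDegree_polyE_le)] at h
  rw [← h]
  refine sum_congr rfl fun j _ => ?_
  congr 1
  simp only [T, LinearMap.coe_mk, AddHom.coe_mk, shiftPoint_shiftPoint hq]
  congr 2
  rw [add_smul, add_smul, one_smul]
  abel

theorem shiftClass_mem_of_relation_hatE (hq : q ≠ 0) (hD : (domain (M := M) q Set.univ).Nonempty)
    (hS : ∀ y ∈ Sol, SatisfiesRP q (domain q Set.univ) y) {r : Shift M}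
    (hr : r ∈ admissible M) (n : ℤ) {i : ℕ} (hi : i ∈ range (M + 2))
    (h0 : ∀ x ∈ domain q Set.univ, (polyE M q).coeff i x ≠ 0)
    (hW : ∀ j ∈ range (M + 2), j ≠ i →
      shiftClass q Sol (r + (n + j) • (sA 0 + sB 0)) ∈ W) :
    shiftClass q Sol (r + (n + i) • (sA 0 + sB 0)) ∈ W :=
  shiftClass_mem_of_relation hD (range (M + 2))
    (fun j x => (polyE M q).coeff j (shiftPoint q (r + (n + 1) • (sA 0 + sB 0)) x))
    (fun j _ => rationalFunctions_shift hq (zsmul_tau_admissible hr _) (coeff_polyE_mem j))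
    (fun j => r + (n + j) • (sA 0 + sB 0))
    (fun y hy _ hx => hatE_relation hq (hS y hy) hr n hx) hi
    (fun _ hx => h0 _ (shiftPoint_mem_domain hq (zsmul_tau_admissible hr _) hx)) hW

variable (q Sol) in
/-- The span of the classes of `T^(s + n τ) y`, `0 ≤ n ≤ M`, where `T^τ = T_{a₁} T_{b₁}`. -/
noncomputable def windowSpan (r : Shift M) :
    Submodule (RatFun M) ((Shift M →₀ RatFun M) ⧸ vanishing q (domain q Set.univ) Sol) :=
  Submodule.span _ (Set.range fun n : Fin (M + 1) =>
    shiftClass q Sol (r + (n : ℤ) • (sA 0 + sB 0)))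

theorem shiftClass_mem_windowSpan (hq : q ≠ 0) (hD : (domain (M := M) q Set.univ).Nonempty)
    (hS : ∀ y ∈ Sol, SatisfiesRP q (domain q Set.univ) y) {r : Shift M}
    (hr : r ∈ admissible M) (n : ℤ) :
    shiftClass q Sol (r + n • (sA 0 + sB 0)) ∈ windowSpan q Sol r := by
  -- The induction carries a whole window of $M+1$ consecutive classes, which one relation slides by
  -- one step in either direction because both extreme coefficients are invertible.
  suffices ∀ n : ℤ, ∀ j ∈ range (M + 1),
      shiftClass q Sol (r + (n + (j : ℕ)) • (sA 0 + sB 0)) ∈ windowSpan q Sol r by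
    simpa using this n 0 (by simp)
  intro n
  induction n using Int.induction_on with
  | zero =>
    intro j hj
    rw [zero_add]
    exact Submodule.subset_span ⟨⟨j, mem_range.1 hj⟩, rfl⟩
  | succ n ih =>
    intro j hj
    have h := shiftClass_mem_of_relation_hatE hq hD hS hr n (i := M + 1) (by simp)
      (fun _ hx => coeff_polyE_last_ne_zero hq hx) (fun j hj hne => ih j (by
        rw [mem_range] at *; omega))
    rcases (Nat.lt_succ_iff.1 (mem_range.1 hj)).lt_or_eq with hlt | rfl
    · have := ih (j + 1) (by simpa using hlt)
      rwa [show (n : ℤ) + 1 + j = n + (j + 1 : ℕ) by push_cast; ring]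
    · rwa [show (n : ℤ) + 1 + j = n + (j + 1 : ℕ) by push_cast; ring]
  | pred n ih =>
    intro j hj
    have h := shiftClass_mem_of_relation_hatE hq hD hS hr (-n - 1) (i := 0) (by simp)
      (fun _ hx => coeff_polyE_zero_ne_zero hx) (fun j hj hne => by
        obtain ⟨k, rfl⟩ := Nat.exists_eq_succ_of_ne_zero hne
        have := ih k (by rw [mem_range] at *; omega)
        rwa [show -(n : ℤ) - 1 + (k.succ : ℕ) = -n + k by push_cast; ring])
    rcases j with _ | j
    · exact h
    · have := ih j (by rw [mem_range] at *; omega)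
      rwa [show -(n : ℤ) - 1 + (j + 1 : ℕ) = -n + j by push_cast; ring]

theorem shiftClass_mem_of_three_term (hq : q ≠ 0) (hD : (domain (M := M) q Set.univ).Nonempty)
    {s₀ s₁ s₂ r : Shift M} (hr : r ∈ admissible M) {f₀ f₁ f₂ : Param M → ℂ}
    (h₀ : f₀ ∈ rationalFunctions M q) (h₁ : f₁ ∈ rationalFunctions M q)
    (h₂ : f₂ ∈ rationalFunctions M q) (hf₀ : ∀ x ∈ domain q Set.univ, f₀ x ≠ 0)
    (h : ∀ y ∈ Sol, ∀ x ∈ domain q Set.univ,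
      f₀ x * T q s₀ y x - f₁ x * T q s₁ y x + f₂ x * T q s₂ y x = 0)
    (hW₁ : shiftClass q Sol (s₁ + r) ∈ W) (hW₂ : shiftClass q Sol (s₂ + r) ∈ W) :
    shiftClass q Sol (s₀ + r) ∈ W := by
  refine shiftClass_mem_of_relation hD (univ : Finset (Fin 3))
    ![fun x => f₀ (shiftPoint q r x), -fun x => f₁ (shiftPoint q r x),
      fun x => f₂ (shiftPoint q r x)] ?_ ![s₀ + r, s₁ + r, s₂ + r] ?_ (mem_univ 0) ?_ ?_
  · intro i _
    fin_cases i
    · exact rationalFunctions_shift hq hr h₀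
    · exact neg_mem (rationalFunctions_shift hq hr h₁)
    · exact rationalFunctions_shift hq hr h₂
  · intro y hy x hx
    have := h y hy _ (shiftPoint_mem_domain hq hr hx)
    simp only [T, LinearMap.coe_mk, AddHom.coe_mk, shiftPoint_shiftPoint hq] at this
    simp only [Fin.sum_univ_three, Matrix.cons_val_zero, Matrix.cons_val_one, Matrix.cons_val,
      Pi.neg_apply]
    linear_combination this
  · intro x hx
    exact hf₀ _ (shiftPoint_mem_domain hq hr hx)
  · intro j _ hj
    fin_cases j
    · exact absurd rfl hj
    · exact hW₁
    · exact hW₂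

theorem shiftClass_sA_mem_windowSpan (hq : q ≠ 0) (hD : (domain (M := M) q Set.univ).Nonempty)
    (hS : ∀ y ∈ Sol, SatisfiesRP q (domain q Set.univ) y) {r : Shift M}
    (hr : r ∈ admissible M) {k : Fin (M + 3)} (hk : k ≠ 0) (n : ℤ) :
    shiftClass q Sol (sA 0 - sA k + (r + n • (sA 0 + sB 0))) ∈ windowSpan q Sol r := by
  have ha := fst_mem_rationalFunctions (M := M) (q := q)
  have hb := snd_mem_rationalFunctions (M := M) (q := q)
  have hc := const_mem_rationalFunctions (M := M) (q := q)
  refine shiftClass_mem_of_three_term hq hD (s₁ := sA 0 + sB 0) (s₂ := 0)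
    (zsmul_tau_admissible hr n)
    (sub_mem (hb 0) (ha 0)) (sub_mem (mul_mem (hc q⁻¹) (ha k)) (ha 0))
    (sub_mem (mul_mem (hc q⁻¹) (ha k)) (hb 0)) ?_ ?_ ?_ ?_
  · intro x hx h
    apply (hx.2.2 0 trivial).2 0 0
    rw [zpow_zero, mul_one]
    exact sub_eq_zero.1 h
  · intro y hy x hx
    have := (hS y hy).three₂ x hx k hk
    rwa [T_zero]
  · rw [add_left_comm, add_comm (sA 0 + sB 0), ← add_one_zsmul]
    exact shiftClass_mem_windowSpan hq hD hS hr _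
  · rw [zero_add]
    exact shiftClass_mem_windowSpan hq hD hS hr _

theorem shiftClass_sB_mem_windowSpan (hq : q ≠ 0) (hD : (domain (M := M) q Set.univ).Nonempty)
    (hS : ∀ y ∈ Sol, SatisfiesRP q (domain q Set.univ) y) {r : Shift M}
    (hr : r ∈ admissible M) {k : Fin (M + 3)} (hk : k ≠ 0) (n : ℤ) :
    shiftClass q Sol (sB k - sB 0 + (r + n • (sA 0 + sB 0))) ∈ windowSpan q Sol r := by
  have ha := fst_mem_rationalFunctions (M := M) (q := q)
  have hb := snd_mem_rationalFunctions (M := M) (q := q)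
  have hc := const_mem_rationalFunctions (M := M) (q := q)
  refine shiftClass_mem_of_three_term hq hD (s₁ := -(sA 0 + sB 0)) (s₂ := 0)
    (zsmul_tau_admissible hr n)
    (sub_mem (ha 0) (hb 0)) (sub_mem (mul_mem (hb k) (hc q)) (hb 0))
    (sub_mem (mul_mem (hb k) (hc q)) (ha 0)) ?_ ?_ ?_ ?_
  · intro x hx h
    apply (hx.2.2 0 trivial).2 0 0
    rw [zpow_zero, mul_one]
    exact (sub_eq_zero.1 h).symm
  · intro y hy x hx
    have := (hS y hy).three₄ x hx k hk
    rwa [T_zero]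
  · rw [add_left_comm, neg_add_eq_sub, sub_eq_add_neg (n • _), ← sub_one_zsmul]
    exact shiftClass_mem_windowSpan hq hD hS hr _
  · rw [zero_add]
    exact shiftClass_mem_windowSpan hq hD hS hr _

/-- The three-term relations give only the inclusion of the shifted window; independence makes both
spans of dimension $M+1$, so no inverse relation is needed. -/
theorem windowSpan_eq_of_le
    (hLI : ∀ r ∈ admissible M, LinearIndependent (RatFun M) fun n : Fin (M + 1) =>
      shiftClass q Sol (r + (n : ℤ) • (sA 0 + sB 0)))
    {r s : Shift M} (hr : r ∈ admissible M) (hs : s ∈ admissible M)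
    (h : ∀ n : ℤ, shiftClass q Sol (s + (r + n • (sA 0 + sB 0))) ∈ windowSpan q Sol r) :
    windowSpan q Sol (r + s) = windowSpan q Sol r := by
  have hfin : ∀ r : Shift M, FiniteDimensional (RatFun M) (windowSpan q Sol r) := fun r =>
    FiniteDimensional.span_of_finite _ (Set.finite_range _)
  refine Submodule.eq_of_le_of_finrank_eq ?_ ?_
  · rw [windowSpan, Submodule.span_le]
    rintro _ ⟨n, rfl⟩
    have := h n
    rwa [add_left_comm, ← add_assoc] at this
  · rw [windowSpan, windowSpan, finrank_span_eq_card (hLI _ (admissible_add hr hs)),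
      finrank_span_eq_card (hLI _ hr)]

theorem windowSpan_eq (hq : q ≠ 0) (hD : (domain (M := M) q Set.univ).Nonempty)
    (hS : ∀ y ∈ Sol, SatisfiesRP q (domain q Set.univ) y)
    (hLI : ∀ r ∈ admissible M, LinearIndependent (RatFun M) fun n : Fin (M + 1) =>
      shiftClass q Sol (r + (n : ℤ) • (sA 0 + sB 0)))
    {s : Shift M} (hs : s ∈ admissible M) : windowSpan q Sol s = windowSpan q Sol 0 := by
  -- The shifts that preserve every window span; quantifying over all base points `r` makes them a
  -- group.
  let H : AddSubgroup (Shift M) :=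
    { carrier := {u | u ∈ admissible M ∧ ∀ r ∈ admissible M,
        windowSpan q Sol (r + u) = windowSpan q Sol r}
      zero_mem' := ⟨by simp [admissible], fun r _ => by rw [add_zero]⟩
      add_mem' := fun {u v} hu hv => ⟨admissible_add hu.1 hv.1, fun r hr => by
        rw [← add_assoc, hv.2 _ (admissible_add hr hu.1), hu.2 r hr]⟩
      neg_mem' := fun {u} hu => by
        have hn : -u ∈ admissible M := by simpa using admissible_zsmul (-1) hu.1
        exact ⟨hn, fun r hr => by rw [← hu.2 _ (admissible_add hr hn), neg_add_cancel_right]⟩ }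
  have hA : ∀ k, sA 0 - sA k ∈ H := fun k => by
    by_cases hk : k = 0
    · rw [hk, sub_self]; exact H.zero_mem
    · exact ⟨sA_sub_sA_admissible 0 k, fun r hr => windowSpan_eq_of_le hLI hr
        (sA_sub_sA_admissible 0 k) (shiftClass_sA_mem_windowSpan hq hD hS hr hk)⟩
  have hB : ∀ k, sB k - sB 0 ∈ H := fun k => by
    by_cases hk : k = 0
    · rw [hk, sub_self]; exact H.zero_mem
    · exact ⟨sB_sub_sB_admissible k 0, fun r hr => windowSpan_eq_of_le hLI hr
        (sB_sub_sB_admissible k 0) (shiftClass_sB_mem_windowSpan hq hD hS hr hk)⟩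
  have hT : sA 0 + sB 0 ∈ H := ⟨sA_add_sB_admissible 0 0, fun r hr =>
    windowSpan_eq_of_le hLI hr (sA_add_sB_admissible 0 0) fun n => by
      rw [add_left_comm, add_comm (sA 0 + sB 0), ← add_one_zsmul]
      exact shiftClass_mem_windowSpan hq hD hS hr _⟩
  -- The $b_1$-exponent comes out right because admissibility equates the two exponent sums.
  have e : s = -∑ k, s.1 k • (sA 0 - sA k) + ∑ k, s.2 k • (sB k - sB 0) +
      (∑ k, s.1 k) • (sA 0 + sB 0) := by
    have h1 : ∑ i, s.1 i = ∑ i, s.2 i := hs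
    ext i
    · simp [sA, sB, Prod.fst_sum, Finset.sum_apply, mul_sub, sum_sub_distrib, Pi.single_apply,
        ← sum_mul]
    · simp [sA, sB, Prod.snd_sum, Finset.sum_apply, mul_sub, sum_sub_distrib, Pi.single_apply,
        ← sum_mul, h1]
  have hH : s ∈ H := by
    rw [e]
    exact H.add_mem (H.add_mem (H.neg_mem (H.sum_mem fun k _ => H.zsmul_mem (hA k) _))
      (H.sum_mem fun k _ => H.zsmul_mem (hB k) _)) (H.zsmul_mem hT _)
  simpa using hH.2 0 (by simp [admissible])

theorem hasRank_of_linearIndependent (hq : q ≠ 0) (hD : (domain (M := M) q Set.univ).Nonempty)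
    (hS : ∀ y ∈ Sol, SatisfiesRP q (domain q Set.univ) y)
    (hLI : ∀ r ∈ admissible M, LinearIndependent (RatFun M) fun n : Fin (M + 1) =>
      shiftClass q Sol (r + (n : ℤ) • (sA 0 + sB 0)))
    {S : Set (Shift M)} (hSa : S ⊆ admissible M) (hSt : sA 0 + sB 0 ∈ S) :
    HasRank q (domain q Set.univ) Sol S (M + 1) := by
  have h0 : (0 : Shift M) ∈ admissible M := by simp [admissible]
  have h : (powerSpan S).map (vanishing q (domain q Set.univ) Sol).mkQ = windowSpan q Sol 0 := by
    rw [powerSpan, Submodule.map_span]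
    apply le_antisymm
    · rw [Submodule.span_le]
      rintro _ ⟨_, ⟨s, hs, i, rfl⟩, rfl⟩
      have hi : i • s ∈ admissible M := admissible_zsmul i (hSa hs)
      rw [SetLike.mem_coe, ← windowSpan_eq hq hD hS hLI hi]
      have := shiftClass_mem_windowSpan hq hD hS hi 0
      rwa [zero_smul, add_zero] at this
    · rw [windowSpan, Submodule.span_le]
      rintro _ ⟨n, rfl⟩
      exact Submodule.subset_span ⟨_, ⟨_, hSt, n, rfl⟩, by simp [shiftClass]⟩
  rw [HasRank, h, windowSpan, rank_span (hLI 0 h0), Cardinal.mk_range_eq _ (hLI 0 h0).injective]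
  simp

end Window

end QRP

namespace QRP

open Filter Topology

/-! ### Continuity of Jackson sums and zero sets -/

section Analysis

variable {M : ℕ} {q : ℂ}

/-- Dominated convergence: near $t=0$ the integrand is bounded by $2$ uniformly in nearby
parameters, which controls the tail; each of the finitely many other terms is dominated by its norm
at `x₀` plus $1$. -/
theorem tendsto_tsum_jacksonTerm (hq1 : ‖q‖ < 1) {X : Type*} [TopologicalSpace X] {x₀ : X}
    {g : X → Param M} {τ : X → ℂ} (hg : ContinuousAt g x₀) (hτ : ContinuousAt τ x₀)
    (h : ∀ (n : ℕ) k, qPoch q ((g x₀).2 k * (τ x₀ * q ^ n)) ≠ 0) :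
    ContinuousAt (fun x => ∑' n, jacksonTerm q (τ x) (integrand q (g x)) n) x₀ := by
  have hterm : ∀ n, ContinuousAt (fun x => jacksonTerm q (τ x) (integrand q (g x)) n) x₀ := by
    intro n
    have h1 : ContinuousAt (fun x => integrand q (g x) (τ x * q ^ n)) x₀ :=
      (continuousAt_integrand hq1 (h n)).comp (f := fun x => (g x, τ x * q ^ n))
        (hg.prodMk (hτ.mul continuousAt_const))
    exact h1.mul (hτ.mul continuousAt_const)
  have h0 := continuousAt_integrand hq1 (x := g x₀) (t := 0) (by simp [qPoch_zero])
  have h2 : ∀ᶠ p in 𝓝 (g x₀, (0 : ℂ)), ‖integrand q p.1 p.2‖ < 2 := by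
    refine h0.norm.eventually_lt continuousAt_const ?_
    simp [integrand_zero]
  rw [nhds_prod_eq, eventually_prod_iff] at h2
  obtain ⟨pa, hpa, pb, hpb, hab⟩ := h2
  obtain ⟨δ, hδ, hball⟩ := Metric.eventually_nhds_iff.1 hpb
  have hlim : Tendsto (fun n : ℕ => (‖τ x₀‖ + 1) * ‖q‖ ^ n) atTop (𝓝 0) := by
    simpa using (tendsto_pow_atTop_nhds_zero_of_lt_one (norm_nonneg q) hq1).const_mul (‖τ x₀‖ + 1)
  obtain ⟨N, hN⟩ := eventually_atTop.1 (hlim.eventually (eventually_lt_nhds hδ))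
  let b : ℕ → ℝ := fun n =>
    (if n ∈ range N then ‖jacksonTerm q (τ x₀) (integrand q (g x₀)) n‖ + 1 else 0) +
      2 * (‖τ x₀‖ + 1) * ‖q‖ ^ n
  have hb : Summable b := by
    refine Summable.add (summable_of_ne_finset_zero (s := range N) fun n hn => if_neg hn) ?_
    exact (summable_geometric_of_lt_one (norm_nonneg q) hq1).mul_left _
  refine tendsto_tsum_of_dominated_convergence hb hterm ?_
  have hhead : ∀ᶠ x in 𝓝 x₀, ∀ n ∈ range N, ‖jacksonTerm q (τ x) (integrand q (g x)) n‖ <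
      ‖jacksonTerm q (τ x₀) (integrand q (g x₀)) n‖ + 1 := by
    rw [eventually_all_finset]
    exact fun n _ => (hterm n).norm.eventually_lt continuousAt_const (by simp)
  have hτ' : ∀ᶠ x in 𝓝 x₀, ‖τ x‖ < ‖τ x₀‖ + 1 :=
    hτ.norm.eventually_lt continuousAt_const (by simp)
  filter_upwards [hhead, hτ', hg.eventually hpa] with x h1 h2 h3 n
  by_cases hn : n ∈ range N
  · simp only [b, if_pos hn]
    have := h1 n hn
    have : 0 ≤ 2 * (‖τ x₀‖ + 1) * ‖q‖ ^ n := by positivity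
    linarith
  · simp only [b, if_neg hn, zero_add]
    have h4 : ‖τ x * q ^ n‖ ≤ (‖τ x₀‖ + 1) * ‖q‖ ^ n := by
      rw [norm_mul, norm_pow]
      gcongr
    have h5 : pb (τ x * q ^ n) := hball (by
      rw [dist_zero_right]
      exact h4.trans_lt (hN n (by simpa using hn)))
    rw [jacksonTerm, norm_mul, mul_assoc]
    exact mul_le_mul (hab h3 h5).le h4 (norm_nonneg _) (by norm_num)

theorem continuous_shiftPoint (s : Shift M) : Continuous (shiftPoint (M := M) q s) := by
  unfold shiftPoint
  fun_prop

theorem eq_zero_of_eventually_eval_eq_zero {σ : Type*} [Fintype σ] {p : MvPolynomial σ ℂ}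
    {c : σ → ℂ} (h : ∀ᶠ z in 𝓝 c, MvPolynomial.eval z p = 0) : p = 0 := by
  obtain ⟨ε, hε, hb⟩ := Metric.eventually_nhds_iff.1 h
  refine MvPolynomial.funext_set (fun i => Metric.ball (c i) ε)
    (fun i => infinite_of_mem_nhds (c i) (Metric.ball_mem_nhds _ hε)) fun z hz => ?_
  rw [map_zero]
  exact hb ((dist_pi_lt_iff hε).2 fun i => hz i trivial)

/-- The theta product $(z)_\infty(q/z)_\infty$ vanishes on $q^{\mathbb Z}$. This reduces infinitely
many inequalities to two open conditions, as needed to show that points near a polar point lie in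
$D$. -/
theorem mul_zpow_ne_one_of_qPoch_ne_zero (hq : q ≠ 0) (hq1 : ‖q‖ < 1) {z : ℂ}
    (h1 : qPoch q z ≠ 0) (h2 : qPoch q (q / z) ≠ 0) (n : ℤ) : z * q ^ n ≠ 1 := by
  intro h
  rcases le_or_gt 0 n with hn | hn
  · refine h1 (qPoch_eq_zero hq1 n.toNat ?_)
    rwa [← zpow_natCast, Int.toNat_of_nonneg hn]
  · refine h2 (qPoch_eq_zero hq1 (-(n + 1)).toNat ?_)
    have hz : z ≠ 0 := by rintro rfl; simp at h
    rw [← zpow_natCast, Int.toNat_of_nonneg (by omega), zpow_neg, zpow_add₀ hq, zpow_one]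
    have := zpow_ne_zero n hq
    field_simp
    rw [h]

theorem qPoch_ne_zero_of_forall_zpow (hq1 : ‖q‖ < 1) {z : ℂ} (h : ∀ n : ℤ, z * q ^ n ≠ 1) :
    qPoch q z ≠ 0 := qPoch_ne_zero hq1 fun n => by simpa using h n

theorem qPoch_pow_succ_ne_zero (hq1 : ‖q‖ < 1) (m : ℕ) : qPoch q (q ^ (m + 1)) ≠ 0 := by
  induction m with
  | zero => simpa using qPoch_q_ne_zero hq1
  | succ m ih =>
    rw [qPoch_eq_mul hq1, ← pow_succ'] at ih
    exact right_ne_zero_of_mul ih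

end Analysis

/-! ### The Casoratian at a polar point -/

section Casoratian

variable {M : ℕ} {q : ℂ}

/-- The indices different from the first and the last one. -/
def innerIndex (j : Fin (M + 1)) : Fin (M + 3) := j.succ.castSucc

theorem inner_ne_zero (j : Fin (M + 1)) : innerIndex j ≠ 0 := by
  rw [innerIndex, Ne, Fin.ext_iff]
  simp

theorem inner_injective : Function.Injective (innerIndex (M := M)) := fun i j h => by
  simpa [innerIndex] using h

/-- A parameter on the poles `a_i = q b_i` for all `i` but the first and the last one, and
otherwise generic. -/
structure IsPolar (q : ℂ) (x : Param M) : Prop where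
  rel : ∏ i, x.1 i = q ^ 2 * ∏ i, x.2 i
  fst_ne_zero : ∀ i, x.1 i ≠ 0
  snd_ne_zero : ∀ i, x.2 i ≠ 0
  inner_eq : ∀ j, x.1 (innerIndex j) = q * x.2 (innerIndex j)
  generic : ∀ i k, (∀ j, innerIndex j = i → i ≠ k) → ∀ n : ℤ, x.2 k * q ^ n ≠ x.1 i

theorem IsPolar.eventually_mem_domain (hq : q ≠ 0) (hq1 : ‖q‖ < 1) {x₀ : Param M}
    (h : IsPolar q x₀) : ∀ᶠ x in 𝓝 x₀, (∏ i, x.1 i = q ^ 2 * ∏ i, x.2 i) →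
      (∀ j, x.1 (innerIndex j) ≠ q * x.2 (innerIndex j)) → x ∈ domain q Set.univ := by
  have hc := continuous_qPoch hq1
  have ha : ∀ i, ∀ᶠ x in 𝓝 x₀, x.1 i ≠ 0 := fun i =>
    ContinuousAt.eventually_ne (g := fun x : Param M => x.1 i) (by fun_prop) (h.fst_ne_zero i)
  have hb : ∀ i, ∀ᶠ x in 𝓝 x₀, x.2 i ≠ 0 := fun i =>
    ContinuousAt.eventually_ne (g := fun x : Param M => x.2 i) (by fun_prop) (h.snd_ne_zero i)
  have hr : ∀ i k, ContinuousAt (fun x : Param M => x.2 k / x.1 i) x₀ := fun i k =>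
    ContinuousAt.div (by fun_prop) (by fun_prop) (h.fst_ne_zero i)
  have hr' : ∀ i k, ContinuousAt (fun x : Param M => q / (x.2 k / x.1 i)) x₀ := fun i k =>
    ContinuousAt.div (by fun_prop) (hr i k)
      (div_ne_zero (h.snd_ne_zero k) (h.fst_ne_zero i))
  have key : ∀ i k, ∀ᶠ x in 𝓝 x₀, (∀ j, x.1 (innerIndex j) ≠ q * x.2 (innerIndex j)) →
      qPoch q (x.2 k / x.1 i) ≠ 0 ∧ qPoch q (q / (x.2 k / x.1 i)) ≠ 0 := by
    intro i k
    by_cases hik : ∀ j, innerIndex j = i → i ≠ k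
    · have h1 : ∀ n : ℤ, x₀.2 k / x₀.1 i * q ^ n ≠ 1 := fun n hn => by
        have := h.fst_ne_zero i
        field_simp at hn
        exact h.generic i k hik n hn
      have h2 : ∀ n : ℤ, q / (x₀.2 k / x₀.1 i) * q ^ n ≠ 1 := fun n hn => by
        apply h1 (-(n + 1))
        have h3 := h.fst_ne_zero i
        have h4 := h.snd_ne_zero k
        have h5 := zpow_ne_zero n hq
        rw [zpow_neg, zpow_add₀ hq, zpow_one]
        field_simp at hn ⊢
        rw [← hn]
      filter_upwards [(hc.continuousAt.comp (hr i k)).eventually_ne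
        (qPoch_ne_zero_of_forall_zpow hq1 h1), (hc.continuousAt.comp (hr' i k)).eventually_ne
        (qPoch_ne_zero_of_forall_zpow hq1 h2)] with x h1 h2 _
      exact ⟨h1, h2⟩
    · push Not at hik
      obtain ⟨j, rfl, rfl⟩ := hik
      have e : x₀.2 (innerIndex j) / x₀.1 (innerIndex j) = q⁻¹ := by
        rw [h.inner_eq]
        have := h.snd_ne_zero (innerIndex j)
        field_simp
      have hq2 : q ≠ 1 := by rintro rfl; simp at hq1
      have h1 : ContinuousAt (fun x : Param M => 1 - x.2 (innerIndex j) / x.1 (innerIndex j)) x₀ :=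
        continuousAt_const.sub (hr _ _)
      have h2 : ContinuousAt (fun x : Param M =>
          qPoch q (q * (q * (x.2 (innerIndex j) / x.1 (innerIndex j))))) x₀ :=
        hc.continuousAt.comp (continuousAt_const.mul (continuousAt_const.mul (hr _ _)))
      filter_upwards [h1.eventually_ne (by
          rw [e, sub_ne_zero]
          intro h3
          exact hq2 (inv_eq_one.1 h3.symm)), h2.eventually_ne (by
          rw [e, mul_inv_cancel₀ hq, mul_one]
          exact qPoch_q_ne_zero hq1), (hc.continuousAt.comp (hr' (innerIndex j) (innerIndex j))).eventually_ne (by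
          simp only [Function.comp_apply, e, div_inv_eq_mul]
          simpa [pow_two] using qPoch_pow_succ_ne_zero hq1 1), ha (innerIndex j)] with x h3 h4 h5 h6 hx
      refine ⟨?_, h5⟩
      -- With $z=b_i/a_i$ near $q^{-1}$, the only factor of $(z)_\infty$ that can vanish is $1-qz$,
      -- which is the equation of the polar hyperplane.
      rw [qPoch_eq_mul hq1, qPoch_eq_mul hq1]
      refine mul_ne_zero h3 (mul_ne_zero (fun h7 => hx j ?_) h4)
      field_simp at h7
      linear_combination h7
  have hall := eventually_all.2 fun i => eventually_all.2 (key i)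
  filter_upwards [eventually_all.2 ha, hb 0, hall] with x h1 h2 h3 h4 h5
  refine ⟨h4, h2, fun i _ => ⟨h1 i, fun k n hn => ?_⟩⟩
  obtain ⟨h6, h7⟩ := h3 i k h5
  apply mul_zpow_ne_one_of_qPoch_ne_zero hq hq1 h6 h7 n
  have := h1 i
  field_simp
  exact hn

/-- The product of `1 - q b_i / a_i`, `i = innerIndex j`, with the value of `φ_{1,i}` at the `n`-th
shift, in a form which is continuous at the pole `a_i = q b_i`. -/
noncomputable def casoratian (q : ℂ) (x : Param M) :
    Matrix (Fin (M + 1)) (Fin (M + 1)) ℂ := fun j n =>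
  (1 - q) * (integrand q (shiftPoint q (sB (innerIndex j))
      (shiftPoint q ((n : ℤ) • (sA 0 + sB 0)) x)) (q / x.1 (innerIndex j)) * (q / x.1 (innerIndex j)) +
    (1 - x.2 (innerIndex j) * (q / x.1 (innerIndex j))) *
      (∑' m, jacksonTerm q (q / x.1 (innerIndex j) * q)
          (integrand q (shiftPoint q ((n : ℤ) • (sA 0 + sB 0)) x)) m -
        jacksonSum q 0 (shiftPoint q ((n : ℤ) • (sA 0 + sB 0)) x)))

theorem shift_zsmul_fst {i : Fin (M + 3)} (hi : i ≠ 0) (n : ℤ) (x : Param M) :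
    (shiftPoint q (n • (sA 0 + sB 0)) x).1 i = x.1 i := by
  simp [shiftPoint, sA, sB, hi]

theorem shift_zsmul_snd {i : Fin (M + 3)} (hi : i ≠ 0) (n : ℤ) (x : Param M) :
    (shiftPoint q (n • (sA 0 + sB 0)) x).2 i = x.2 i := by
  simp [shiftPoint, sA, sB, hi]

/-- At $a_i=qb_i$ the node $t=q^{m+1}/a_i$ has $b_it=q^m$, so only $m=0$ is a pole. That term is
split off, and its factor $1-b_it$ is absorbed by shifting $b_i$. -/
theorem casoratian_eq (hq1 : ‖q‖ < 1) {x : Param M}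
    (hx : x ∈ domain q Set.univ) (j n : Fin (M + 1)) :
    casoratian q x j n = (1 - x.2 (innerIndex j) * (q / x.1 (innerIndex j))) *
      phi q 0 (innerIndex j) (shiftPoint q ((n : ℤ) • (sA 0 + sB 0)) x) := by
  have hx' := domain_anti (Set.subset_univ {innerIndex j}) hx
  have h1 : (shiftPoint q ((n : ℤ) • (sA 0 + sB 0)) x).2 (innerIndex j) * (q / x.1 (innerIndex j)) ≠ 1 := by
    rw [shift_zsmul_snd (inner_ne_zero j)]
    simpa using mul_zpow_ne_one hx' (innerIndex j) 1
  have h2 : jacksonSum q (innerIndex j) (shiftPoint q ((n : ℤ) • (sA 0 + sB 0)) x) =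
      integrand q (shiftPoint q ((n : ℤ) • (sA 0 + sB 0)) x) (q / x.1 (innerIndex j)) *
        (q / x.1 (innerIndex j)) + ∑' m, jacksonTerm q (q / x.1 (innerIndex j) * q)
          (integrand q (shiftPoint q ((n : ℤ) • (sA 0 + sB 0)) x)) m := by
    rw [jacksonSum, shift_zsmul_fst (inner_ne_zero j),
      (summable_jacksonTerm hq1 _ _).tsum_eq_zero_add]
    congr 1
    · simp [jacksonTerm]
    · refine tsum_congr fun m => ?_
      rw [jacksonTerm, jacksonTerm, pow_succ', mul_assoc (q / _) q]
  rw [phi_eq, Pi.smul_apply, Pi.sub_apply, smul_eq_mul, h2, casoratian,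
    integrand_shift_sB hq1 _ _ _ h1, shift_zsmul_snd (inner_ne_zero j)]
  ring

theorem IsPolar.qPoch_ne_zero (hq : q ≠ 0) (hq1 : ‖q‖ < 1) {x : Param M} (h : IsPolar q x)
    (s : Shift M) (m : ℤ) {i k : Fin (M + 3)} (hik : ∀ j, innerIndex j = i → i ≠ k) :
    qPoch q ((shiftPoint q s x).2 k * (q ^ m / x.1 i)) ≠ 0 := by
  refine qPoch_ne_zero_of_forall_zpow hq1 fun n hn => h.generic i k hik (s.2 k + m + n) ?_
  have h0 := h.fst_ne_zero i
  rw [zpow_add₀ hq, zpow_add₀ hq]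
  simp only [shiftPoint] at hn
  field_simp at hn
  linear_combination hn

theorem IsPolar.qPoch_fst_ne_zero (hq : q ≠ 0) (hq1 : ‖q‖ < 1) {x : Param M} (h : IsPolar q x)
    (k : Fin (M + 3)) (j : Fin (M + 1)) : qPoch q (x.1 k * (q / x.1 (innerIndex j))) ≠ 0 := by
  by_cases hk : k = innerIndex j
  · rw [hk, mul_div_cancel₀ _ (h.fst_ne_zero _)]
    exact qPoch_q_ne_zero hq1
  · refine qPoch_ne_zero_of_forall_zpow hq1 fun n hn =>
      h.generic k (innerIndex j) (fun _ _ => hk) (-n) ?_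
    have h0 := h.snd_ne_zero (innerIndex j)
    have h1 := zpow_ne_zero n hq
    rw [h.inner_eq] at hn
    rw [zpow_neg]
    field_simp at hn ⊢
    exact hn.symm

theorem IsPolar.continuousAt_casoratian (hq : q ≠ 0) (hq1 : ‖q‖ < 1) {x : Param M}
    (h : IsPolar q x) : ContinuousAt (casoratian (M := M) q) x := by
  refine continuousAt_pi.2 fun j => continuousAt_pi.2 fun n => ?_
  have hτ : ContinuousAt (fun x : Param M => q / x.1 (innerIndex j)) x :=
    ContinuousAt.div (by fun_prop) (by fun_prop) (h.fst_ne_zero _)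
  have hs := fun s : Shift M => (continuous_shiftPoint (q := q) s).continuousAt (x := x)
  have hne : ∀ {k}, k ≠ innerIndex j → ∀ i, innerIndex i = innerIndex j → innerIndex j ≠ k := fun hk i _ => hk.symm
  have h1 : ContinuousAt (fun x : Param M => integrand q (shiftPoint q (sB (innerIndex j))
      (shiftPoint q ((n : ℤ) • (sA 0 + sB 0)) x)) (q / x.1 (innerIndex j))) x := by
    simp only [shiftPoint_shiftPoint hq]
    refine (continuousAt_integrand (t := q / x.1 (innerIndex j)) (x := shiftPoint q
      (sB (innerIndex j) + (n : ℤ) • (sA 0 + sB 0)) x) hq1 fun k => ?_).comp (f := fun x : Param M =>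
      (shiftPoint q (sB (innerIndex j) + (n : ℤ) • (sA 0 + sB 0)) x, q / x.1 (innerIndex j)))
      ((hs _).prodMk hτ)
    by_cases hk : k = innerIndex j
    · subst hk
      have : (shiftPoint q (sB (innerIndex j) + (n : ℤ) • (sA 0 + sB 0)) x).2 (innerIndex j) *
          (q / x.1 (innerIndex j)) = q ^ (0 + 1) := by
        rw [h.inner_eq]
        have := h.snd_ne_zero (innerIndex j)
        simp [shiftPoint, sA, sB, inner_ne_zero]
        field_simp
      rw [this]
      exact qPoch_pow_succ_ne_zero hq1 0
    · have := h.qPoch_ne_zero hq hq1 (sB (innerIndex j) + (n : ℤ) • (sA 0 + sB 0)) 1 (hne hk)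
      rwa [zpow_one] at this
  have h2 : ContinuousAt (fun x : Param M => ∑' m, jacksonTerm q (q / x.1 (innerIndex j) * q)
      (integrand q (shiftPoint q ((n : ℤ) • (sA 0 + sB 0)) x)) m) x := by
    refine tendsto_tsum_jacksonTerm hq1 (hs _) (hτ.mul continuousAt_const) fun m k => ?_
    by_cases hk : k = innerIndex j
    · subst hk
      rw [shift_zsmul_snd (inner_ne_zero j)]
      have : x.2 (innerIndex j) * (q / x.1 (innerIndex j) * q * q ^ m) = q ^ (m + 1) := by
        rw [h.inner_eq]
        have := h.snd_ne_zero (innerIndex j)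
        field_simp
        ring
      rw [this]
      exact qPoch_pow_succ_ne_zero hq1 m
    · have := h.qPoch_ne_zero hq hq1 ((n : ℤ) • (sA 0 + sB 0)) (m + 2) (hne hk)
      rw [zpow_add₀ hq] at this
      convert this using 3
      rw [zpow_natCast]
      norm_cast
      ring
  have h3 : ContinuousAt (fun x : Param M =>
      jacksonSum q 0 (shiftPoint q ((n : ℤ) • (sA 0 + sB 0)) x)) x := by
    unfold jacksonSum
    have h0 : (shiftPoint q ((n : ℤ) • (sA 0 + sB 0)) x).1 0 ≠ 0 :=
      mul_ne_zero (zpow_ne_zero _ hq) (h.fst_ne_zero 0)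
    refine tendsto_tsum_jacksonTerm hq1 (hs _) (ContinuousAt.div continuousAt_const
      (((continuous_apply 0).comp continuous_fst).continuousAt.comp (hs _)) h0) fun m k => ?_
    -- The shift turns $a_1$ into $q^na_1$, so the nodes are $q^{1+m-n}/a_1$.
    have := h.qPoch_ne_zero hq hq1 ((n : ℤ) • (sA 0 + sB 0)) (1 + m - n) (i := 0) (k := k)
      fun j hj => absurd hj (inner_ne_zero j)
    convert this using 3
    have h4 := zpow_ne_zero (n : ℤ) hq
    rw [zpow_sub₀ hq, zpow_add₀ hq, zpow_one, zpow_natCast q m]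
    simp [shiftPoint, sA, sB]
    field_simp
  unfold casoratian
  exact continuousAt_const.mul ((h1.mul hτ).add ((continuousAt_const.sub
    (ContinuousAt.mul (by fun_prop) hτ)).mul (h2.sub h3)))

/-- The system is triangular: at $t=(bq^m)^{-1}$ all terms with $n>m$ vanish, those with $n<m$ are
zero by induction, and the factors with $a$ are nonzero since $a\notin bq^{\mathbb Z}$. -/
theorem eq_zero_of_sum_prod_eq_zero (hq : q ≠ 0) (hq1 : ‖q‖ < 1) {a b : ℂ} (hb : b ≠ 0)
    (hab : ∀ n : ℤ, b * q ^ n ≠ a) {v : Fin (M + 1) → ℂ} (h : ∀ t : ℂ,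
      ∑ n : Fin (M + 1), v n * ((∏ i ∈ range n, (1 - b * q ^ i * t)) *
        ∏ i ∈ Ico (n : ℕ) M, (1 - a * q ^ i * t)) = 0) : v = 0 := by
  have hqi : ∀ {i m : ℕ}, i < m → q ^ i ≠ q ^ m := fun {i m} him he => by
    have := congrArg norm he
    rw [norm_pow, norm_pow] at this
    exact him.ne' (pow_right_injective₀ (norm_pos_iff.2 hq) hq1.ne this).symm
  have key : ∀ (m : ℕ) (hm : m < M + 1), v ⟨m, hm⟩ = 0 := by
    intro m
    induction m using Nat.strong_induction_on with
    | _ m ih =>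
      intro hm
      have hbm : b * q ^ m ≠ 0 := mul_ne_zero hb (pow_ne_zero m hq)
      have h1 := h (b * q ^ m)⁻¹
      rw [Finset.sum_eq_single ⟨m, hm⟩] at h1
      · refine (mul_eq_zero.1 h1).resolve_right (mul_ne_zero (prod_ne_zero_iff.2 fun i hi => ?_)
          (prod_ne_zero_iff.2 fun i _ h2 => ?_))
        · rw [sub_ne_zero]
          intro h2
          refine hqi (mem_range.1 hi) (mul_left_cancel₀ hb ?_)
          rw [← div_eq_mul_inv, eq_div_iff hbm, one_mul] at h2
          exact h2.symm
        · apply hab (m - i)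
          rw [zpow_sub₀ hq, zpow_natCast, zpow_natCast]
          have := pow_ne_zero i hq
          have := pow_ne_zero m hq
          field_simp at h2 ⊢
          linear_combination h2
      · intro n _ hn
        rcases lt_trichotomy (n : ℕ) m with hlt | heq | hgt
        · rw [ih n hlt n.2, zero_mul]
        · exact absurd (Fin.ext heq) hn
        · rw [prod_eq_zero (mem_range.2 hgt) (by rw [mul_inv_cancel₀ hbm, sub_self]), zero_mul,
            mul_zero]
      · simp
  ext n
  exact key n n.2

theorem integrand_nsmul (hq : q ≠ 0) (hq1 : ‖q‖ < 1) {x : Param M} {t : ℂ}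
    (h : ∀ n : ℕ, x.2 0 * q ^ n * t ≠ 1) (n : ℕ) :
    (∏ i ∈ range n, (1 - x.1 0 * q ^ i * t)) *
      integrand q (shiftPoint q ((n : ℤ) • (sA 0 + sB 0)) x) t =
    (∏ i ∈ range n, (1 - x.2 0 * q ^ i * t)) * integrand q x t := by
  induction n with
  | zero => simp [shiftPoint]
  | succ n ih =>
    have h1 := integrand_eq_mul_shift_sA hq1 (shiftPoint q ((n : ℤ) • (sA 0 + sB 0)) x) 0 t
    have ha : (shiftPoint q ((n : ℤ) • (sA 0 + sB 0)) x).1 0 = x.1 0 * q ^ n := by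
      simp [shiftPoint, sA, sB, mul_comm]
    have hb : (shiftPoint q (sA 0) (shiftPoint q ((n : ℤ) • (sA 0 + sB 0)) x)).2 0 =
        x.2 0 * q ^ n := by
      simp [shiftPoint, sA, sB, mul_comm]
    have h2 := integrand_shift_sB hq1 (shiftPoint q (sA 0)
      (shiftPoint q ((n : ℤ) • (sA 0 + sB 0)) x)) 0 t (by rw [hb]; exact h n)
    rw [shiftPoint_shiftPoint hq, shiftPoint_shiftPoint hq, hb,
      show sB 0 + sA 0 + (n : ℤ) • (sA 0 + sB 0) = ((n + 1 : ℕ) : ℤ) • (sA 0 + sB 0 : Shift M) by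
        rw [Nat.cast_succ, add_smul, one_smul]; abel] at h2
    rw [prod_range_succ, prod_range_succ, h2]
    rw [ha] at h1
    rw [h1] at ih
    linear_combination (1 - x.2 0 * q ^ n * t) * ih

/-- Row $j$ reduces to values of shifted integrands at $t=q/a_i$. By `integrand_nsmul` their ratios
are quotients of the products in `eq_zero_of_sum_prod_eq_zero`, so a kernel vector yields a
polynomial `F` of degree at most $M$ that vanishes at $M+1$ points. -/
theorem IsPolar.det_casoratian_ne_zero (hq : q ≠ 0) (hq1 : ‖q‖ < 1) {x : Param M}
    (h : IsPolar q x) : (casoratian (M := M) q x).det ≠ 0 := by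
  intro hdet
  obtain ⟨v, hv, hv0⟩ := Matrix.exists_mulVec_eq_zero_iff.2 hdet
  have hq2 : 1 - q ≠ 0 := sub_ne_zero.2 fun h => by simp [← h] at hq1
  have hg0 : ∀ i : Fin (M + 3), (∀ j : Fin (M + 1), innerIndex j = i → i ≠ 0) := fun i j hj =>
    hj ▸ inner_ne_zero j
  have hroot : ∀ j : Fin (M + 1), ∑ n : Fin (M + 1), v n *
      ((∏ i ∈ range n, (1 - x.2 0 * q ^ i * (q / x.1 (innerIndex j)))) *
        ∏ i ∈ Ico (n : ℕ) M, (1 - x.1 0 * q ^ i * (q / x.1 (innerIndex j)))) = 0 := by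
    intro j
    set t := q / x.1 (innerIndex j) with ht
    have ht0 : t ≠ 0 := div_ne_zero hq (h.fst_ne_zero _)
    set X := shiftPoint q (sB (innerIndex j)) x with hX
    have hXa : X.1 0 = x.1 0 := by simp [hX, shiftPoint, sB]
    have hXb : X.2 0 = x.2 0 := by simp [hX, shiftPoint, sB, (inner_ne_zero j).symm]
    have hbt : ∀ n : ℕ, X.2 0 * q ^ n * t ≠ 1 := fun n hn => by
      apply h.generic (innerIndex j) 0 (hg0 _) (n + 1)
      have := h.fst_ne_zero (innerIndex j)
      rw [hXb, ht] at hn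
      rw [zpow_add₀ hq, zpow_one, zpow_natCast]
      field_simp at hn
      linear_combination hn
    have hI : integrand q X t ≠ 0 := by
      refine prod_ne_zero_iff.2 fun k _ => div_ne_zero ?_ ?_
      · have : X.1 k = x.1 k := by simp [hX, shiftPoint, sB]
        rw [this]
        exact h.qPoch_fst_ne_zero hq hq1 k j
      · by_cases hk : k = innerIndex j
        · have : X.2 k * t = q := by
            have := h.snd_ne_zero (innerIndex j)
            rw [ht, hk, h.inner_eq]
            simp [hX, shiftPoint, sB]
            field_simp
          rw [this]
          exact qPoch_q_ne_zero hq1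
        · have := h.qPoch_ne_zero hq hq1 (sB (innerIndex j)) 1 (i := innerIndex j) (k := k)
            fun _ _ => Ne.symm hk
          simpa using this
    have hz : 1 - x.2 (innerIndex j) * t = 0 := by
      have := h.snd_ne_zero (innerIndex j)
      rw [ht, h.inner_eq]
      field_simp
      ring
    have hrow := congrFun hv0 j
    simp only [Matrix.mulVec, dotProduct, Pi.zero_apply, casoratian] at hrow
    rw [← ht, hz] at hrow
    simp only [zero_mul, add_zero] at hrow
    have hsum : ∑ n : Fin (M + 1), v n *
        integrand q (shiftPoint q ((n : ℤ) • (sA 0 + sB 0)) X) t = 0 := by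
      refine (mul_eq_zero.1 (?_ : ((1 - q) * t) * _ = 0)).resolve_left (mul_ne_zero hq2 ht0)
      rw [mul_sum, ← hrow]
      refine sum_congr rfl fun n _ => ?_
      rw [hX, shiftPoint_shiftPoint hq, shiftPoint_shiftPoint hq, add_comm (sB (innerIndex j))]
      ring
    apply mul_left_cancel₀ hI
    -- Multiplication by all $M$ factors $1-a_1q^it$ clears every denominator at once; the $n$-th
    -- term keeps those with $i\ge n$.
    rw [mul_zero, mul_sum, ← mul_zero (∏ i ∈ range M, (1 - x.1 0 * q ^ i * t)), ← hsum, mul_sum]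
    refine sum_congr rfl fun n _ => ?_
    have h1 := integrand_nsmul hq hq1 hbt n
    rw [hXa, hXb] at h1
    rw [← prod_range_mul_prod_Ico _ (Nat.lt_succ_iff.1 n.2)]
    linear_combination -(v n * ∏ i ∈ Ico (n : ℕ) M, (1 - x.1 0 * q ^ i * t)) * h1
  let F : Polynomial ℂ := ∑ n : Fin (M + 1), Polynomial.C (v n) *
    ((∏ i ∈ range n, (1 - Polynomial.C (x.2 0 * q ^ i) * Polynomial.X)) *
      ∏ i ∈ Ico (n : ℕ) M, (1 - Polynomial.C (x.1 0 * q ^ i) * Polynomial.X))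
  have heval : ∀ t, F.eval t = ∑ n : Fin (M + 1), v n *
      ((∏ i ∈ range n, (1 - x.2 0 * q ^ i * t)) *
        ∏ i ∈ Ico (n : ℕ) M, (1 - x.1 0 * q ^ i * t)) := fun t => by
    simp [F, Polynomial.eval_finsetSum, Polynomial.eval_prod]
  have hlin : ∀ c : ℂ, (1 - Polynomial.C c * Polynomial.X).natDegree ≤ 1 := fun c =>
    (Polynomial.natDegree_sub_le _ _).trans (max_le (by simp)
      ((Polynomial.natDegree_C_mul_le _ _).trans Polynomial.natDegree_X_le))
  have hdeg : F.natDegree ≤ M := by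
    refine Polynomial.natDegree_sum_le_of_forall_le _ _ fun n _ => ?_
    refine (Polynomial.natDegree_C_mul_le _ _).trans (Polynomial.natDegree_mul_le.trans ?_)
    have h1 := (Polynomial.natDegree_prod_le (range n) fun i =>
      1 - Polynomial.C (x.2 0 * q ^ i) * Polynomial.X).trans
      (sum_le_card_nsmul _ _ 1 fun i _ => hlin _)
    have h2 := (Polynomial.natDegree_prod_le (Ico (n : ℕ) M) fun i =>
      1 - Polynomial.C (x.1 0 * q ^ i) * Polynomial.X).trans
      (sum_le_card_nsmul _ _ 1 fun i _ => hlin _)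
    rw [card_range] at h1
    rw [Nat.card_Ico] at h2
    have h3 := n.2
    simp only [smul_eq_mul, mul_one] at h1 h2
    omega
  have hinj : Function.Injective fun j : Fin (M + 1) => q / x.1 (innerIndex j) := by
    intro i j hij
    by_contra hne
    have h1 := h.fst_ne_zero (innerIndex i)
    have h2 := h.fst_ne_zero (innerIndex j)
    simp only at hij
    -- Two equal nodes would give $a_i=a_j=qb_j$, against genericity.
    refine h.generic (innerIndex i) (innerIndex j) (fun _ _ he => hne (inner_injective he)) 1 ?_
    rw [zpow_one, mul_comm, ← h.inner_eq]
    field_simp at hij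
    exact hij
  have hF : F = 0 := Polynomial.eq_zero_of_natDegree_lt_card_of_eval_eq_zero F hinj
    (fun j => by rw [heval, hroot j]) (by rw [Fintype.card_fin]; omega)
  refine hv (eq_zero_of_sum_prod_eq_zero hq hq1 (h.snd_ne_zero 0)
    (h.generic 0 0 fun j hj => absurd hj (inner_ne_zero j)) fun t => ?_)
  rw [← heval, hF, Polynomial.eval_zero]

end Casoratian

end QRP

namespace QRP

open Filter Topology

/-! ### Existence of polar points and linear independence -/

section Independence

variable {M : ℕ} {q : ℂ}

/-- The parameter on the hypersurface `a₁ ⋯ a_{M+3} = q² b₁ ⋯ b_{M+3}` with given independent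
coordinates. -/
noncomputable def pointOf (q : ℂ) (c : Fin (M + 2) ⊕ Fin (M + 3) → ℂ) : Param M :=
  (Fin.snoc (α := fun _ => ℂ) (fun i => c (Sum.inl i))
    (q ^ 2 * (∏ k, c (Sum.inr k)) / ∏ i, c (Sum.inl i)), fun k => c (Sum.inr k))

theorem evalAt_pointOf (c : Fin (M + 2) ⊕ Fin (M + 3) → ℂ) (p : Poly M) :
    evalAt (pointOf q c) p = MvPolynomial.eval c p := by
  rw [evalAt]
  congr 2
  ext i
  cases i <;> simp [pointOf]

theorem pointOf_rel {c : Fin (M + 2) ⊕ Fin (M + 3) → ℂ} (hc : ∀ i, c (Sum.inl i) ≠ 0) :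
    ∏ i, (pointOf q c).1 i = q ^ 2 * ∏ i, (pointOf q c).2 i := by
  have : ∏ i, c (Sum.inl i) ≠ 0 := prod_ne_zero_iff.2 fun i _ => hc i
  rw [Fin.prod_univ_castSucc]
  simp only [pointOf, Fin.snoc_castSucc, Fin.snoc_last]
  field_simp

theorem continuousAt_pointOf {c : Fin (M + 2) ⊕ Fin (M + 3) → ℂ} (hc : ∀ i, c (Sum.inl i) ≠ 0) :
    ContinuousAt (pointOf (M := M) q) c := by
  have : ∏ i, c (Sum.inl i) ≠ 0 := prod_ne_zero_iff.2 fun i _ => hc i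
  refine ContinuousAt.prodMk (continuousAt_pi.2 fun i => ?_)
    (continuousAt_pi.2 fun k => continuousAt_apply (Sum.inr k) c)
  induction i using Fin.lastCases with
  | cast i => simpa only [Fin.snoc_castSucc] using continuousAt_apply (Sum.inl i) c
  | last =>
    simp only [Fin.snoc_last]
    exact ContinuousAt.div (continuousAt_const.mul
      (tendsto_finsetProd _ fun k _ => continuousAt_apply (Sum.inr k) c))
      (tendsto_finsetProd _ fun i _ => continuousAt_apply (Sum.inl i) c) this

/-- All moduli are integral powers of $\rho=|q|^{1/(M+5)}$, so $b_kq^n=a_i$ forces a congruence of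
exponents modulo $M+5$. The $b_k$ take the residues $0,\dots,M+2$, $a_1$ takes $M+3$, the product
relation gives $a_{M+3}$ the residue $-1$, and each inner $a_i$ shares its residue with $b_i$ alone.
-/
theorem exists_isPolar (hq : q ≠ 0) (hq1 : ‖q‖ < 1) :
    ∃ c : Fin (M + 2) ⊕ Fin (M + 3) → ℂ, (∀ i, c (Sum.inl i) ≠ 0) ∧ IsPolar q (pointOf q c) := by
  obtain ⟨ρ, hρ0, hρ1, hρ⟩ : ∃ ρ : ℝ, 0 < ρ ∧ ρ < 1 ∧ ρ ^ (M + 5) = ‖q‖ := by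
    have h0 : 0 < ‖q‖ := norm_pos_iff.2 hq
    exact ⟨‖q‖ ^ (((M + 5 : ℕ) : ℝ)⁻¹), Real.rpow_pos_of_pos h0 _,
      Real.rpow_lt_one h0.le hq1 (by positivity), Real.rpow_inv_natCast_pow h0.le (by omega)⟩
  have hρc : (ρ : ℂ) ≠ 0 := by exact_mod_cast hρ0.ne'
  have hnρ : ‖(ρ : ℂ)‖ = ρ := by simp [abs_of_pos hρ0]
  let c : Fin (M + 2) ⊕ Fin (M + 3) → ℂ := Sum.elim
    (Fin.cons (ρ ^ (M + 3) : ℂ) fun j : Fin (M + 1) => q * ρ ^ ((j : ℕ) + 1))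
    fun k => (ρ : ℂ) ^ (k : ℕ)
  have hc : ∀ i, c (Sum.inl i) ≠ 0 := fun i => by
    induction i using Fin.cases with
    | zero => simp [c, hρc]
    | succ j => simp [c, hρc, hq]
  have hb : ∀ k, (pointOf q c).2 k = (ρ : ℂ) ^ (k : ℕ) := fun k => rfl
  have ha0 : (pointOf q c).1 0 = (ρ : ℂ) ^ (M + 3) := by
    rw [← Fin.castSucc_zero]
    simp only [pointOf, Fin.snoc_castSucc]
    simp [c]
  have hai : ∀ j, (pointOf q c).1 (innerIndex j) = q * (ρ : ℂ) ^ ((j : ℕ) + 1) := fun j => by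
    simp only [pointOf, innerIndex, Fin.snoc_castSucc]
    simp [c]
  have hal : (pointOf q c).1 (Fin.last _) * (ρ * q ^ (M + 1)) = q ^ 2 := by
    have h := pointOf_rel (q := q) hc
    rw [Fin.prod_univ_castSucc, Fin.prod_univ_succ, Fin.castSucc_zero, ha0] at h
    simp only [hb] at h
    have h1 : ∏ i : Fin (M + 1), (pointOf q c).1 i.succ.castSucc =
        q ^ (M + 1) * ∏ i : Fin (M + 1), (ρ : ℂ) ^ ((i : ℕ) + 1) := by
      have h2 := prod_congr (s₁ := univ) rfl fun j (_ : j ∈ univ) => hai j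
      rw [prod_mul_distrib, prod_const, card_univ, Fintype.card_fin] at h2
      exact h2
    have h2 : ∏ i : Fin (M + 3), (ρ : ℂ) ^ (i : ℕ) =
        (∏ i : Fin (M + 1), (ρ : ℂ) ^ ((i : ℕ) + 1)) * ρ ^ (M + 2) := by
      rw [Fin.prod_univ_castSucc, Fin.prod_univ_succ]
      simp
    rw [h1, h2] at h
    have h3 : (∏ i : Fin (M + 1), (ρ : ℂ) ^ ((i : ℕ) + 1)) * ρ ^ (M + 2) ≠ 0 :=
      mul_ne_zero (prod_ne_zero_iff.2 fun i _ => pow_ne_zero _ hρc) (pow_ne_zero _ hρc)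
    apply mul_right_cancel₀ h3
    rw [← h]
    ring
  have hal0 : (pointOf q c).1 (Fin.last _) ≠ 0 := fun h => by
    rw [h, zero_mul] at hal
    exact pow_ne_zero 2 hq hal.symm
  have hcases : ∀ i : Fin (M + 3), i = 0 ∨ (∃ j : Fin (M + 1), innerIndex j = i) ∨ i = Fin.last _ := by
    intro i
    induction i using Fin.lastCases with
    | last => exact Or.inr (Or.inr rfl)
    | cast i =>
      induction i using Fin.cases with
      | zero => exact Or.inl rfl
      | succ j => exact Or.inr (Or.inl ⟨j, rfl⟩)
  refine ⟨c, hc, ⟨pointOf_rel hc, fun i => ?_, fun k => ?_, fun j => ?_, ?_⟩⟩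
  · rcases hcases i with rfl | ⟨j, rfl⟩ | rfl
    · rw [ha0]; exact pow_ne_zero _ hρc
    · rw [hai]; exact mul_ne_zero hq (pow_ne_zero _ hρc)
    · exact hal0
  · rw [hb]; exact pow_ne_zero _ hρc
  · rw [hai, hb]; simp [innerIndex]
  · intro i k hik n hn
    obtain ⟨e, he, hdvd⟩ : ∃ e : ℤ, ‖(pointOf q c).1 i‖ = ρ ^ e ∧
        ¬ ((M + 5 : ℕ) : ℤ) ∣ e - (k : ℕ) := by
      have hk := k.2
      rcases hcases i with rfl | ⟨j, rfl⟩ | rfl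
      · refine ⟨(M + 3 : ℕ), by rw [ha0, norm_pow, hnρ, zpow_natCast], fun hd => ?_⟩
        have := Int.eq_zero_of_abs_lt_dvd hd (by rw [abs_lt]; constructor <;> push_cast <;> omega)
        push_cast at this
        omega
      · refine ⟨(M + 5 : ℕ) + ((j : ℕ) + 1 : ℕ), ?_, fun hd => ?_⟩
        · rw [hai, norm_mul, norm_pow, hnρ, zpow_add₀ hρ0.ne', zpow_natCast, zpow_natCast, hρ]
        · have hj := j.2
          rw [add_sub_assoc, dvd_add_right (dvd_refl _)] at hd
          have := Int.eq_zero_of_abs_lt_dvd hd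
            (by rw [abs_lt]; constructor <;> push_cast <;> omega)
          refine hik j rfl (Fin.ext ?_)
          simp [innerIndex]
          push_cast at this
          omega
      · refine ⟨(M + 5 : ℕ) * (1 - M) + (-1), ?_, fun hd => ?_⟩
        · have h1 := congrArg norm hal
          rw [norm_mul, norm_mul, norm_pow, norm_pow, hnρ] at h1
          have h2 : ‖q‖ ≠ 0 := norm_ne_zero_iff.2 hq
          rw [zpow_add₀ hρ0.ne', zpow_mul, zpow_natCast, hρ, zpow_sub₀ h2, zpow_one, zpow_neg_one,
            zpow_natCast]
          field_simp
          have h3 := pow_ne_zero M h2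
          apply mul_right_cancel₀ h2
          rw [← pow_two, ← h1]
          ring
        · rw [add_sub_assoc, dvd_add_right (dvd_mul_right _ _)] at hd
          have := Int.eq_zero_of_abs_lt_dvd hd
            (by rw [abs_lt]; constructor <;> push_cast <;> omega)
          omega
    apply hdvd
    have h1 := congrArg norm hn
    rw [hb, norm_mul, norm_pow, norm_zpow, hnρ, he, ← hρ, ← zpow_natCast, ← zpow_natCast,
      ← zpow_mul, ← zpow_add₀ hρ0.ne'] at h1
    have h2 := zpow_right_injective₀ hρ0 hρ1.ne h1
    exact ⟨n, by rw [← h2]; ring⟩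

theorem pointOf_innerIndex_fst (c : Fin (M + 2) ⊕ Fin (M + 3) → ℂ) (j : Fin (M + 1)) :
    (pointOf q c).1 (innerIndex j) = c (Sum.inl j.succ) := by
  simp only [pointOf, innerIndex, Fin.snoc_castSucc]

variable (M q) in
/-- The equation of the union of the hyperplanes `a_i = q b_i`, `i = innerIndex j`. -/
noncomputable def polarPoly : Poly M :=
  ∏ j : Fin (M + 1), (MvPolynomial.X (Sum.inl j.succ) -
    MvPolynomial.C q * MvPolynomial.X (Sum.inr (innerIndex j)))

theorem polarPoly_ne_zero : polarPoly M q ≠ 0 := by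
  refine prod_ne_zero_iff.2 fun j _ h => ?_
  have := congrArg (MvPolynomial.eval (Sum.elim 1 0)) h
  simp at this

theorem eval_polarPoly_ne_zero {c : Fin (M + 2) ⊕ Fin (M + 3) → ℂ}
    (h : MvPolynomial.eval c (polarPoly M q) ≠ 0) (j : Fin (M + 1)) :
    (pointOf q c).1 (innerIndex j) ≠ q * (pointOf q c).2 (innerIndex j) := by
  rw [pointOf_innerIndex_fst]
  rw [polarPoly, map_prod] at h
  have := prod_ne_zero_iff.1 h j (mem_univ j)
  rw [map_sub, map_mul, MvPolynomial.eval_X, MvPolynomial.eval_C, MvPolynomial.eval_X] at this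
  exact sub_ne_zero.1 this

theorem eventually_pointOf_mem_domain (hq : q ≠ 0) (hq1 : ‖q‖ < 1)
    {c : Fin (M + 2) ⊕ Fin (M + 3) → ℂ} (hc : ∀ i, c (Sum.inl i) ≠ 0)
    (h : IsPolar q (pointOf q c)) : ∀ᶠ z in 𝓝 c, MvPolynomial.eval z (polarPoly M q) ≠ 0 →
      pointOf q z ∈ domain q Set.univ := by
  have h1 : ∀ᶠ z in 𝓝 c, ∀ i, z (Sum.inl i) ≠ 0 := eventually_all.2 fun i =>
    (continuousAt_apply (Sum.inl i) c).eventually_ne (hc i)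
  filter_upwards [h1, (continuousAt_pointOf hc).eventually (h.eventually_mem_domain hq hq1)]
    with z h2 h3 h4
  exact h3 (pointOf_rel h2) (eval_polarPoly_ne_zero h4)

theorem domain_nonempty (hq : q ≠ 0) (hq1 : ‖q‖ < 1) : (domain (M := M) q Set.univ).Nonempty := by
  obtain ⟨c, hc, h⟩ := exists_isPolar (M := M) hq hq1
  by_contra hempty
  refine polarPoly_ne_zero (M := M) (q := q) (eq_zero_of_eventually_eval_eq_zero (c := c) ?_)
  filter_upwards [eventually_pointOf_mem_domain hq hq1 hc h] with z hz
  by_contra h0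
  exact hempty ⟨_, hz h0⟩

theorem eq_zero_of_sum_phi_eq_zero (hq : q ≠ 0) (hq1 : ‖q‖ < 1) {r : Shift M}
    (hr : r ∈ admissible M) {p : Fin (M + 1) → Poly M}
    (h : ∀ i j : Fin (M + 3), ∀ x ∈ domain q Set.univ, ∑ n : Fin (M + 1), evalAt x (p n) *
      phi q i j (shiftPoint q (r + (n : ℤ) • (sA 0 + sB 0)) x) = 0) (n : Fin (M + 1)) :
    p n = 0 := by
  have hr' : -r ∈ admissible M := by simpa using admissible_zsmul (-1) hr
  obtain ⟨c, hc, hx⟩ := exists_isPolar (M := M) hq hq1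
  have hdet : ∀ᶠ z in 𝓝 c, (casoratian q (pointOf q z)).det ≠ 0 := by
    have h1 : ContinuousAt (fun z => casoratian (M := M) q (pointOf q z)) c :=
      (hx.continuousAt_casoratian hq hq1).comp (continuousAt_pointOf hc)
    exact ((continuous_id.matrix_det).continuousAt.comp h1).eventually_ne
      (hx.det_casoratian_ne_zero hq hq1)
  -- Near `c` the matrix is invertible but the relations hold only off the polar hyperplanes; the
  -- factor `polarPoly` makes the product vanish on a full neighbourhood.
  have hzero : scale q (-r) (p n) * polarPoly M q = 0 := by
    refine eq_zero_of_eventually_eval_eq_zero (c := c) ?_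
    filter_upwards [hdet, eventually_pointOf_mem_domain hq hq1 hc hx] with z h1 h2
    rw [map_mul]
    by_cases h3 : MvPolynomial.eval z (polarPoly M q) = 0
    · rw [h3, mul_zero]
    · have hD := h2 h3
      have hv : (casoratian q (pointOf q z)).mulVec
          (fun n => evalAt (shiftPoint q (-r) (pointOf q z)) (p n)) = 0 := by
        ext j
        rw [Matrix.mulVec, dotProduct, Pi.zero_apply]
        have h4 := h 0 (innerIndex j) _ (shiftPoint_mem_domain hq hr' hD)
        calc _ = (1 - (pointOf q z).2 (innerIndex j) * (q / (pointOf q z).1 (innerIndex j))) *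
              ∑ n : Fin (M + 1), evalAt (shiftPoint q (-r) (pointOf q z)) (p n) *
                phi q 0 (innerIndex j) (shiftPoint q (r + (n : ℤ) • (sA 0 + sB 0))
                  (shiftPoint q (-r) (pointOf q z))) := by
              rw [mul_sum]
              refine sum_congr rfl fun n _ => ?_
              rw [casoratian_eq hq1 hD, shiftPoint_shiftPoint hq, add_right_comm, add_neg_cancel,
                zero_add]
              ring
          _ = 0 := by rw [h4, mul_zero]
      have h5 := congrFun (Matrix.eq_zero_of_mulVec_eq_zero h1 hv) n
      rw [← evalAt_pointOf (q := q), evalAt_scale, h5, Pi.zero_apply, zero_mul]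
  have hs := (mul_eq_zero.1 hzero).resolve_right polarPoly_ne_zero
  refine MvPolynomial.funext fun z => ?_
  -- `evalAt` sees only the independent coordinates, so this undoes the scaling for every `z`, even
  -- where the last coordinate of `pointOf` is a division by zero.
  have h6 := evalAt_scale (q := q) (-r) (p n) (shiftPoint q r (pointOf q z))
  rw [hs, map_zero, shiftPoint_shiftPoint hq, neg_add_cancel, shiftPoint_zero,
    evalAt_pointOf] at h6
  rw [← h6, map_zero]

theorem linearIndependent_shiftClass (hq : q ≠ 0) (hq1 : ‖q‖ < 1) {Sol : Set (Param M → ℂ)}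
    (hS : ∀ i j, phi q i j ∈ Sol) {r : Shift M} (hr : r ∈ admissible M) :
    LinearIndependent (RatFun M) fun n : Fin (M + 1) =>
      shiftClass q Sol (r + (n : ℤ) • (sA 0 + sB 0)) := by
  have hinj : Function.Injective fun n : Fin (M + 1) => r + (n : ℤ) • (sA 0 + sB 0 : Shift M) := by
    intro m n hmn
    have := congrFun (congrArg Prod.fst (add_left_cancel hmn)) 0
    simp [sA, sB] at this
    exact Fin.ext this
  rw [Fintype.linearIndependent_iff]
  intro g hg n
  set A : Shift M →₀ RatFun M :=
    ∑ n : Fin (M + 1), Finsupp.single (r + (n : ℤ) • (sA 0 + sB 0)) (g n) with hA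
  have hAmem : A ∈ vanishing q (domain q Set.univ) Sol := by
    rw [← Submodule.Quotient.mk_eq_zero, ← Submodule.mkQ_apply, ← hg, hA, map_sum]
    refine sum_congr rfl fun n _ => ?_
    rw [shiftClass, ← map_smul, Finsupp.smul_single, smul_eq_mul, mul_one]
  have hAn : ∀ n : Fin (M + 1), A (r + (n : ℤ) • (sA 0 + sB 0)) = g n := fun n => by
    rw [hA, Finsupp.finsetSum_apply, Finset.sum_eq_single n]
    · simp
    · intro m _ hm
      exact Finsupp.single_eq_of_ne fun h => hm (hinj h.symm)
    · simp
  obtain ⟨d, hd, P, hP, hK⟩ := hAmem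
  have hcoef : ∀ s, algebraMap (Poly M) (RatFun M) (P s) =
      algebraMap (Poly M) (RatFun M) d * A s := fun s => by
    have := DFunLike.congr_fun hP s
    rw [Finsupp.smul_apply, smul_eq_mul] at this
    rw [this]
    simp [toRat]
  -- `P` equals $d$ times `A`, so it has no terms outside the window and its relation is a sum over
  -- $0\le n\le M$.
  have hsupp : P.support ⊆ univ.map ⟨_, hinj⟩ := by
    intro s hs
    by_contra hns
    have h0 : A s = 0 := by
      rw [hA, Finsupp.finsetSum_apply]
      refine sum_eq_zero fun m _ => Finsupp.single_eq_of_ne fun h => hns ?_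
      rw [Finset.mem_map]
      exact ⟨m, mem_univ m, h.symm⟩
    have := hcoef s
    rw [h0, mul_zero, FaithfulSMul.algebraMap_eq_zero_iff] at this
    exact Finsupp.mem_support_iff.1 hs this
  have hp := eq_zero_of_sum_phi_eq_zero hq hq1 hr
    (p := fun n => P (r + (n : ℤ) • (sA 0 + sB 0))) (fun i j x hx => by
      have := hK _ (hS i j) x hx
      rw [Finsupp.sum_of_support_subset _ hsupp _ (by simp), sum_map] at this
      exact this) n
  have := hcoef (r + (n : ℤ) • (sA 0 + sB 0))
  rw [hp, map_zero, hAn] at this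
  refine (mul_eq_zero.1 this.symm).resolve_left ?_
  rwa [FaithfulSMul.algebraMap_eq_zero_iff]

end Independence

end QRP

theorem mainTheorem2 (M : ℕ) (q : ℂ) (hq0 : 0 < ‖q‖) (hq1 : ‖q‖ < 1) :
    -- the series defining the Jackson integrals converge
    (∀ (i : Fin (M + 3)), ∀ x ∈ QRP.domain q {i},
      Summable (QRP.jacksonTerm q (q / x.1 i) (QRP.integrand q x))) ∧
    -- the Jackson integrals satisfy the system
    (∀ i j : Fin (M + 3), QRP.SatisfiesRP q (QRP.domain q {i, j}) (QRP.phi q i j)) ∧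
    -- the system has rank `M + 1`, for every class `Y` of functions that contains the
    -- Jackson integrals, and for every set `S` of admissible shifts that contains `T_{a₁} T_{b₁}`
    (∀ Y : Set (QRP.Param M → ℂ), (∀ i j : Fin (M + 3), QRP.phi q i j ∈ Y) →
      ∀ S : Set (QRP.Shift M), S ⊆ QRP.admissible M → QRP.sA 0 + QRP.sB 0 ∈ S →
        QRP.HasRank q (QRP.domain q Set.univ)
          {y | y ∈ Y ∧ QRP.SatisfiesRP q (QRP.domain q Set.univ) y} S (M + 1)) := by
  have hq : q ≠ 0 := norm_pos_iff.1 hq0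
  refine ⟨fun i x _ => QRP.summable_jacksonTerm hq1 x _, QRP.satisfiesRP_phi hq hq1,
    fun Y hY S hS hτ => ?_⟩
  have hphi : ∀ i j : Fin (M + 3), QRP.phi q i j ∈
      {y | y ∈ Y ∧ QRP.SatisfiesRP q (QRP.domain q Set.univ) y} := fun i j => by
    have hD : QRP.domain (M := M) q Set.univ ⊆ QRP.domain q {i, j} :=
      QRP.domain_anti (Set.subset_univ _)
    have h := QRP.satisfiesRP_phi (M := M) hq hq1 i j
    exact ⟨hY i j, fun x hx => h.ordinary x (hD hx), fun x hx => h.three₁ x (hD hx),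
      fun x hx => h.three₂ x (hD hx), fun x hx => h.three₃ x (hD hx),
      fun x hx => h.three₄ x (hD hx), fun x hx => h.three₅ x (hD hx),
      fun x hx => h.three₆ x (hD hx), fun x hx => h.total x (hD hx)⟩
  exact QRP.hasRank_of_linearIndependent hq (QRP.domain_nonempty hq hq1) (fun y hy => hy.2)
    (fun r hr => QRP.linearIndependent_shiftClass hq hq1 hphi hr) hS hτ
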